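/- Theorem 2.3.3 [Lagrangian submanifold with transverse Lagrangian distribution]. Let $(M,\omega)$ be a smooth symplectic manifold of dimension $2m$ and let $N\subset M$ be a compact embedded Lagrangian submanifold (without boundary, of dimension $m$). Let $\Gamma_N=\{\Gamma_x\}_{x\in N}$ be a smooth distribution of tangent $m$-planes of $M$ along $N$ (a smooth rank $m$ subbundle of $TM|_N$) such that, for every $x\in N$, $\Gamma_x$ is a Lagrangian subspace of $(T_xM,\omega_x)$ and $\Gamma_x\cap T_xN=\{0\}$. Then there exist an open neighbourhood $U\subset T^*N$ of the zero section and a smooth embedding $\Phi:U\to M$ such that (i) $\Phi|_N=\mathrm{id}_N$, where $N$ is identified with the zero section of $T^*N$; (ii) $\Phi^*\omega=\omega_{can}$ on $U$, where $\omega_{can}$ is the canonical symplectic form on $T^*N$, i.e. $\omega_{can}=-d\lambda$ with $\lambda_{(x,\alpha)}(v)=\alpha(d\pi(v))$ and $\pi:T^*N\to N$ the projection (in canonical coordinates $\omega_{can}=\sum_i dq_i\wedge dp_i$); (iii) $\Phi_*\bigl(T_0(T^*_xN)\bigr)=\Gamma_x$ for all $x\in N$, where $T_0(T^*_xN)$ is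 the tangent space to the cotangent fibre $T^*_xN$ at the zero covector $0\in T^*_xN$. -/

import Mathlib

open Set Bundle Topology
open scoped Manifold ContDiff

noncomputable section

/-! ## Differential forms on manifolds without boundary

A `k`-form on `M` is a family `Ω x` of alternating `k`-linear forms on the tangent spaces. -/

section Forms

variable {E : Type*} [NormedAddCommGroup E] [NormedSpace ℝ E]
  {H : Type*} [TopologicalSpace H] (I : ModelWithCorners ℝ E H)
  {M : Type*} [TopologicalSpace M] [ChartedSpace H M]
  {E' : Type*} [NormedAddCommGroup E'] [NormedSpace ℝ E']
  {H' : Type*} [TopologicalSpace H'] (I' : ModelWithCorners ℝ E' H')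
  {M' : Type*} [TopologicalSpace M'] [ChartedSpace H' M']
  {k : ℕ}

/-- The pullback `f^* Ω` of a `k`-form `Ω` on `M'` under a map `f : M → M'`, at the point `x`. -/
def formPullback (f : M → M') (Ω : ∀ y : M', TangentSpace I' y [⋀^Fin k]→L[ℝ] ℝ) (x : M) :
    TangentSpace I x [⋀^Fin k]→L[ℝ] ℝ :=
  (Ω (f x)).compContinuousLinearMap (mfderiv I I' f x)

/-- The coordinate expression of a `k`-form in the preferred chart at `x₀`: the pullback of the
form under the inverse of the chart. It is meaningful on the target of the chart. -/
def formInChart (Ω : ∀ x : M, TangentSpace I x [⋀^Fin k]→L[ℝ] ℝ) (x₀ : M) :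
    E → E [⋀^Fin k]→L[ℝ] ℝ :=
  fun y => formPullback 𝓘(ℝ, E) I (extChartAt I x₀).symm Ω y

/-- A `k`-form is smooth if all its coordinate expressions are. -/
def IsSmoothForm (Ω : ∀ x : M, TangentSpace I x [⋀^Fin k]→L[ℝ] ℝ) : Prop :=
  ∀ x₀ : M, ContDiffOn ℝ ∞ (formInChart I Ω x₀) (extChartAt I x₀).target

/-- The exterior derivative of a `k`-form: at `x` it is the exterior derivative of the coordinate
expression in the chart at `x`, pulled back to the manifold by the chart. -/
def formExtDeriv (Ω : ∀ x : M, TangentSpace I x [⋀^Fin k]→L[ℝ] ℝ) (x : M) :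
    TangentSpace I x [⋀^Fin (k + 1)]→L[ℝ] ℝ :=
  formPullback I 𝓘(ℝ, E) (extChartAt I x) (fun y : E => extDeriv (E := E) (formInChart I Ω x) y) x

/-- A symplectic form: a smooth, closed, nondegenerate `2`-form. -/
structure IsSymplecticForm (Ω : ∀ x : M, TangentSpace I x [⋀^Fin 2]→L[ℝ] ℝ) : Prop where
  smooth : IsSmoothForm I Ω
  closed : ∀ x, formExtDeriv I Ω x = 0
  nondegenerate : ∀ (x : M) (v : TangentSpace I x), (∀ w, Ω x ![v, w] = 0) → v = 0

end Forms

/-- A subspace `L` is Lagrangian for an alternating form `β` if it equals its own `β`-orthogonal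
complement. -/
def IsLagrangianSubspace {V : Type*} [AddCommGroup V] [Module ℝ V] [TopologicalSpace V]
    (β : V [⋀^Fin 2]→L[ℝ] ℝ) (L : Submodule ℝ V) : Prop :=
  ∀ v, v ∈ L ↔ ∀ w ∈ L, β ![v, w] = 0

/-! ## The cotangent bundle and its canonical symplectic form -/

section Cotangent

variable {E : Type*} [NormedAddCommGroup E] [NormedSpace ℝ E]
  {H : Type*} [TopologicalSpace H] (I : ModelWithCorners ℝ E H)
  (N : Type*) [TopologicalSpace N] [ChartedSpace H N] [IsManifold I ∞ N]

/-- The total space of the cotangent bundle of `N`. -/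
abbrev CotangentBundle : Type _ :=
  TotalSpace (E →L[ℝ] ℝ) (fun x : N => TangentSpace I x →L[ℝ] ℝ)

/-- The model with corners of the cotangent bundle. -/
abbrev cotangentModel : ModelWithCorners ℝ (E × (E →L[ℝ] ℝ)) (ModelProd H (E →L[ℝ] ℝ)) :=
  I.prod 𝓘(ℝ, E →L[ℝ] ℝ)

variable {N}

/-- The tautological `1`-form on the cotangent bundle: at `p = (x, α)` it sends a tangent vector
`v` to `α (dπ v)`, where `π` is the projection to the base. -/
def tautologicalForm (p : CotangentBundle I N) :
    TangentSpace (cotangentModel I) p [⋀^Fin 1]→L[ℝ] ℝ :=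
  ContinuousAlternatingMap.ofSubsingleton ℝ (TangentSpace (cotangentModel I) p) ℝ (0 : Fin 1)
    (p.snd.comp (mfderiv (cotangentModel I) I (fun q : CotangentBundle I N => q.proj) p))

/-- The canonical symplectic form `-dλ` on the cotangent bundle, `λ` the tautological form
(in canonical coordinates `∑ dqᵢ ∧ dpᵢ`). -/
def canonicalForm (p : CotangentBundle I N) :
    TangentSpace (cotangentModel I) p [⋀^Fin 2]→L[ℝ] ℝ :=
  -formExtDeriv (cotangentModel I) (tautologicalForm I) p

/-- The point of the zero section over `x`. -/
def zeroCovector (x : N) : CotangentBundle I N := ⟨x, 0⟩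

/-- The tangent space at `p` to the cotangent fibre through `p`, as a subspace of the tangent space
of the cotangent bundle: the kernel of the differential of the projection to the base. -/
def fibreTangent (p : CotangentBundle I N) :
    Submodule ℝ (TangentSpace (cotangentModel I) p) :=
  (mfderiv (cotangentModel I) I (fun q : CotangentBundle I N => q.proj) p).ker

end Cotangent

/-! ## Distributions along a map -/

section Distribution

variable {E : Type*} [NormedAddCommGroup E] [NormedSpace ℝ E]
  {H : Type*} [TopologicalSpace H] (I : ModelWithCorners ℝ E H)
  {N : Type*} [TopologicalSpace N] [ChartedSpace H N]
  {E' : Type*} [NormedAddCommGroup E'] [NormedSpace ℝ E']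
  {H' : Type*} [TopologicalSpace H'] (J : ModelWithCorners ℝ E' H')
  {M : Type*} [TopologicalSpace M] [ChartedSpace H' M] [IsManifold J ∞ M]

/-- `Γ` is a smooth distribution of tangent `m`-planes of `M` along `f : N → M`, that is, a smooth
rank `m` subbundle of `f^* TM`: near each point of `N` there is a smooth frame of `m` vector fields
along `f` that spans `Γ`. -/
def IsSmoothDistributionAlong (m : ℕ) (f : N → M)
    (Γ : ∀ x : N, Submodule ℝ (TangentSpace J (f x))) : Prop :=
  ∀ x₀ : N, ∃ V ∈ 𝓝 x₀, ∃ s : Fin m → ∀ x : N, TangentSpace J (f x),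
    (∀ i, ContMDiffOn I J.tangent ∞ (fun x => (⟨f x, s i x⟩ : TangentBundle J M)) V) ∧
    ∀ x ∈ V, LinearIndependent ℝ (fun i => s i x) ∧
      Submodule.span ℝ (Set.range fun i => s i x) = Γ x

end Distribution

end

/-! The embedding is found as a germ along the zero section, corrected twice, and only at the end
restricted to a neighbourhood. The starting germ is `ι` composed with the projection, which already
has the right values.

First correction. Since `T_xN` is Lagrangian and `Γ_x` is transverse to it, `Ω` pairs the two
perfectly: every covector `p` at `x` equals `Ω(·, A p)` on `T_xN` for a unique `A p ∈ Γ_x`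
(`exists_dual_frame`). Having vertical derivative `A` along the zero section is equivalent to
sending vertical vectors into `Γ` and pulling `Ω` back to the canonical form at the points of the
zero section (`isFirstOrderAdapted_iff_fderiv`).

Second correction. In canonical coordinates the pulled back form is now `θ₀ + τ`, with `τ` closed
and zero on the zero section. Contracting the fibres gives `τ = dσ`, where `σ` and its first
derivative vanish on the zero section (`oneFormDeriv_fibreHomotopy`). Moser's field for a cut-off of
`σ` then vanishes there together with its derivative, so its flow fixes the zero section with
identity differential and does not disturb the tangency to `Γ` (`exists_local_moser`). The smooth
flow comes from solving the integral equation in a space of curves, after truncating the field to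
Lipschitz constant `1 / 2` (`exists_contDiff_flow`).

Both corrections are made in one chart of `N` at a time, and neither spoils a point where its goal
is already reached: the first adds a term that vanishes there, the second composes with a map that
is the identity near there. Compactness of `N` then lets finitely many of them be performed in
succession (`exists_forall_of_local_modification`), with no global vector field.

Finally, nondegeneracy and equality of dimensions make the germ a local diffeomorphism, and
injectivity on the compact zero section extends to a neighbourhood (`exists_isSmoothEmbedding`).
That vertical spaces map onto `Γ`, and not just into it, follows from the symplectic property
(`map_fibreTangent_eq`). -/

section

set_option linter.unusedSectionVars false
set_option maxSynthPendingDepth 3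

/-! ## Superposition operators -/

section Superposition

variable {K : Type} [TopologicalSpace K] [CompactSpace K]
  {V W W' : Type} [NormedAddCommGroup V] [NormedSpace ℝ V]
  [NormedAddCommGroup W] [NormedSpace ℝ W] [NormedAddCommGroup W'] [NormedSpace ℝ W']

/-- The pointwise application of a bilinear map to continuous functions. -/
noncomputable def ContinuousMap.pointwiseBilin (K : Type) [TopologicalSpace K] [CompactSpace K]
    (b : V →L[ℝ] W →L[ℝ] W') : C(K, V) →L[ℝ] C(K, W) →L[ℝ] C(K, W') :=
  LinearMap.mkContinuous₂
    (LinearMap.mk₂ ℝ (fun (A : C(K, V)) (h : C(K, W)) =>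
        (⟨fun t => b (A t) (h t), (b.continuous.comp A.continuous).clm_apply h.continuous⟩ : C(K, W')))
      (fun _ _ _ => by ext; simp) (fun _ _ _ => by ext; simp) (fun _ _ _ => by ext; simp)
      (fun _ _ _ => by ext; simp)) ‖b‖ (fun A h => by
        refine (ContinuousMap.norm_le _ (by positivity)).2 fun t => ?_
        calc _ ≤ ‖b‖ * ‖A t‖ * ‖h t‖ := b.le_opNorm₂ _ _
          _ ≤ ‖b‖ * ‖A‖ * ‖h‖ := by
            gcongr
            · exact A.norm_coe_le_norm t
            · exact h.norm_coe_le_norm t)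

@[simp] theorem ContinuousMap.pointwiseBilin_apply (b : V →L[ℝ] W →L[ℝ] W') (A : C(K, V))
    (h : C(K, W)) (t : K) : ContinuousMap.pointwiseBilin K b A h t = b (A t) (h t) := rfl

/-- The superposition operator `γ ↦ f ∘ γ` on continuous functions. -/
def superposition (K : Type) [TopologicalSpace K] (f : W → W') (hf : Continuous f)
    (γ : C(K, W)) : C(K, W') := (⟨f, hf⟩ : C(W, W')).comp γ

@[simp] theorem superposition_apply (f : W → W') (hf : Continuous f) (γ : C(K, W)) (t : K) :
    superposition K f hf γ t = f (γ t) := rfl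

theorem continuous_superposition (f : W → W') (hf : Continuous f) :
    Continuous (superposition K f hf) := ContinuousMap.continuous_postcomp _

/-- The mean value inequality on the segment from `γ t` to `γ t + k t` bounds the error by the
oscillation of `g` along it; continuity of the superposition operator of `g` at `γ` makes this small
uniformly in `t`. Writing the derivative through `b` exhibits it as a fixed linear operator applied
to another superposition. -/
theorem hasFDerivAt_superposition {f : W → W'} (hf : Continuous f) {g : W → V} (hg : Continuous g)
    {b : V →L[ℝ] W →L[ℝ] W'} (hfg : ∀ x, HasFDerivAt f (b (g x)) x) (γ : C(K, W)) :
    HasFDerivAt (superposition K f hf)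
      (ContinuousMap.pointwiseBilin K b (superposition K g hg γ)) γ := by
  rw [hasFDerivAt_iff_isLittleO_nhds_zero, Asymptotics.isLittleO_iff]
  intro ε hε
  -- The `+ 1` covers the case `b = 0`.
  obtain ⟨η, hη, hη'⟩ : ∃ η > 0, ‖b‖ * η ≤ ε :=
    ⟨ε / (‖b‖ + 1), by positivity, by
      rw [mul_div_assoc', div_le_iff₀ (by positivity)]; nlinarith [norm_nonneg b]⟩
  obtain ⟨δ, hδ, h⟩ := Metric.continuous_iff.1 (continuous_superposition (K := K) g hg) γ η hη
  filter_upwards [Metric.ball_mem_nhds (0 : C(K, W)) hδ] with k hk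
  rw [mem_ball_zero_iff] at hk
  refine (ContinuousMap.norm_le _ (by positivity)).2 fun t => ?_
  have key := Convex.norm_image_sub_le_of_norm_hasFDerivWithin_le' (f := f)
    (s := segment ℝ (γ t) (γ t + k t)) (f' := fun x => b (g x))
    (φ := b (g (γ t))) (C := ε) (x := γ t) (y := γ t + k t) (𝕜 := ℝ)
    (fun x _ => (hfg x).hasFDerivWithinAt) ?_ (convex_segment _ _)
    (left_mem_segment _ _ _) (right_mem_segment _ _ _)
  · simp only [add_sub_cancel_left] at key
    refine (le_trans (le_of_eq ?_) key).trans ?_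
    · simp
    · gcongr; exact k.norm_coe_le_norm t
  · intro x hx
    rw [segment_eq_image'] at hx
    obtain ⟨s, hs, rfl⟩ := hx
    have h1 := h (γ + s • k) (by
      rw [dist_eq_norm, add_sub_cancel_left, norm_smul, Real.norm_of_nonneg hs.1]
      exact lt_of_le_of_lt (mul_le_of_le_one_left (norm_nonneg _) hs.2) hk)
    rw [dist_eq_norm] at h1
    rw [← map_sub]
    refine (b.le_opNorm _).trans (le_trans ?_ hη')
    gcongr
    refine le_trans ?_ h1.le
    refine le_trans (le_of_eq ?_) (ContinuousMap.norm_coe_le_norm _ t)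
    simp

/-- The derivative is a bounded linear map composed with the superposition operator of `g`, so one
order of smoothness is gained. -/
theorem contDiff_succ_superposition {f : W → W'} (hf : Continuous f) {g : W → V} (hg : Continuous g)
    {b : V →L[ℝ] W →L[ℝ] W'} (hfg : ∀ x, HasFDerivAt f (b (g x)) x) {n : ℕ}
    (h : ContDiff ℝ n (superposition K g hg)) : ContDiff ℝ (n + 1) (superposition K f hf) := by
  have hd := hasFDerivAt_superposition (K := K) hf hg hfg
  refine contDiff_succ_iff_fderiv.2 ⟨fun γ => (hd γ).differentiableAt, by simp, ?_⟩
  rw [funext fun γ => (hd γ).fderiv]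
  exact (ContinuousLinearMap.contDiff _).comp h

/-- The target space is generalised in the induction because the next operator is superposition with
`fderiv ℝ f`, whose values lie in `W →L[ℝ] W'`. -/
theorem contDiff_nat_superposition (n : ℕ) : ∀ {W' : Type} [NormedAddCommGroup W']
    [NormedSpace ℝ W'] {f : W → W'} (hf : ContDiff ℝ n f),
    ContDiff ℝ n (superposition K f hf.continuous) := by
  induction n with
  | zero => intro W' _ _ f hf; exact contDiff_zero.2 (continuous_superposition _ _)
  | succ n ih =>
    intro W' _ _ f hf
    have h1 : ContDiff ℝ 1 f := hf.of_le (by exact_mod_cast Nat.le_add_left 1 n)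
    have h2 : ContDiff ℝ n (fderiv ℝ f) :=
      ((contDiff_succ_iff_fderiv (n := n)).1 (by exact_mod_cast hf)).2.2
    exact_mod_cast contDiff_succ_superposition hf.continuous h2.continuous
      (b := ContinuousLinearMap.id ℝ (W →L[ℝ] W'))
      (fun x => (h1.differentiable one_ne_zero x).hasFDerivAt) (ih h2)

theorem contDiff_superposition {f : W → W'} (hf : ContDiff ℝ ∞ f) :
    ContDiff ℝ ∞ (superposition K f hf.continuous) :=
  contDiff_infty.2 fun n => contDiff_nat_superposition n (contDiff_infty.1 hf n)

end Superposition

/-! ## Integration of continuous curves over the unit interval -/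

section Primitive

variable (Z : Type) [NormedAddCommGroup Z] [NormedSpace ℝ Z]

omit [NormedSpace ℝ Z] in
theorem continuous_comp_projIcc (γ : C(Icc (0:ℝ) 1, Z)) :
    Continuous fun s : ℝ => γ (projIcc 0 1 zero_le_one s) := γ.continuous.comp continuous_projIcc

/-- The primitive vanishing at `0` of a continuous curve on the unit interval. -/
noncomputable def unitIntervalPrimitive : C(Icc (0:ℝ) 1, Z) →L[ℝ] C(Icc (0:ℝ) 1, Z) :=
  LinearMap.mkContinuous
    { toFun := fun γ => ⟨fun t => ∫ s in (0:ℝ)..t, γ (projIcc 0 1 zero_le_one s),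
        (intervalIntegral.continuous_primitive
          (fun _ _ => (continuous_comp_projIcc Z γ).intervalIntegrable _ _) 0).comp
          continuous_subtype_val⟩
      map_add' := fun γ γ' => by
        ext t
        simp only [ContinuousMap.coe_mk, ContinuousMap.add_apply]
        exact intervalIntegral.integral_add ((continuous_comp_projIcc Z γ).intervalIntegrable _ _)
          ((continuous_comp_projIcc Z γ').intervalIntegrable _ _)
      map_smul' := fun c γ => by
        ext t
        simp [intervalIntegral.integral_smul] } 1 (fun γ => by
        rw [one_mul]
        refine (ContinuousMap.norm_le _ (by positivity)).2 fun t => ?_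
        refine (intervalIntegral.norm_integral_le_of_norm_le_const
          (C := ‖γ‖) fun s _ => γ.norm_coe_le_norm _).trans ?_
        rw [sub_zero, abs_of_nonneg t.2.1]
        exact mul_le_of_le_one_right (norm_nonneg _) t.2.2)

variable {Z}

theorem unitIntervalPrimitive_apply (γ : C(Icc (0:ℝ) 1, Z)) (t : Icc (0:ℝ) 1) :
    unitIntervalPrimitive Z γ t = ∫ s in (0:ℝ)..t, γ (projIcc 0 1 zero_le_one s) := rfl

/-- With constant `1`, the integral operator of the flow inherits the Lipschitz constant of the
vector field. -/
theorem norm_unitIntervalPrimitive_le (γ : C(Icc (0:ℝ) 1, Z)) :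
    ‖unitIntervalPrimitive Z γ‖ ≤ ‖γ‖ := by
  simpa using (unitIntervalPrimitive Z).le_of_opNorm_le
    (LinearMap.mkContinuous_norm_le _ zero_le_one _) γ

theorem hasDerivAt_unitIntervalPrimitive [CompleteSpace Z] (γ : C(Icc (0:ℝ) 1, Z))
    (t : Icc (0:ℝ) 1) :
    HasDerivAt (fun s : ℝ => ∫ r in (0:ℝ)..s, γ (projIcc 0 1 zero_le_one r)) (γ t) t := by
  have h := intervalIntegral.integral_hasDerivAt_right
    ((continuous_comp_projIcc Z γ).intervalIntegrable 0 t)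
    (continuous_comp_projIcc Z γ).stronglyMeasurable.stronglyMeasurableAtFilter
    (continuous_comp_projIcc Z γ).continuousAt
  simpa using h

end Primitive

section Curves

variable {Z W' : Type} [NormedAddCommGroup Z] [NormedSpace ℝ Z] [NormedAddCommGroup W']
  [NormedSpace ℝ W']

theorem exists_hasFDerivAt_superposition {K : Type} [TopologicalSpace K] [CompactSpace K]
    {f : Z → W'} (hf : ContDiff ℝ ∞ f) (γ : C(K, Z)) :
    ∃ A : C(K, Z) →L[ℝ] C(K, W'), HasFDerivAt (superposition K f hf.continuous) A γ ∧
      ∀ h t, A h t = fderiv ℝ f (γ t) (h t) :=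
  ⟨_, hasFDerivAt_superposition hf.continuous (hf.continuous_fderiv (by simp))
    (b := ContinuousLinearMap.id ℝ (Z →L[ℝ] W'))
    (fun x => (hf.differentiable (by simp) x).hasFDerivAt) γ, fun _ _ => rfl⟩

variable (Z) in
/-- Constant curves, as a continuous linear map. -/
noncomputable def constCurve : Z →L[ℝ] C(Icc (0:ℝ) 1, Z) :=
  LinearMap.mkContinuous
    { toFun := fun z => ContinuousMap.const _ z
      map_add' := fun _ _ => by ext; simp
      map_smul' := fun _ _ => by ext; simp } 1
    (fun z => (ContinuousMap.norm_le _ (by positivity)).2 fun t => by simp)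

@[simp] theorem constCurve_apply (z : Z) (t : Icc (0:ℝ) 1) : constCurve Z z t = z := rfl

variable (Z) in
/-- The graph `t ↦ (t, γ t)` of a curve `γ`. -/
noncomputable def curveGraph (γ : C(Icc (0:ℝ) 1, Z)) : C(Icc (0:ℝ) 1, ℝ × Z) :=
  (⟨fun t => ((t : ℝ), 0), by fun_prop⟩ : C(Icc (0:ℝ) 1, ℝ × Z)) +
    (ContinuousLinearMap.inr ℝ ℝ Z).compLeftContinuous ℝ (Icc (0:ℝ) 1) γ

@[simp] theorem curveGraph_apply (γ : C(Icc (0:ℝ) 1, Z)) (t : Icc (0:ℝ) 1) :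
    curveGraph Z γ t = ((t : ℝ), γ t) := by simp [curveGraph]

theorem hasFDerivAt_curveGraph (γ : C(Icc (0:ℝ) 1, Z)) : HasFDerivAt (curveGraph Z)
    ((ContinuousLinearMap.inr ℝ ℝ Z).compLeftContinuous ℝ (Icc (0:ℝ) 1)) γ :=
  (ContinuousLinearMap.hasFDerivAt _).const_add _

theorem contDiff_curveGraph : ContDiff ℝ ∞ (curveGraph Z) :=
  contDiff_const.add (ContinuousLinearMap.contDiff _)

/-! ### Integrals depending on a parameter -/

/-- The integral is a bounded functional applied to a superposition on the graph of a constant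
curve, so smoothness and differentiation under the integral sign are both instances of the chain
rule. -/
theorem contDiff_unitInterval_integral [CompleteSpace W'] {g : ℝ × Z → W'}
    (hg : ContDiff ℝ ∞ g) :
    ContDiff ℝ ∞ (fun z => ∫ t in (0:ℝ)..1, g (t, z)) ∧
    ∀ z, ∃ A : Z →L[ℝ] W', HasFDerivAt (fun z => ∫ t in (0:ℝ)..1, g (t, z)) A z ∧
      ∀ v, A v = ∫ t in (0:ℝ)..1, fderiv ℝ g (t, z) (0, v) := by
  let ev : C(Icc (0:ℝ) 1, W') →L[ℝ] W' :=
    (ContinuousMap.evalCLM ℝ (⟨1, by simp⟩ : Icc (0:ℝ) 1)).comp (unitIntervalPrimitive W')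
  have hev : ∀ (c : C(Icc (0:ℝ) 1, W')) (c' : ℝ → W'), (∀ t : Icc (0:ℝ) 1, c t = c' t) →
      ev c = ∫ t in (0:ℝ)..1, c' t := fun c c' h => by
    refine intervalIntegral.integral_congr fun t ht => ?_
    rw [uIcc_of_le zero_le_one] at ht
    simp only [projIcc_of_mem zero_le_one ht, h]
  have heq : (fun z => ∫ t in (0:ℝ)..1, g (t, z)) =
      ev ∘ superposition _ g hg.continuous ∘ curveGraph Z ∘ constCurve Z := by
    funext z
    exact (hev _ _ fun t => by simp).symm
  rw [heq]
  refine ⟨ev.contDiff.comp ((contDiff_superposition hg).comp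
    (contDiff_curveGraph.comp (constCurve Z).contDiff)), fun z => ?_⟩
  obtain ⟨A, hA, hA'⟩ := exists_hasFDerivAt_superposition hg (curveGraph Z (constCurve Z z))
  refine ⟨_, ev.hasFDerivAt.comp z (hA.comp z ((hasFDerivAt_curveGraph _).comp z
    (constCurve Z).hasFDerivAt)), fun v => ?_⟩
  exact hev _ _ fun t => by simp [hA']

/-! ### Flows of time-dependent vector fields with a small Lipschitz constant -/

variable [CompleteSpace Z]

/-- Neumann series. -/
theorem exists_continuousLinearEquiv_one_sub {E : Type*} [NormedAddCommGroup E] [NormedSpace ℝ E]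
    [CompleteSpace E] {A : E →L[ℝ] E} (hA : ‖A‖ < 1) :
    ∃ f' : E ≃L[ℝ] E, (f' : E →L[ℝ] E) = ContinuousLinearMap.id ℝ E - A :=
  ⟨ContinuousLinearEquiv.unitsEquiv ℝ E (Units.oneSub A hA), rfl⟩

/-- Flow curves solve `γ - S γ = constCurve Z z` with `S` a `1 / 2`-Lipschitz map, so `id - S` is a
homeomorphism of the space of curves. Its derivative is everywhere invertible since `‖fderiv ℝ S γ‖
< 1`, hence its inverse is smooth, and the initial point enters only through the linear map
`constCurve`. -/
theorem exists_contDiff_flow {X : ℝ × Z → Z} (hX : ContDiff ℝ ∞ X)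
    (hL : ∀ t, LipschitzWith (1 / 2) fun z => X (t, z)) :
    ∃ Γ : Z → C(Icc (0:ℝ) 1, Z), ContDiff ℝ ∞ Γ ∧
      (∀ z, Γ z = constCurve Z z +
        unitIntervalPrimitive Z (superposition _ X hX.continuous (curveGraph Z (Γ z)))) ∧
      ∀ z γ, γ = constCurve Z z +
        unitIntervalPrimitive Z (superposition _ X hX.continuous (curveGraph Z γ)) → γ = Γ z := by
  set S : C(Icc (0:ℝ) 1, Z) → C(Icc (0:ℝ) 1, Z) := fun γ =>
    unitIntervalPrimitive Z (superposition _ X hX.continuous (curveGraph Z γ)) with hS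
  have hSc : ContDiff ℝ ∞ S := (ContinuousLinearMap.contDiff _).comp
    ((contDiff_superposition hX).comp contDiff_curveGraph)
  have hSL : LipschitzWith (1 / 2) S := by
    refine LipschitzWith.of_dist_le_mul fun γ γ' => ?_
    rw [dist_eq_norm, dist_eq_norm, ← map_sub]
    refine (norm_unitIntervalPrimitive_le _).trans
      ((ContinuousMap.norm_le _ (by positivity)).2 fun t => ?_)
    have h1 := (hL t).dist_le_mul (γ t) (γ' t)
    rw [dist_eq_norm, dist_eq_norm] at h1
    refine le_trans (le_of_eq ?_) (h1.trans ?_)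
    · simp
    · gcongr
      exact (γ - γ').norm_coe_le_norm t
  have hT : ApproximatesLinearOn (fun γ => γ - S γ)
      (ContinuousLinearEquiv.refl ℝ C(Icc (0:ℝ) 1, Z) : _ →L[ℝ] _) univ (1 / 2) := by
    intro γ _ γ' _
    have h1 := hSL.dist_le_mul γ γ'
    rw [dist_eq_norm, dist_eq_norm] at h1
    have h2 : γ - S γ - (γ' - S γ') -
        (ContinuousLinearEquiv.refl ℝ C(Icc (0:ℝ) 1, Z) : _ →L[ℝ] _) (γ - γ') = -(S γ - S γ') := by
      change γ - S γ - (γ' - S γ') - (γ - γ') = _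
      abel
    rw [h2, norm_neg]
    exact h1
  -- The identity has norm `1` only on a nontrivial space, hence the two cases.
  have hc : Subsingleton C(Icc (0:ℝ) 1, Z) ∨ (1 / 2 : NNReal) <
      ‖((ContinuousLinearEquiv.refl ℝ C(Icc (0:ℝ) 1, Z)).symm :
        C(Icc (0:ℝ) 1, Z) →L[ℝ] C(Icc (0:ℝ) 1, Z))‖₊⁻¹ := by
    rcases subsingleton_or_nontrivial C(Icc (0:ℝ) 1, Z) with h | h
    · exact Or.inl h
    · right
      have : ‖((ContinuousLinearEquiv.refl ℝ C(Icc (0:ℝ) 1, Z)).symm :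
          C(Icc (0:ℝ) 1, Z) →L[ℝ] C(Icc (0:ℝ) 1, Z))‖₊ = 1 := by
        ext; exact ContinuousLinearMap.norm_id
      rw [this, inv_one]
      exact NNReal.half_lt_self one_ne_zero
  set e := hT.toHomeomorph _ hc with he
  have hecoe : ∀ γ, e γ = γ - S γ := fun _ => rfl
  have hsymm : ContDiff ℝ ∞ e.symm := by
    have hd : ∀ γ, ∃ f' : C(Icc (0:ℝ) 1, Z) ≃L[ℝ] C(Icc (0:ℝ) 1, Z), HasFDerivAt e (f' : _ →L[ℝ] _) γ := by
      intro γ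
      have h1 := (hSc.differentiable (by simp) γ).hasFDerivAt
      have h2 : ‖fderiv ℝ S γ‖ < 1 := lt_of_le_of_lt (h1.le_of_lipschitz hSL) (by norm_num)
      obtain ⟨f', hf'⟩ := exists_continuousLinearEquiv_one_sub h2
      exact ⟨f', by rw [hf']; exact (hasFDerivAt_id γ).sub h1⟩
    choose f' hf' using hd
    exact e.contDiff_symm hf' (contDiff_id.sub hSc)
  refine ⟨e.symm ∘ constCurve Z, hsymm.comp (constCurve Z).contDiff, fun z => ?_, fun z γ h => ?_⟩
  · have h1 : e (e.symm (constCurve Z z)) = constCurve Z z := e.apply_symm_apply _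
    rw [hecoe, sub_eq_iff_eq_add] at h1
    exact h1
  · have h1 : e γ = constCurve Z z := by rw [hecoe, sub_eq_iff_eq_add]; exact h
    simp [← h1]

/-- The properties of a global flow over the unit interval of a time-dependent vector field. -/
theorem exists_flow {X : ℝ × Z → Z} (hX : ContDiff ℝ ∞ X)
    (hL : ∀ t, LipschitzWith (1 / 2) fun z => X (t, z)) :
    ∃ Γ : Z → C(Icc (0:ℝ) 1, Z), ContDiff ℝ ∞ Γ ∧ (∀ z, Γ z ⟨0, by simp⟩ = z) ∧
      (∀ z, ∃ c : ℝ → Z, ∀ t : Icc (0:ℝ) 1, c t = Γ z t ∧ HasDerivAt c (X (t, Γ z t)) t) ∧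
      (∀ z v, fderiv ℝ Γ z v ⟨0, by simp⟩ = v ∧ ∃ c : ℝ → Z, ∀ t : Icc (0:ℝ) 1,
        c t = fderiv ℝ Γ z v t ∧
        HasDerivAt c (fderiv ℝ X (t, Γ z t) (0, fderiv ℝ Γ z v t)) t) ∧
      ∀ z, (∀ t ∈ Icc (0:ℝ) 1, X (t, z) = 0) → Γ z = constCurve Z z := by
  obtain ⟨Γ, hΓ, h1, h2⟩ := exists_contDiff_flow hX hL
  have hprim : ∀ (z : Z) (γ B : C(Icc (0:ℝ) 1, Z)), γ = constCurve Z z + unitIntervalPrimitive Z B →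
      γ ⟨0, by simp⟩ = z ∧ ∃ c : ℝ → Z, ∀ t : Icc (0:ℝ) 1, c t = γ t ∧ HasDerivAt c (B t) t := by
    rintro z γ B rfl
    exact ⟨by simp [unitIntervalPrimitive_apply],
      fun s : ℝ => z + ∫ r in (0:ℝ)..s, B (projIcc 0 1 zero_le_one r), fun t =>
        ⟨rfl, (hasDerivAt_unitIntervalPrimitive B t).const_add z⟩⟩
  have hfl := fun z => hprim z _ _ (h1 z)
  simp only [superposition_apply, curveGraph_apply] at hfl
  refine ⟨Γ, hΓ, fun z => (hfl z).1, fun z => (hfl z).2, fun z v => ?_, fun z hz => ?_⟩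
  · have hd := (hΓ.differentiable (by simp) z).hasFDerivAt
    obtain ⟨A, hA, hA'⟩ := exists_hasFDerivAt_superposition hX (curveGraph Z (Γ z))
    have h3 := (constCurve Z).hasFDerivAt.add ((unitIntervalPrimitive Z).hasFDerivAt.comp z
      (hA.comp z ((hasFDerivAt_curveGraph _).comp z hd)))
    -- Differentiating both sides of the integral equation in `z` gives the variational equation in
    -- integral form.
    have h4 := hd.unique (h3.congr_of_eventuallyEq (Filter.Eventually.of_forall h1))
    have h5 := hprim v (fderiv ℝ Γ z v)
      (A ((ContinuousLinearMap.inr ℝ ℝ Z).compLeftContinuous ℝ (Icc (0:ℝ) 1) (fderiv ℝ Γ z v)))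
      (by nth_rw 1 [h4]; rfl)
    simpa [hA'] using h5
  -- The constant curve solves the integral equation, whose solution is unique.
  · refine (h2 z _ ?_).symm
    have : superposition _ X hX.continuous (curveGraph Z (constCurve Z z)) = 0 := by
      ext t; simp [hz t t.2]
    rw [this]; simp

end Curves

/-! ## The fibrewise Poincaré lemma -/

section Poincare

variable {E F : Type} [NormedAddCommGroup E] [NormedSpace ℝ E] [NormedAddCommGroup F]
  [NormedSpace ℝ F]

variable (E F) in
/-- The projection of `E × F` to its second summand. -/
noncomputable def fibrePart : E × F →L[ℝ] E × F :=
  (ContinuousLinearMap.inr ℝ E F).comp (ContinuousLinearMap.snd ℝ E F)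

variable (E F) in
/-- The scaling `(q, p) ↦ (q, t p)`. -/
noncomputable def fibreScale (t : ℝ) : E × F →L[ℝ] E × F :=
  (ContinuousLinearMap.inl ℝ E F).comp (ContinuousLinearMap.fst ℝ E F) + t • fibrePart E F

@[simp] theorem fibrePart_apply (z : E × F) : fibrePart E F z = (0, z.2) := rfl

@[simp] theorem fibreScale_apply (t : ℝ) (z : E × F) : fibreScale E F t z = (z.1, t • z.2) := by
  simp [fibreScale]

theorem contDiff_fibreScale : ContDiff ℝ ∞ (fibreScale E F) :=
  contDiff_const.add (contDiff_id.smul contDiff_const)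

theorem hasDerivAt_fibreScale (t : ℝ) (z : E × F) :
    HasDerivAt (fun t => fibreScale E F t z) (fibrePart E F z) t := by
  have : HasDerivAt (fun t : ℝ => (ContinuousLinearMap.inl ℝ E F).comp
      (ContinuousLinearMap.fst ℝ E F) z + t • fibrePart E F z) ((1 : ℝ) • fibrePart E F z) t :=
    ((hasDerivAt_id t).smul_const _).const_add _
  simpa [fibreScale] using this

/-- The integrand of the homotopy operator. -/
noncomputable def fibreHomotopyIntegrand (τ : E × F → E × F →L[ℝ] E × F →L[ℝ] ℝ) (y : ℝ × (E × F)) :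
    E × F →L[ℝ] ℝ :=
  (τ (fibreScale E F y.1 y.2) (fibrePart E F y.2)).comp (fibreScale E F y.1)

/-- The homotopy operator of the fibrewise contraction of `E × F` to `E`, on `2`-forms. -/
noncomputable def fibreHomotopy (τ : E × F → E × F →L[ℝ] E × F →L[ℝ] ℝ) (z : E × F) :
    E × F →L[ℝ] ℝ :=
  ∫ t in (0:ℝ)..1, fibreHomotopyIntegrand τ (t, z)

/-- The bilinear form `dσ` of a one-form `σ`. -/
noncomputable def oneFormDeriv {Z : Type} [NormedAddCommGroup Z] [NormedSpace ℝ Z]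
    (σ : Z → Z →L[ℝ] ℝ) (z : Z) : Z →L[ℝ] Z →L[ℝ] ℝ :=
  fderiv ℝ σ z - (fderiv ℝ σ z).flip

/-- Closedness at a point of a `2`-form, given as a family of bilinear maps. -/
def IsClosedAt {Z : Type} [NormedAddCommGroup Z] [NormedSpace ℝ Z]
    (τ : Z → Z →L[ℝ] Z →L[ℝ] ℝ) (z : Z) : Prop :=
  ∀ a b c, fderiv ℝ τ z a b c - fderiv ℝ τ z b a c + fderiv ℝ τ z c a b = 0

theorem continuous_fderiv_apply₃ {Z : Type} [NormedAddCommGroup Z] [NormedSpace ℝ Z]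
    {τ : Z → Z →L[ℝ] Z →L[ℝ] ℝ} (hτ : ContDiff ℝ ∞ τ) {x a b c : ℝ → Z} (hx : Continuous x)
    (ha : Continuous a) (hb : Continuous b) (hc : Continuous c) :
    Continuous fun t => fderiv ℝ τ (x t) (a t) (b t) (c t) := by
  have h : Continuous fun t => fderiv ℝ τ (x t) := (hτ.continuous_fderiv (by simp)).comp hx
  exact ((h.clm_apply ha).clm_apply hb).clm_apply hc

variable {τ : E × F → E × F →L[ℝ] E × F →L[ℝ] ℝ}

theorem contDiff_fibreHomotopyIntegrand (hτ : ContDiff ℝ ∞ τ) :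
    ContDiff ℝ ∞ (fibreHomotopyIntegrand τ) := by
  have h1 : ContDiff ℝ ∞ fun y : ℝ × (E × F) => fibreScale E F y.1 :=
    contDiff_fibreScale.comp contDiff_fst
  exact ((hτ.comp (h1.clm_apply contDiff_snd)).clm_apply
    ((fibrePart E F).contDiff.comp contDiff_snd)).clm_comp h1

theorem contDiff_fibreHomotopy (hτ : ContDiff ℝ ∞ τ) : ContDiff ℝ ∞ (fibreHomotopy τ) :=
  (contDiff_unitInterval_integral (contDiff_fibreHomotopyIntegrand hτ)).1

/-- On the line `z + s • v` this is the product rule in one variable, with the last argument held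
fixed. -/
theorem fderiv_fibreHomotopyIntegrand (hτ : ContDiff ℝ ∞ τ) (t : ℝ) (z v b : E × F) :
    fderiv ℝ (fibreHomotopyIntegrand τ) (t, z) (0, v) b =
      fderiv ℝ τ (fibreScale E F t z) (fibreScale E F t v) (fibrePart E F z) (fibreScale E F t b) +
      τ (fibreScale E F t z) (fibrePart E F v) (fibreScale E F t b) := by
  have h1 : HasDerivAt (fun s : ℝ => z + s • v) v 0 := by
    simpa using ((hasDerivAt_id (0:ℝ)).smul_const v).const_add z
  have h2 : HasDerivAt (fun s : ℝ => fibreHomotopyIntegrand τ (t, z + s • v) b)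
      (fderiv ℝ (fibreHomotopyIntegrand τ) (t, z) (0, v) b) 0 := by
    have h3 := ((contDiff_fibreHomotopyIntegrand hτ).differentiable (by simp)
      (t, z + (0:ℝ) • v)).hasFDerivAt.comp_hasDerivAt (0:ℝ) ((hasDerivAt_const (0:ℝ) t).prodMk h1)
    have := h3.clm_apply (hasDerivAt_const (0:ℝ) b)
    simpa using this
  have h4 : HasDerivAt (fun s : ℝ => τ (fibreScale E F t (z + s • v)))
      (fderiv ℝ τ (fibreScale E F t z) (fibreScale E F t v)) 0 := by
    have h5 := (hτ.differentiable (by simp) (fibreScale E F t (z + (0:ℝ) • v))).hasFDerivAt.comp_hasDerivAt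
      (0:ℝ) ((fibreScale E F t).hasFDerivAt.comp_hasDerivAt (0:ℝ) h1)
    rw [zero_smul, add_zero] at h5
    exact h5
  have h6 := (h4.clm_apply ((fibrePart E F).hasFDerivAt.comp_hasDerivAt (0:ℝ) h1)).clm_apply
    (hasDerivAt_const (0:ℝ) (fibreScale E F t b))
  have h7 := h2.unique h6
  simpa using h7

theorem fderiv_fibreHomotopy (hτ : ContDiff ℝ ∞ τ) (z a b : E × F) :
    fderiv ℝ (fibreHomotopy τ) z a b = ∫ t in (0:ℝ)..1,
      (fderiv ℝ τ (fibreScale E F t z) (fibreScale E F t a) (fibrePart E F z) (fibreScale E F t b) +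
      τ (fibreScale E F t z) (fibrePart E F a) (fibreScale E F t b)) := by
  obtain ⟨A, hA, hA'⟩ :=
    (contDiff_unitInterval_integral (contDiff_fibreHomotopyIntegrand hτ)).2 z
  have hc : Continuous fun t : ℝ => fderiv ℝ (fibreHomotopyIntegrand τ) (t, z) (0, a) :=
    (((contDiff_fibreHomotopyIntegrand hτ).continuous_fderiv (by simp)).comp
      (by fun_prop : Continuous fun t : ℝ => (t, z))).clm_apply continuous_const
  have h1 : fderiv ℝ (fibreHomotopy τ) z = A := hA.fderiv
  rw [h1, hA', ContinuousLinearMap.intervalIntegral_apply (hc.intervalIntegrable _ _)]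
  simp only [fderiv_fibreHomotopyIntegrand hτ]

theorem fibreHomotopy_eq_zero {z : E × F}
    (h : ∀ t ∈ Icc (0:ℝ) 1, τ (fibreScale E F t z) = 0) : fibreHomotopy τ z = 0 := by
  rw [fibreHomotopy, intervalIntegral.integral_congr (g := fun _ => 0)]
  · simp
  · intro t ht
    rw [uIcc_of_le zero_le_one] at ht
    simp only [fibreHomotopyIntegrand, h t ht, zero_apply,
      ContinuousLinearMap.zero_comp]

/-- Both terms of the integrand carry a vanishing factor: the fibre part of `(q, 0)` in one, the
value of `τ` in the other. This is what makes Moser's flow tangent to the identity along the zero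
section. -/
theorem fderiv_fibreHomotopy_zeroSection (hτ : ContDiff ℝ ∞ τ) (h0 : ∀ q, τ (q, 0) = 0) (q : E) :
    fderiv ℝ (fibreHomotopy τ) (q, 0) = 0 := by
  refine ContinuousLinearMap.ext fun a => ContinuousLinearMap.ext fun b => ?_
  rw [fderiv_fibreHomotopy hτ]
  simp [h0, Prod.mk_zero_zero]

theorem fibreHomotopy_zeroSection (h0 : ∀ q, τ (q, 0) = 0) (q : E) :
    fibreHomotopy τ (q, 0) = 0 := fibreHomotopy_eq_zero fun t _ => by simp [h0]

/-- The fibrewise Poincaré lemma for `2`-forms vanishing along the zero section. -/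
theorem oneFormDeriv_fibreHomotopy (hτ : ContDiff ℝ ∞ τ) (hanti : ∀ z a b, τ z a b = -τ z b a)
    (h0 : ∀ q, τ (q, 0) = 0) {z : E × F}
    (hcl : ∀ t ∈ Icc (0:ℝ) 1, IsClosedAt τ (fibreScale E F t z)) :
    oneFormDeriv (fibreHomotopy τ) z = τ z := by
  refine ContinuousLinearMap.ext fun a => ContinuousLinearMap.ext fun b => ?_
  have hcM : ∀ w, Continuous fun t : ℝ => fibreScale E F t w := fun w =>
    (contDiff_fibreScale (E := E) (F := F)).continuous.clm_apply continuous_const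
  have hcτ : Continuous fun t : ℝ => τ (fibreScale E F t z) := hτ.continuous.comp (hcM z)
  have hci : ∀ a b, Continuous fun t : ℝ =>
      fderiv ℝ τ (fibreScale E F t z) (fibreScale E F t a) (fibrePart E F z) (fibreScale E F t b) +
      τ (fibreScale E F t z) (fibrePart E F a) (fibreScale E F t b) := fun a b =>
    (continuous_fderiv_apply₃ hτ (hcM z) (hcM a) continuous_const (hcM b)).add
      ((hcτ.clm_apply continuous_const).clm_apply (hcM b))
  -- The antisymmetrised integrand is the `t`-derivative of the pullback of `τ` by `fibreScale E F
  -- t`: closedness replaces the derivative of `τ` in the direction `fibrePart E F z` by the two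
  -- derivatives in the integrand.
  have key : ∀ t ∈ uIcc (0:ℝ) 1,
      HasDerivAt (fun t => τ (fibreScale E F t z) (fibreScale E F t a) (fibreScale E F t b))
      ((fderiv ℝ τ (fibreScale E F t z) (fibreScale E F t a) (fibrePart E F z) (fibreScale E F t b) +
      τ (fibreScale E F t z) (fibrePart E F a) (fibreScale E F t b)) -
      (fderiv ℝ τ (fibreScale E F t z) (fibreScale E F t b) (fibrePart E F z) (fibreScale E F t a) +
      τ (fibreScale E F t z) (fibrePart E F b) (fibreScale E F t a))) t := by
    intro t ht
    rw [uIcc_of_le zero_le_one] at ht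
    have h1 := (hτ.differentiable (by simp) (fibreScale E F t z)).hasFDerivAt.comp_hasDerivAt t
      (hasDerivAt_fibreScale t z)
    have h2 := (h1.clm_apply (hasDerivAt_fibreScale t a)).clm_apply (hasDerivAt_fibreScale t b)
    refine h2.congr_deriv ?_
    have h3 := hcl t ht (fibrePart E F z) (fibreScale E F t a) (fibreScale E F t b)
    have h4 := hanti (fibreScale E F t z) (fibrePart E F b) (fibreScale E F t a)
    simp only [Function.comp_apply, add_apply]
    linarith
  have hint := intervalIntegral.integral_eq_sub_of_hasDerivAt key
    (((hci a b).sub (hci b a)).intervalIntegrable _ _)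
  rw [intervalIntegral.integral_sub ((hci a b).intervalIntegrable _ _)
    ((hci b a).intervalIntegrable _ _), ← fderiv_fibreHomotopy hτ, ← fderiv_fibreHomotopy hτ] at hint
  simp only [oneFormDeriv, sub_apply, ContinuousLinearMap.flip_apply]
  -- At `t = 0` the scaled point is on the zero section, so only the value at `t = 1` survives.
  rw [hint]
  simp [h0]

end Poincare

/-! ## Moser's method -/

section Moser

/-- The identity times a bump function; compact support supplies the Lipschitz constant. -/
theorem exists_smooth_truncation (F : Type) [NormedAddCommGroup F] [NormedSpace ℝ F]
    [FiniteDimensional ℝ F] : ∃ (r : F → F) (C : NNReal), ContDiff ℝ ∞ r ∧ LipschitzWith C r ∧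
      (∀ p, ‖p‖ ≤ 1 → r p = p) ∧ ∀ p, ‖r p‖ ≤ 2 := by
  let b : ContDiffBump (0 : F) := ⟨1, 2, one_pos, one_lt_two⟩
  have hb : ContDiff ℝ ∞ fun p => b p • p := b.contDiff.smul contDiff_id
  have hs : HasCompactSupport fun p => b p • p := b.hasCompactSupport.smul_right
  obtain ⟨C, hC⟩ := hb.lipschitzWith_of_hasCompactSupport hs (by simp)
  refine ⟨_, C, hb, hC, fun p hp => ?_, fun p => ?_⟩
  · have : b p = 1 := b.one_of_mem_closedBall (by simpa using hp)
    simp [this]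
  · rcases le_or_gt ‖p‖ 2 with h | h
    · rw [norm_smul, Real.norm_of_nonneg b.nonneg]
      exact (mul_le_of_le_one_left (norm_nonneg _) b.le_one).trans h
    · have : b p = 0 := b.zero_of_le_dist (by simpa using h.le)
      simp [this]

/-- A smooth truncation at scale `ε`, with a Lipschitz constant which does not depend on `ε`. -/
theorem exists_smooth_truncation_scaled (F : Type) [NormedAddCommGroup F] [NormedSpace ℝ F]
    [FiniteDimensional ℝ F] : ∃ C : NNReal, ∀ ε : ℝ, 0 < ε → ∃ r : F → F, ContDiff ℝ ∞ r ∧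
      LipschitzWith C r ∧ (∀ p, ‖p‖ ≤ ε → r p = p) ∧ ∀ p, ‖r p‖ ≤ 2 * ε := by
  obtain ⟨r, C, h1, h2, h3, h4⟩ := exists_smooth_truncation F
  refine ⟨C, fun ε hε => ⟨fun p => ε • r (ε⁻¹ • p),
    (h1.comp (contDiff_id.const_smul ε⁻¹)).const_smul ε, ?_, fun p hp => ?_, fun p => ?_⟩⟩
  · refine LipschitzWith.of_dist_le_mul fun p p' => ?_
    rw [dist_smul₀, Real.norm_of_nonneg hε.le]
    calc ε * dist (r (ε⁻¹ • p)) (r (ε⁻¹ • p')) ≤ ε * (C * dist (ε⁻¹ • p) (ε⁻¹ • p')) := by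
          gcongr; exact h2.dist_le_mul _ _
      _ = C * dist p p' := by
          rw [dist_smul₀, Real.norm_of_nonneg (inv_nonneg.2 hε.le)]
          field_simp
  · have : ‖ε⁻¹ • p‖ ≤ 1 := by
      rw [norm_smul, Real.norm_of_nonneg (inv_nonneg.2 hε.le), inv_mul_le_iff₀ hε]
      simpa using hp
    simp [h3 _ this, smul_smul, hε.ne']
  · rw [norm_smul, Real.norm_of_nonneg hε.le, mul_comm]
    gcongr
    exact h4 _

variable {Z : Type} [NormedAddCommGroup Z] [NormedSpace ℝ Z]

theorem contDiff_oneFormDeriv {s : Z → Z →L[ℝ] ℝ} (hs : ContDiff ℝ ∞ s) :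
    ContDiff ℝ ∞ (oneFormDeriv s) := by
  have h : ContDiff ℝ ∞ (fderiv ℝ s) := hs.fderiv_right (by simp)
  exact h.sub ((ContinuousLinearMap.flipₗᵢ ℝ Z Z ℝ).toContinuousLinearEquiv.contDiff.comp h)

theorem oneFormDeriv_antisymm (s : Z → Z →L[ℝ] ℝ) (z a b : Z) :
    oneFormDeriv s z a b = -oneFormDeriv s z b a := by
  simp [oneFormDeriv]

/-- This is `d ∘ d = 0`: the six second-derivative terms cancel in pairs by symmetry. -/
theorem isClosedAt_oneFormDeriv {s : Z → Z →L[ℝ] ℝ} (hs : ContDiff ℝ ∞ s) (z : Z) :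
    IsClosedAt (oneFormDeriv s) z := by
  have h : DifferentiableAt ℝ (fderiv ℝ s) z :=
    (hs.fderiv_right (m := ∞) (by simp)).differentiable (by simp) z
  have hsym : IsSymmSndFDerivAt ℝ s z :=
    hs.contDiffAt.isSymmSndFDerivAt (by
      simpa using (mod_cast le_top : ((2 : ℕ∞) : WithTop ℕ∞) ≤ ((⊤ : ℕ∞) : WithTop ℕ∞)))
  have hd : ∀ v a b, fderiv ℝ (oneFormDeriv s) z v a b =
      fderiv ℝ (fderiv ℝ s) z v a b - fderiv ℝ (fderiv ℝ s) z v b a := by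
    intro v a b
    let fl : (Z →L[ℝ] Z →L[ℝ] ℝ) →L[ℝ] (Z →L[ℝ] Z →L[ℝ] ℝ) :=
      (ContinuousLinearMap.flipₗᵢ ℝ Z Z ℝ).toContinuousLinearEquiv
    have h1 : HasFDerivAt (oneFormDeriv s) (fderiv ℝ (fderiv ℝ s) z -
        fl.comp (fderiv ℝ (fderiv ℝ s) z)) z :=
      h.hasFDerivAt.sub (fl.hasFDerivAt.comp z h.hasFDerivAt)
    rw [h1.fderiv]
    rfl
  intro a b c
  rw [hd, hd, hd, hsym a b, hsym a c, hsym b c]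
  ring

/-- The derivative of the pullback of a family of closed `2`-forms along Moser's flow vanishes. -/
theorem hasDerivAt_moser {θ : Z → Z →L[ℝ] Z →L[ℝ] ℝ} {s : Z → Z →L[ℝ] ℝ} (hs : ContDiff ℝ ∞ s)
    (hanti : ∀ z a b, θ z a b = -θ z b a) {X : Z → Z} {c y w : ℝ → Z} {t : ℝ}
    (hθ : DifferentiableAt ℝ θ (c t)) (hcl : IsClosedAt θ (c t)) (hX : DifferentiableAt ℝ X (c t))
    (hXs : ∀ᶠ z in 𝓝 (c t), (θ z - (1 - t) • oneFormDeriv s z) (X z) = -s z)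
    (hc : HasDerivAt c (X (c t)) t) (hy : HasDerivAt y (fderiv ℝ X (c t) (y t)) t)
    (hw : HasDerivAt w (fderiv ℝ X (c t) (w t)) t) :
    HasDerivAt (fun t => (θ (c t) - (1 - t) • oneFormDeriv s (c t)) (y t) (w t)) 0 t := by
  have hβd : DifferentiableAt ℝ (oneFormDeriv s) (c t) :=
    (contDiff_oneFormDeriv hs).differentiable (by simp) _
  have hβcl := isClosedAt_oneFormDeriv hs (c t)
  have hβanti := oneFormDeriv_antisymm s
  set β := oneFormDeriv s with hβ
  have h1 := hθ.hasFDerivAt.comp_hasDerivAt t hc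
  have h2 := hβd.hasFDerivAt.comp_hasDerivAt t hc
  have h3 : HasDerivAt (fun t : ℝ => 1 - t) (-1) t := by
    simpa using (hasDerivAt_id t).const_sub 1
  have h4 := ((h1.sub (h3.smul h2)).clm_apply hy).clm_apply hw
  refine HasDerivAt.congr_deriv h4 ?_
  -- Moser's equation holds on a neighbourhood at the fixed time `t`, so it may be differentiated in
  -- space. This controls the terms with `fderiv ℝ X` produced by the two variational equations.
  have h5 : ∀ a b, (fderiv ℝ θ (c t) a - (1 - t) • fderiv ℝ β (c t) a) (X (c t)) b +
      (θ (c t) - (1 - t) • β (c t)) (fderiv ℝ X (c t) a) b = -fderiv ℝ s (c t) a b := by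
    intro a b
    have e1 := ((hθ.hasFDerivAt.sub (hβd.hasFDerivAt.const_smul (1 - t))).clm_apply
      hX.hasFDerivAt)
    have e2 := (hs.differentiable (by simp) (c t)).hasFDerivAt.neg
    have e3 := congrArg (fun L => L a b) (e1.unique (e2.congr_of_eventuallyEq hXs))
    simp at e3 ⊢
    linarith
  have h6 := h5 (y t) (w t)
  have h7 := h5 (w t) (y t)
  have h8 := hcl (X (c t)) (y t) (w t)
  have h9 := hβcl (X (c t)) (y t) (w t)
  have h10 := hanti (c t) (y t) (fderiv ℝ X (c t) (w t))
  have h11 := hβanti (c t) (y t) (fderiv ℝ X (c t) (w t))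
  have h12 : β (c t) (y t) (w t) = fderiv ℝ s (c t) (y t) (w t) - fderiv ℝ s (c t) (w t) (y t) := by
    simp [hβ, oneFormDeriv]
  simp only [sub_apply, add_apply, smul_apply, smul_eq_mul, Function.comp_apply, Pi.sub_apply,
    Pi.smul_apply'] at *
  simp only [h10, h11, h12]
  -- Cartan's formula: closedness (`h8`, `h9`) rewrites the derivatives along `X`, and `h6 - h7`
  -- contributes `-β`, which cancels the time derivative `β` of the family.
  linear_combination h6 - h7 + h8 - (1 - t) * h9

end Moser

/-! ### Truncation of a time-dependent field near the zero section -/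

section LocalMoser

variable {E F : Type} [NormedAddCommGroup E] [NormedSpace ℝ E] [FiniteDimensional ℝ E]
  [NormedAddCommGroup F] [NormedSpace ℝ F] [FiniteDimensional ℝ F]

/-- Truncation of a vector field that vanishes to second order along the zero section. -/
theorem exists_truncated_field {Y : ℝ × (E × F) → E × F} {O : Set (ℝ × (E × F))} (hO : IsOpen O)
    (hY : ContDiffOn ℝ ∞ Y O) (hO0 : ∀ t q, (t, (q, (0 : F))) ∈ O)
    (hD0 : ∀ t q, fderiv ℝ Y (t, (q, (0 : F))) = 0) {K : Set E} (hK : IsCompact K)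
    (hKO : ∀ t q p, q ∉ K → (t, (q, p)) ∈ O) (hKY : ∀ t q p, q ∉ K → fderiv ℝ Y (t, (q, p)) = 0) :
    ∃ (ε : ℝ) (X : ℝ × (E × F) → E × F), 0 < ε ∧ ContDiff ℝ ∞ X ∧
      (∀ t, LipschitzWith (1 / 2) fun z => X (t, z)) ∧
      (∀ t q p, t ∈ Icc (0:ℝ) 1 → ‖p‖ ≤ ε → X (t, (q, p)) = Y (t, (q, p)) ∧ (t, (q, p)) ∈ O) ∧
      ∀ t q p, ∃ t' p', X (t, (q, p)) = Y (t', (q, p')) ∧ (‖p‖ ≤ ε → p' = p) := by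
  obtain ⟨C, hC⟩ := exists_smooth_truncation_scaled F
  obtain ⟨D, hD⟩ := exists_smooth_truncation_scaled ℝ
  -- A bound `c` on `fderiv ℝ Y` times the Lipschitz constant `1 + C` of the truncated argument
  -- gives `1 / 2`. Since `C` does not depend on the scale, `c` can be fixed before `ε`.
  set c : NNReal := (2 * (1 + C))⁻¹ with hc
  have hc0 : 0 < c := by positivity
  have hfc : ContinuousOn (fderiv ℝ Y) O := hY.continuousOn_fderiv_of_isOpen hO (by simp)
  set O' := O ∩ fderiv ℝ Y ⁻¹' (Metric.ball 0 c) with hO'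
  have hO'o : IsOpen O' := hfc.isOpen_inter_preimage hO Metric.isOpen_ball
  have hsub : (Icc (-2:ℝ) 2) ×ˢ (K ×ˢ ({0} : Set F)) ⊆ O' := by
    rintro ⟨t, q, p⟩ ⟨_, _, hp⟩
    rw [mem_singleton_iff] at hp
    simp only at hp
    subst hp
    exact ⟨hO0 t q, by simp [hD0, hc0]⟩
  -- Time is truncated too, at scale `1`: it then stays in `Icc (-2) 2`, a compact set, and is
  -- unchanged on the unit interval.
  obtain ⟨ε, hε, hεO⟩ : ∃ ε > 0, ∀ t ∈ Icc (-2:ℝ) 2, ∀ q, ∀ p : F, ‖p‖ ≤ 2 * ε → (t, (q, p)) ∈ O' := by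
    have hcomp : IsCompact ((Icc (-2:ℝ) 2) ×ˢ (K ×ˢ ({0} : Set F))) :=
      isCompact_Icc.prod (hK.prod isCompact_singleton)
    obtain ⟨δ, hδ, h⟩ := hcomp.exists_thickening_subset_open hO'o hsub
    refine ⟨δ / 4, by positivity, fun t ht q p hp => ?_⟩
    by_cases hq : q ∈ K
    · refine h (Metric.mem_thickening_iff.2 ⟨(t, (q, 0)), ⟨ht, hq, rfl⟩, ?_⟩)
      simp only [Prod.dist_eq, dist_self, dist_zero_right]
      simp only [norm_nonneg, sup_of_le_right]
      linarith
    -- Off `K` the bound holds for every `p`, which compensates for the noncompactness of `E`.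
    · exact ⟨hKO t q p hq, by simp [hKY t q p hq, hc0]⟩
  obtain ⟨r, hr1, hr2, hr3, hr4⟩ := hC ε hε
  obtain ⟨ρ, hρ1, hρ2, hρ3, hρ4⟩ := hD 1 one_pos
  have hρm : ∀ t, ρ t ∈ Icc (-2:ℝ) 2 := fun t => by
    have := hρ4 t
    rw [Real.norm_eq_abs, mul_one] at this
    exact abs_le.1 this
  refine ⟨ε, fun y => Y (ρ y.1, (y.2.1, r y.2.2)), hε, ?_, fun t => ?_, fun t q p ht hp => ?_,
    fun t q p => ⟨ρ t, r p, rfl, hr3 p⟩⟩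
  · rw [contDiff_iff_contDiffAt]
    intro y
    have h1 : ContDiffAt ℝ ∞ Y (ρ y.1, (y.2.1, r y.2.2)) :=
      hY.contDiffAt (hO.mem_nhds (hεO _ (hρm _) _ _ (hr4 _)).1)
    exact h1.comp y (f := fun y : ℝ × (E × F) => (ρ y.1, (y.2.1, r y.2.2)))
      (by fun_prop : ContDiff ℝ ∞ fun y : ℝ × (E × F) => (ρ y.1, (y.2.1, r y.2.2))).contDiffAt
  · have hconv : Convex ℝ ((univ : Set E) ×ˢ Metric.closedBall (0 : F) (2 * ε)) :=
      convex_univ.prod (convex_closedBall _ _)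
    have hL : LipschitzOnWith c (fun z => Y (ρ t, z)) (univ ×ˢ Metric.closedBall (0 : F) (2 * ε)) := by
      refine hconv.lipschitzOnWith_of_nnnorm_hasFDerivWithin_le
        (f' := fun z => (fderiv ℝ Y (ρ t, z)).comp (ContinuousLinearMap.inr ℝ ℝ (E × F)))
        (fun z hz => ?_) fun z hz => ?_
      · have hz' := hεO _ (hρm t) z.1 z.2 (by simpa using hz.2)
        have h1 := ((hY.contDiffAt (hO.mem_nhds hz'.1)).differentiableAt (by simp)).hasFDerivAt
        have h2 : HasFDerivAt (fun z : E × F => (ρ t, z)) (ContinuousLinearMap.inr ℝ ℝ (E × F)) z :=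
          hasFDerivAt_prodMk_right _ _
        exact (h1.comp z h2).hasFDerivWithinAt
      · have hz' := (hεO _ (hρm t) z.1 z.2 (by simpa using hz.2)).2
        have h3 : ‖fderiv ℝ Y (ρ t, z)‖ < c := by simpa using hz'
        rw [← NNReal.coe_le_coe, coe_nnnorm]
        refine (ContinuousLinearMap.opNorm_comp_le _ _).trans ?_
        exact (mul_le_of_le_one_right (norm_nonneg _) (ContinuousLinearMap.norm_inr_le_one _ _ _)).trans
          h3.le
    refine LipschitzWith.of_dist_le_mul fun z z' => ?_
    have h1 := hL.dist_le_mul (z.1, r z.2) ⟨trivial, by simpa using hr4 z.2⟩ (z'.1, r z'.2)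
      ⟨trivial, by simpa using hr4 z'.2⟩
    refine h1.trans ?_
    have h2 : dist (z.1, r z.2) (z'.1, r z'.2) ≤ (1 + C) * dist z z' := by
      rw [Prod.dist_eq]
      refine max_le ?_ ?_
      · refine (le_max_left _ _ : dist z.1 z'.1 ≤ dist z z').trans ?_
        exact le_mul_of_one_le_left (dist_nonneg (x := z) (y := z')) (by simp)
      · refine (hr2.dist_le_mul _ _).trans ?_
        gcongr
        · simp
        · exact le_max_right _ _
    calc (c : ℝ) * dist (z.1, r z.2) (z'.1, r z'.2) ≤ c * ((1 + C) * dist z z') := by gcongr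
      _ = _ := by
        rw [hc]; push_cast
        have : (1 + C : ℝ) ≠ 0 := by positivity
        field_simp
  · have h1 : ρ t = t := hρ3 t (by rw [Real.norm_eq_abs, abs_of_nonneg ht.1]; exact ht.2)
    simp only [h1, hr3 p hp, true_and]
    exact (hεO t ⟨by linarith [ht.1], by linarith [ht.2]⟩ q p (by linarith)).1

end LocalMoser

/-! ### Moser's flow near the zero section -/

section LocalMoser

variable {E F : Type} [NormedAddCommGroup E] [NormedSpace ℝ E] [FiniteDimensional ℝ E]
  [NormedAddCommGroup F] [NormedSpace ℝ F] [FiniteDimensional ℝ F]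

/-- In the product rule one term contains `s y` and the other the derivative of `s` at `y`; both
vanish, whatever the derivative of the inverse is. -/
theorem hasFDerivAt_inverse_apply_zero {G Z V : Type} [NormedAddCommGroup G] [NormedSpace ℝ G]
    [NormedAddCommGroup Z] [NormedSpace ℝ Z] [CompleteSpace Z] [NormedAddCommGroup V]
    [NormedSpace ℝ V] {W : G → Z →L[ℝ] V} {s : G → V} {y : G}
    (hW : DifferentiableAt ℝ W y) (hi : (W y).IsInvertible) (hs : HasFDerivAt s (0 : G →L[ℝ] V) y)
    (hs0 : s y = 0) : HasFDerivAt (fun y => -(W y).inverse (s y)) (0 : G →L[ℝ] Z) y := by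
  obtain ⟨e, he⟩ := hi
  have h1 : DifferentiableAt ℝ (ContinuousLinearMap.inverse (R := ℝ) : (Z →L[ℝ] V) → V →L[ℝ] Z)
      (W y) := by
    rw [← he]
    exact (contDiffAt_map_inverse (n := 1) e).differentiableAt one_ne_zero
  have h2 := ((h1.hasFDerivAt.comp y hW.hasFDerivAt).clm_apply hs).neg
  refine h2.congr_fderiv ?_
  ext v
  simp [hs0]

theorem contDiffAt_inverse_apply {G Z V : Type} [NormedAddCommGroup G] [NormedSpace ℝ G]
    [NormedAddCommGroup Z] [NormedSpace ℝ Z] [CompleteSpace Z] [NormedAddCommGroup V]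
    [NormedSpace ℝ V] {W : G → Z →L[ℝ] V} {s : G → V} {y : G}
    (hW : ContDiffAt ℝ ∞ W y) (hi : (W y).IsInvertible) (hs : ContDiffAt ℝ ∞ s y) :
    ContDiffAt ℝ ∞ (fun y => -(W y).inverse (s y)) y := by
  obtain ⟨e, he⟩ := hi
  have h1 : ContDiffAt ℝ ∞ (ContinuousLinearMap.inverse (R := ℝ) : (Z →L[ℝ] V) → V →L[ℝ] Z) (W y) := by
    rw [← he]
    exact contDiffAt_map_inverse e
  exact ((h1.comp y hW).clm_apply hs).neg

theorem isOpen_setOf_isInvertible {G Z V : Type} [TopologicalSpace G]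
    [NormedAddCommGroup Z] [NormedSpace ℝ Z] [CompleteSpace Z] [NormedAddCommGroup V]
    [NormedSpace ℝ V] {W : G → Z →L[ℝ] V} (hW : Continuous W) :
    IsOpen {y | (W y).IsInvertible} := (ContinuousLinearEquiv.isOpen (𝕜 := ℝ)).preimage hW

/-- **Moser's method near the zero section.** A closed two-form `θ₀ + τ` with `τ` vanishing along
the zero section is changed into `θ₀` over the region where `χ = 1`, by a map which is the identity
outside the support of `χ` and wherever `τ` vanishes already. -/
theorem exists_local_moser {θ₀ : E × F →L[ℝ] E × F →L[ℝ] ℝ} (hθ₀ : ∀ a b, θ₀ a b = -θ₀ b a)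
    (hinv : θ₀.IsInvertible) {τ : E × F → E × F →L[ℝ] E × F →L[ℝ] ℝ} (hτ : ContDiff ℝ ∞ τ)
    (hanti : ∀ z a b, τ z a b = -τ z b a) (hτ0 : ∀ q, τ (q, 0) = 0) {B : Set E} (hB : IsOpen B) {δ : ℝ}
    (hδ : 0 < δ) (hcl : ∀ z : E × F, z.1 ∈ B → ‖z.2‖ < δ → IsClosedAt τ z)
    {χ : E → ℝ} (hχ : ContDiff ℝ ∞ χ) {K : Set E} (hK : IsCompact K)
    (hχK : ∀ q, q ∉ K → χ q = 0) :
    ∃ φ : E × F → E × F, ContDiff ℝ ∞ φ ∧ (∀ q p, q ∉ K → φ (q, p) = (q, p)) ∧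
      (∀ q, φ (q, 0) = (q, 0) ∧ HasFDerivAt φ (ContinuousLinearMap.id ℝ (E × F)) (q, 0)) ∧
      (∀ q, (∀ᶠ z in 𝓝 (q, 0), τ z = 0) → ∀ᶠ z in 𝓝 (q, 0), φ z = z) ∧
      ∀ q ∈ B, (∀ᶠ q' in 𝓝 q, χ q' = 1) → ∀ᶠ z in 𝓝 (q, 0),
        ∀ a b, (θ₀ + τ (φ z)) (fderiv ℝ φ z a) (fderiv ℝ φ z b) = θ₀ a b := by
  set σ := fibreHomotopy τ with hσ
  have hσc : ContDiff ℝ ∞ σ := contDiff_fibreHomotopy hτ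
  -- The cutoff is applied to the primitive, not to the form, so that the interpolating forms stay
  -- closed. It depends on the base point only, so `s` and its derivative still vanish on the zero
  -- section.
  set s : E × F → E × F →L[ℝ] ℝ := fun z => χ z.1 • σ z with hs
  have hsc : ContDiff ℝ ∞ s := (hχ.comp contDiff_fst).smul hσc
  have hs0 : ∀ q, s (q, 0) = 0 := fun q => by simp [hs, hσ, fibreHomotopy_zeroSection hτ0]
  have hsd0 : ∀ q, HasFDerivAt s 0 (q, 0) := fun q => by
    have h1 := (hσc.differentiable (by simp) (q, 0)).hasFDerivAt
    rw [fderiv_fibreHomotopy_zeroSection hτ hτ0] at h1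
    have h2 := (((hχ.comp contDiff_fst).differentiable (by simp) (q, (0 : F))).hasFDerivAt).smul h1
    refine h2.congr_fderiv ?_
    rw [hσ, fibreHomotopy_zeroSection hτ0]
    refine ContinuousLinearMap.ext fun v => ?_
    simp
  have hβ0 : ∀ q, oneFormDeriv s (q, 0) = 0 := fun q => by
    simp only [oneFormDeriv, (hsd0 q).fderiv]
    refine ContinuousLinearMap.ext fun a => ContinuousLinearMap.ext fun b => ?_
    simp
  -- This family ends at `θ₀ + τ` at time `1` and, near base points where `χ = 1` locally, starts at
  -- `θ₀` at time `0`.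
  set W : ℝ × (E × F) → E × F →L[ℝ] E × F →L[ℝ] ℝ := fun y =>
    (θ₀ + τ y.2) - (1 - y.1) • oneFormDeriv s y.2 with hW
  have hWc : ContDiff ℝ ∞ W := (contDiff_const.add (hτ.comp contDiff_snd)).sub
    ((contDiff_const.sub contDiff_fst).smul ((contDiff_oneFormDeriv hsc).comp contDiff_snd))
  have hW0 : ∀ t q, W (t, (q, 0)) = θ₀ := fun t q => by simp [hW, hτ0, hβ0]
  set Y : ℝ × (E × F) → E × F := fun y => -(W y).inverse (s y.2) with hY
  have hY0 : ∀ t z, s z = 0 → Y (t, z) = 0 := fun t z hz => by simp [hY, hz]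
  have hsK : ∀ q p, q ∉ K → s (q, p) = 0 := fun q p hq => by simp [hs, hχK q hq]
  have hKo : IsOpen {y : ℝ × (E × F) | y.2.1 ∉ K} :=
    hK.isClosed.isOpen_compl.preimage (by fun_prop : Continuous fun y : ℝ × (E × F) => y.2.1)
  have hYK : ∀ y ∈ {y : ℝ × (E × F) | y.2.1 ∉ K}, Y =ᶠ[𝓝 y] fun _ => 0 := fun y hy => by
    filter_upwards [hKo.mem_nhds hy] with y' hy'
    exact hY0 _ _ (hsK _ _ hy')
  -- Off `K` the form `W y` need not be invertible, but there `Y` is an inverse, possibly a default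
  -- value, applied to `s = 0`, hence locally zero and smooth.
  set O := {y : ℝ × (E × F) | (W y).IsInvertible} ∪ {y : ℝ × (E × F) | y.2.1 ∉ K} with hO
  have hOo : IsOpen O := (isOpen_setOf_isInvertible hWc.continuous).union hKo
  have hYO : ContDiffOn ℝ ∞ Y O := by
    rintro y (hy | hy)
    · exact (contDiffAt_inverse_apply hWc.contDiffAt hy
        (hsc.comp contDiff_snd).contDiffAt).contDiffWithinAt
    · exact (contDiffAt_const.congr_of_eventuallyEq (hYK y hy)).contDiffWithinAt
  have hYd0 : ∀ t q, HasFDerivAt Y (0 : ℝ × (E × F) →L[ℝ] E × F) (t, (q, (0 : F))) := fun t q => by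
    refine hasFDerivAt_inverse_apply_zero (hWc.differentiable (by simp) _) ?_ ?_ (hs0 q)
    · rw [hW0]; exact hinv
    · have h1 : HasFDerivAt (fun y : ℝ × (E × F) => y.2) (ContinuousLinearMap.snd ℝ ℝ (E × F))
        (t, (q, (0 : F))) := hasFDerivAt_snd
      have h2 := (hsd0 q).comp (t, (q, (0 : F))) h1
      rw [ContinuousLinearMap.zero_comp] at h2
      exact h2
  obtain ⟨ε, X, hε, hX, hXL, hXY, hXY'⟩ := exists_truncated_field hOo hYO
    (fun t q => Or.inl (by simp only [mem_ofPred_eq, hW0]; exact hinv))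
    (fun t q => (hYd0 t q).fderiv) hK (fun t q p hq => Or.inr hq)
    (fun t q p hq => ((hYK (t, (q, p)) hq).fderiv_eq).trans (by simp))
  -- `X` at `(q, p)` is a value of `Y` over the same `q`, at some `p'` known to equal `p` only when
  -- `‖p‖ ≤ ε`. The hypothesis thus serves both for `q ∉ K` and for points near the zero section.
  have hX0 : ∀ t q p, (∀ p', (‖p‖ ≤ ε → p' = p) → s (q, p') = 0) → X (t, (q, p)) = 0 := by
    intro t q p h
    obtain ⟨t', p', h1, h2⟩ := hXY' t q p
    rw [h1, hY0 _ _ (h p' h2)]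
  obtain ⟨Γ, hΓ, hΓ0, hΓc, hΓd, hΓX⟩ := exists_flow hX hXL
  have hfix : ∀ q p, (∀ p', (‖p‖ ≤ ε → p' = p) → s (q, p') = 0) → Γ (q, p) = constCurve _ (q, p) :=
    fun q p h => hΓX _ fun t _ => hX0 t q p h
  have hfix0 : ∀ q, Γ (q, 0) = constCurve _ (q, 0) := fun q => hfix q 0 fun p' hp' => by
    rw [hp' (by simpa using hε.le), hs0]
  let one : Icc (0:ℝ) 1 := ⟨1, by simp⟩
  let ev := ContinuousMap.evalCLM ℝ (M := E × F) one
  have hφd : ∀ z v, fderiv ℝ (fun z => Γ z one) z v = fderiv ℝ Γ z v one := fun z v => by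
    have := ev.hasFDerivAt.comp z (hΓ.differentiable (by simp) z).hasFDerivAt
    exact congrArg (· v) this.fderiv
  have hφ : ContDiff ℝ ∞ fun z => Γ z one := ev.contDiff.comp hΓ
  refine ⟨fun z => Γ z one, hφ, fun q p hq => ?_, fun q => ⟨?_, ?_⟩, fun q hq => ?_,
    fun q hq hχ1 => ?_⟩
  · change Γ (q, p) one = _
    rw [hfix q p fun p' _ => hsK q p' hq, constCurve_apply]
  · change Γ (q, 0) one = _
    rw [hfix0, constCurve_apply]
  · have h1 := (hφ.differentiable (by simp) (q, 0)).hasFDerivAt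
    refine h1.congr_fderiv (ContinuousLinearMap.ext fun v => ?_)
    rw [hφd]
    obtain ⟨h2, c, hc⟩ := hΓd (q, 0) v
    -- Near the zero section `X` agrees with `Y` for `t` in the unit interval, and `Y` has zero
    -- derivative there, so solutions of the variational equation are constant.
    have hXd : ∀ t ∈ Icc (0:ℝ) 1, ∀ w, fderiv ℝ X (t, (q, 0)) (0, w) = 0 := by
      intro t ht w
      have e1 : HasFDerivAt (fun z => X (t, z)) ((fderiv ℝ X (t, (q, 0))).comp
          (ContinuousLinearMap.inr ℝ ℝ (E × F))) (q, 0) :=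
        (hX.differentiable (by simp) (t, (q, (0 : F)))).hasFDerivAt.comp (q, (0 : F))
          (hasFDerivAt_prodMk_right _ _)
      have e2 : HasFDerivAt (fun z => Y (t, z)) ((0 : ℝ × (E × F) →L[ℝ] E × F).comp
          (ContinuousLinearMap.inr ℝ ℝ (E × F))) (q, 0) :=
        (hYd0 t q).comp (q, (0 : F)) (hasFDerivAt_prodMk_right _ _)
      have e3 : (fun z => X (t, z)) =ᶠ[𝓝 (q, (0 : F))] fun z => Y (t, z) := by
        have : ∀ᶠ z : E × F in 𝓝 (q, (0 : F)), ‖z.2‖ < ε :=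
          (isOpen_lt (by fun_prop) continuous_const).mem_nhds (by simpa using hε)
        filter_upwards [this] with z hz
        exact (hXY t z.1 z.2 ht hz.le).1
      have := congrArg (· w) (e1.unique (e2.congr_of_eventuallyEq e3))
      simpa using this
    have h3 : ∀ t ∈ Icc (0:ℝ) 1, c t = c 0 := by
      refine constant_of_has_deriv_right_zero
        (fun t ht => (hc ⟨t, ht⟩).2.continuousAt.continuousWithinAt) fun t ht => ?_
      have h4 := (hc ⟨t, Ico_subset_Icc_self ht⟩).2
      rw [hfix0, constCurve_apply] at h4
      rw [hXd t (Ico_subset_Icc_self ht)] at h4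
      exact h4.hasDerivWithinAt
    have h5 := h3 1 (by simp)
    have h6 := (hc one).1
    have h7 := (hc ⟨0, by simp⟩).1
    rw [ContinuousLinearMap.id_apply, ← h6, ← h2, ← h7]
    exact h5
  · obtain ⟨η, hη, hq⟩ := Metric.eventually_nhds_iff_ball.1 hq
    have : ∀ᶠ z : E × F in 𝓝 (q, (0 : F)), ‖z.2‖ < ε :=
      (isOpen_lt (by fun_prop) continuous_const).mem_nhds (by simpa using hε)
    filter_upwards [this, Metric.ball_mem_nhds (q, (0 : F)) hη] with z hz hz'
    rw [show z = (z.1, z.2) from rfl, hfix z.1 z.2 ?_, constCurve_apply]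
    intro p' hp'
    rw [hp' hz.le]
    -- The segment from `(z.1, 0)` to `z` stays in the ball on which `τ` vanishes, so the homotopy
    -- integral is zero.
    have : σ z = 0 := by
      refine fibreHomotopy_eq_zero fun t ht => hq _ ?_
      rw [Metric.mem_ball, Prod.dist_eq, dist_zero_right] at hz' ⊢
      refine lt_of_le_of_lt (max_le_max (le_of_eq (by simp)) ?_) hz'
      rw [fibreScale_apply, norm_smul, Real.norm_of_nonneg ht.1]
      exact mul_le_of_le_one_left (norm_nonneg _) ht.2
    simp [hs, this]
  · set G : Set (E × F) := {z | z.1 ∈ B ∧ ‖z.2‖ < δ ∧ ‖z.2‖ < ε} with hG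
    have hGo : IsOpen G :=
      (hB.preimage continuous_fst).inter
      ((isOpen_lt (f := fun z : E × F => ‖z.2‖) (by fun_prop) continuous_const).inter
      (isOpen_lt (f := fun z : E × F => ‖z.2‖) (by fun_prop) continuous_const))
    have hqG : (q, (0 : F)) ∈ G := ⟨hq, by simpa using hδ, by simpa using hε⟩
    obtain ⟨η, hη, hηG⟩ := Metric.isOpen_iff.1 hGo _ hqG
    -- The curve `Γ (q, 0)` is constant and `Γ` is continuous for the uniform norm, so whole flow
    -- curves stay in `G`, where the form is closed and `X = Y` at times in the unit interval.
    have hstay : ∀ᶠ z in 𝓝 (q, (0 : F)), ∀ t, Γ z t ∈ G := by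
      filter_upwards [hΓ.continuous.continuousAt (Metric.ball_mem_nhds _ hη)] with z hz t
      refine hηG ?_
      have h1 : dist (Γ z) (Γ (q, 0)) < η := hz
      refine lt_of_le_of_lt ?_ h1
      have h2 := ContinuousMap.dist_apply_le_dist (f := Γ z) (g := Γ (q, 0)) t
      rwa [hfix0, constCurve_apply, ← hfix0] at h2
    have hχ1' : ∀ᶠ z : E × F in 𝓝 (q, (0 : F)), ∀ᶠ z' in 𝓝 z, s z' = σ z' := by
      rw [eventually_eventually_nhds]
      filter_upwards [(continuous_fst.tendsto (q, (0 : F))).eventually hχ1] with z hz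
      simp [hs, hz]
    filter_upwards [hstay, hχ1', hGo.mem_nhds hqG] with z hz hzχ hzG a b
    obtain ⟨c, hc⟩ := hΓc z
    obtain ⟨ha0, y, hy⟩ := hΓd z a
    obtain ⟨hb0, w, hw⟩ := hΓd z b
    have hder : ∀ t ∈ Icc (0:ℝ) 1, HasDerivAt (fun t => (θ₀ + τ (c t) -
        (1 - t) • oneFormDeriv s (c t)) (y t) (w t)) 0 t := by
      intro t ht
      obtain ⟨hc1, hc2⟩ := hc ⟨t, ht⟩
      obtain ⟨hy1, hy2⟩ := hy ⟨t, ht⟩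
      obtain ⟨hw1, hw2⟩ := hw ⟨t, ht⟩
      simp only at hc1 hc2 hy1 hy2 hw1 hw2
      have hG' := hz ⟨t, ht⟩
      rw [← hc1] at hG' hc2 hy2 hw2
      rw [← hy1] at hy2
      rw [← hw1] at hw2
      have e1 : HasFDerivAt (fun z => X (t, z)) ((fderiv ℝ X (t, c t)).comp
          (ContinuousLinearMap.inr ℝ ℝ (E × F))) (c t) :=
        (hX.differentiable (by simp) (t, c t)).hasFDerivAt.comp (c t)
          (hasFDerivAt_prodMk_right _ _)
      refine hasDerivAt_moser (θ := fun z => θ₀ + τ z) (X := fun z => X (t, z)) hsc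
        (fun z a b => by simp [hθ₀ a b, hanti z a b]; ring)
        ((hτ.differentiable (by simp) _).const_add _) ?_ e1.differentiableAt ?_ hc2
        (by rw [e1.fderiv]; exact hy2) (by rw [e1.fderiv]; exact hw2)
      · intro a b c'
        rw [fderiv_const_add]
        exact hcl (c t) hG'.1 hG'.2.1 a b c'
      · filter_upwards [hGo.mem_nhds hG'] with z' hz'
        obtain ⟨h1, h2⟩ := hXY t z'.1 z'.2 ht hz'.2.2.le
        have h3 : X (t, z') = Y (t, z') := h1
        rw [h3]
        rcases h2 with h2 | h2
        · have h2' : (W (t, z')).IsInvertible := h2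
          simp only [hY, map_neg]
          change -(W (t, z')) ((W (t, z')).inverse (s z')) = -s z'
          rw [h2'.self_apply_inverse]
        · have h4 : s z' = 0 := hsK _ _ h2
          rw [hY0 _ _ h4, h4]; simp
    have hconst := constant_of_has_deriv_right_zero
      (f := fun t => (θ₀ + τ (c t) - (1 - t) • oneFormDeriv s (c t)) (y t) (w t)) (a := 0) (b := 1)
      (fun t ht => (hder t ht).continuousAt.continuousWithinAt)
      (fun t ht => (hder t (Ico_subset_Icc_self ht)).hasDerivWithinAt) 1 (by simp)
    -- The fibre segment below `z` lies in `G`, so the fibrewise Poincaré lemma applies and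
    -- identifies the form at time `0` with `θ₀`.
    have hβ : oneFormDeriv s z = τ z := by
      have h1 : fderiv ℝ s z = fderiv ℝ σ z := Filter.EventuallyEq.fderiv_eq hzχ
      have h2 : oneFormDeriv s z = oneFormDeriv σ z := by simp [oneFormDeriv, h1]
      rw [h2]
      refine oneFormDeriv_fibreHomotopy hτ hanti hτ0 fun t ht => hcl _ ?_ ?_
      · simpa using hzG.1
      · rw [fibreScale_apply, norm_smul, Real.norm_of_nonneg ht.1]
        exact lt_of_le_of_lt (mul_le_of_le_one_left (norm_nonneg _) ht.2) hzG.2.1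
    have c0 := (hc ⟨0, by simp⟩).1
    have c1 := (hc one).1
    have y0 := (hy ⟨0, by simp⟩).1
    have y1 := (hy one).1
    have w0 := (hw ⟨0, by simp⟩).1
    have w1 := (hw one).1
    rw [hΓ0] at c0
    rw [ha0] at y0
    rw [hb0] at w0
    rw [hφd, hφd]
    change (θ₀ + τ (c (one : ℝ)) - (1 - 1) • oneFormDeriv s (c (one : ℝ))) (y (one : ℝ)) (w (one : ℝ))
      = _ at hconst
    rw [c0, c1, y0, y1, w0, w1, hβ] at hconst
    simpa using hconst

end LocalMoser

/-! ## Pullbacks of forms and the exterior derivative in charts -/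

section FormPullback

variable {E : Type*} [NormedAddCommGroup E] [NormedSpace ℝ E]
  {H : Type*} [TopologicalSpace H] {I : ModelWithCorners ℝ E H}
  {M : Type*} [TopologicalSpace M] [ChartedSpace H M]
  {E' : Type*} [NormedAddCommGroup E'] [NormedSpace ℝ E']
  {H' : Type*} [TopologicalSpace H'] {I' : ModelWithCorners ℝ E' H'}
  {M' : Type*} [TopologicalSpace M'] [ChartedSpace H' M']
  {E'' : Type*} [NormedAddCommGroup E''] [NormedSpace ℝ E'']
  {H'' : Type*} [TopologicalSpace H''] {I'' : ModelWithCorners ℝ E'' H''}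
  {M'' : Type*} [TopologicalSpace M''] [ChartedSpace H'' M'']
  {k : ℕ}

theorem formPullback_comp {f : M → M'} {g : M' → M''}
    (Ω : ∀ y : M'', TangentSpace I'' y [⋀^Fin k]→L[ℝ] ℝ) {x : M}
    (hg : MDifferentiableAt I' I'' g (f x)) (hf : MDifferentiableAt I I' f x) :
    formPullback I I'' (g ∘ f) Ω x = formPullback I I' f (formPullback I' I'' g Ω) x := by
  unfold formPullback
  rw [mfderiv_comp x hg hf]
  rfl

theorem formPullback_congr {f g : M → M'} (Ω : ∀ y : M', TangentSpace I' y [⋀^Fin k]→L[ℝ] ℝ)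
    {x : M} (h : f =ᶠ[𝓝 x] g) : formPullback I I' f Ω x = formPullback I I' g Ω x := by
  have h1 : (Ω (f x) : E' [⋀^Fin k]→L[ℝ] ℝ) = Ω (g x) := by rw [h.eq_of_nhds]
  have h2 : (mfderiv I I' f x : E →L[ℝ] E') = mfderiv I I' g x := h.mfderiv_eq
  exact congrArg₂ (fun (a : E' [⋀^Fin k]→L[ℝ] ℝ) (b : E →L[ℝ] E') =>
    a.compContinuousLinearMap b) h1 h2

theorem formPullback_congr_form {f : M → M'}
    {Ω Ω' : ∀ y : M', TangentSpace I' y [⋀^Fin k]→L[ℝ] ℝ} {x : M} (h : Ω (f x) = Ω' (f x)) :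
    formPullback I I' f Ω x = formPullback I I' f Ω' x := by
  unfold formPullback
  rw [h]

theorem formPullback_id (Ω : ∀ y : M, TangentSpace I y [⋀^Fin k]→L[ℝ] ℝ) (x : M) :
    formPullback I I id Ω x = Ω x := by
  unfold formPullback
  rw [mfderiv_id]
  rfl

theorem formPullback_vectorSpace (f : E → E') (Ω : E' → E' [⋀^Fin k]→L[ℝ] ℝ) (x : E) :
    formPullback 𝓘(ℝ, E) 𝓘(ℝ, E') f Ω x = (Ω (f x)).compContinuousLinearMap (fderiv ℝ f x) := by
  unfold formPullback
  rw [mfderiv_eq_fderiv]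
  rfl

variable [I.Boundaryless] [IsManifold I ∞ M]

theorem extChartAt_target_mem_nhds_of_mem {x₀ : M} {y : E} (hy : y ∈ (extChartAt I x₀).target) :
    (extChartAt I x₀).target ∈ 𝓝 y := (isOpen_extChartAt_target x₀).mem_nhds hy

theorem contMDiffAt_extChartAt_symm {x₀ : M} {y : E} (hy : y ∈ (extChartAt I x₀).target) :
    ContMDiffAt 𝓘(ℝ, E) I ∞ (extChartAt I x₀).symm y :=
  (contMDiffOn_extChartAt_symm x₀).contMDiffAt (extChartAt_target_mem_nhds_of_mem hy)

theorem mdifferentiableAt_extChartAt_symm {x₀ : M} {y : E} (hy : y ∈ (extChartAt I x₀).target) :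
    MDifferentiableAt 𝓘(ℝ, E) I (extChartAt I x₀).symm y :=
  (contMDiffAt_extChartAt_symm hy).mdifferentiableAt (by simp)

theorem contMDiffAt_extChartAt_of_mem {x₀ x : M} (hx : x ∈ (extChartAt I x₀).source) :
    ContMDiffAt I 𝓘(ℝ, E) ∞ (extChartAt I x₀) x :=
  contMDiffAt_extChartAt' (by simpa using hx)

theorem mdifferentiableAt_extChartAt_of_mem {x₀ x : M} (hx : x ∈ (extChartAt I x₀).source) :
    MDifferentiableAt I 𝓘(ℝ, E) (extChartAt I x₀) x :=
  (contMDiffAt_extChartAt_of_mem hx).mdifferentiableAt (by simp)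

/-- Pulling back to the chart and then back to the manifold gives back the form. -/
theorem formPullback_extChartAt_symm (Ω : ∀ y : M, TangentSpace I y [⋀^Fin k]→L[ℝ] ℝ)
    {x₀ x : M} (hx : x ∈ (extChartAt I x₀).source) :
    formPullback I 𝓘(ℝ, E) (extChartAt I x₀)
      (formPullback 𝓘(ℝ, E) I (extChartAt I x₀).symm Ω) x = Ω x := by
  rw [← formPullback_comp Ω
    (mdifferentiableAt_extChartAt_symm ((extChartAt I x₀).map_source hx))
    (mdifferentiableAt_extChartAt_of_mem hx), formPullback_congr Ω (g := id), formPullback_id]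
  filter_upwards [(isOpen_extChartAt_source x₀).mem_nhds hx] with x' hx'
  exact (extChartAt I x₀).left_inv hx'

/-- The exterior derivative may be computed in any chart. -/
theorem formPullback_symm_formExtDeriv {Ω : ∀ y : M, TangentSpace I y [⋀^Fin k]→L[ℝ] ℝ}
    (hΩ : IsSmoothForm I Ω) {x₀ : M} {y : E} (hy : y ∈ (extChartAt I x₀).target) :
    formPullback 𝓘(ℝ, E) I (extChartAt I x₀).symm (formExtDeriv I Ω) y =
      extDeriv (formInChart I Ω x₀) y := by
  set P := (extChartAt I x₀).symm y with hP
  have hPs : P ∈ (extChartAt I P).source := mem_extChartAt_source P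
  have hPt : extChartAt I P P ∈ (extChartAt I P).target := mem_extChartAt_target P
  have hsymm := contMDiffAt_extChartAt_symm hy
  -- `formExtDeriv` at `P` is computed in the chart at `P`. The claim is therefore naturality of
  -- `extDeriv` under the transition map `g`.
  set g : E → E := extChartAt I P ∘ (extChartAt I x₀).symm with hg
  have hgM : ContMDiffAt 𝓘(ℝ, E) 𝓘(ℝ, E) ∞ g y :=
    (contMDiffAt_extChartAt_of_mem (x₀ := P) hPs).comp y hsymm
  have hgc : ContDiffAt ℝ ∞ g y := hgM.contDiffAt
  have hyn : ∀ᶠ y' in 𝓝 y, y' ∈ (extChartAt I x₀).target := extChartAt_target_mem_nhds_of_mem hy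
  have hev : ∀ᶠ y' in 𝓝 y, y' ∈ (extChartAt I x₀).target ∧
      (extChartAt I x₀).symm y' ∈ (extChartAt I P).source :=
    hyn.and (hsymm.continuousAt.eventually_mem
      ((isOpen_extChartAt_source P).mem_nhds hPs))
  have h1 : (fun y' => (formInChart I Ω P (g y')).compContinuousLinearMap (fderiv ℝ g y')) =ᶠ[𝓝 y]
      formInChart I Ω x₀ := by
    filter_upwards [hev.eventually_nhds] with y' hy'
    obtain ⟨hy1, hy2⟩ := hy'.self_of_nhds
    rw [← formPullback_vectorSpace]
    have hg' : MDifferentiableAt 𝓘(ℝ, E) 𝓘(ℝ, E) g y' :=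
      (mdifferentiableAt_extChartAt_of_mem hy2).comp y' (mdifferentiableAt_extChartAt_symm hy1)
    have h2 := formPullback_comp (I := 𝓘(ℝ, E)) (I' := 𝓘(ℝ, E)) (f := g)
      (g := (extChartAt I P).symm) Ω (mdifferentiableAt_extChartAt_symm
        ((extChartAt I P).map_source hy2)) hg'
    refine h2.symm.trans (formPullback_congr Ω ?_)
    filter_upwards [hy'] with y'' hy''
    exact (extChartAt I P).left_inv hy''.2
  have h3 : extDeriv (fun y' => (formInChart I Ω P (g y')).compContinuousLinearMap (fderiv ℝ g y')) y =
      (extDeriv (formInChart I Ω P) (g y)).compContinuousLinearMap (fderiv ℝ g y) :=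
    extDeriv_pullback (r := ∞) (((hΩ P).contDiffAt (extChartAt_target_mem_nhds_of_mem hPt)).differentiableAt (by simp)) hgc
    (by simpa using (mod_cast le_top : ((2 : ℕ∞) : WithTop ℕ∞) ≤ ((⊤ : ℕ∞) : WithTop ℕ∞)))
  rw [← h1.extDeriv_eq, h3, ← formPullback_vectorSpace g (extDeriv (formInChart I Ω P)) y]
  have h4 := formPullback_comp (I := 𝓘(ℝ, E)) (I'' := 𝓘(ℝ, E)) (f := (extChartAt I x₀).symm)
    (g := extChartAt I P) (extDeriv (formInChart I Ω P)) (mdifferentiableAt_extChartAt_of_mem hPs)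
    (mdifferentiableAt_extChartAt_symm hy)
  exact (formPullback_congr_form rfl).trans h4.symm

end FormPullback

/-! ## Two-forms on vector spaces as bilinear maps -/

section TwoForms

variable {Z : Type*} [NormedAddCommGroup Z] [NormedSpace ℝ Z]
  {Y : Type*} [NormedAddCommGroup Y] [NormedSpace ℝ Y]

variable (Z) in
/-- The bilinear map underlying an alternating two-form. -/
noncomputable def twoFormBilin : (Z [⋀^Fin 2]→L[ℝ] ℝ) →L[ℝ] Z →L[ℝ] Z →L[ℝ] ℝ :=
  (ContinuousLinearMap.compL ℝ Z (Z [⋀^Fin 1]→L[ℝ] ℝ) (Z →L[ℝ] ℝ)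
    ((ContinuousAlternatingMap.ofSubsingletonLIE (𝕜 := ℝ) (E := Z) (F := ℝ)
      (0 : Fin 1)).symm : (Z [⋀^Fin 1]→L[ℝ] ℝ) →L[ℝ] Z →L[ℝ] ℝ)).comp
    (ContinuousAlternatingMap.curryLeftLI (𝕜 := ℝ) (E := Z) (F := ℝ) (n := 1)).toContinuousLinearMap

theorem twoFormBilin_apply (β : Z [⋀^Fin 2]→L[ℝ] ℝ) (a b : Z) :
    twoFormBilin Z β a b = β ![a, b] := by
  change β (Matrix.vecCons a fun _ => b) = _
  congr 1
  ext i
  fin_cases i <;> rfl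

theorem twoFormBilin_injective : Function.Injective (twoFormBilin Z) := by
  intro β γ h
  ext v
  have := congrArg (fun B : Z →L[ℝ] Z →L[ℝ] ℝ => B (v 0) (v 1)) h
  simp only [twoFormBilin_apply] at this
  rwa [show ![v 0, v 1] = v from by ext i; fin_cases i <;> rfl] at this

theorem twoForm_swap {V : Type*} [AddCommGroup V] [Module ℝ V] [TopologicalSpace V]
    (β : V [⋀^Fin 2]→L[ℝ] ℝ) (a b : V) : β ![a, b] = -β ![b, a] := by
  have h := β.toAlternatingMap.map_swap ![b, a] (i := 0) (j := 1) (by simp)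
  rw [← ContinuousAlternatingMap.coe_toAlternatingMap, ← h]
  congr 1
  ext i
  fin_cases i <;> rfl

theorem twoFormBilin_swap (β : Z [⋀^Fin 2]→L[ℝ] ℝ) (a b : Z) :
    twoFormBilin Z β a b = -twoFormBilin Z β b a := by
  simp only [twoFormBilin_apply, twoForm_swap β a b]

theorem twoFormBilin_comp (β : Y [⋀^Fin 2]→L[ℝ] ℝ) (f : Z →L[ℝ] Y) (a b : Z) :
    twoFormBilin Z (β.compContinuousLinearMap f) a b = twoFormBilin Y β (f a) (f b) := by
  rw [twoFormBilin_apply, twoFormBilin_apply, ContinuousAlternatingMap.compContinuousLinearMap_apply]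
  congr 1
  ext i
  fin_cases i <;> rfl

/-- The alternating sum for `extDeriv β z ![a, b, c]` has exactly the three terms of `IsClosedAt`.
-/
theorem isClosedAt_twoFormBilin {Z : Type} [NormedAddCommGroup Z] [NormedSpace ℝ Z]
    {β : Z → Z [⋀^Fin 2]→L[ℝ] ℝ} {z : Z} (hβ : DifferentiableAt ℝ β z)
    (h : extDeriv β z = 0) : IsClosedAt (fun y => twoFormBilin Z (β y)) z := by
  intro a b c
  have key : ∀ u v w, fderiv ℝ (fun y => twoFormBilin Z (β y)) z u v w =
      fderiv ℝ (fun y => β y ![v, w]) z u := by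
    intro u v w
    have h1 := ((twoFormBilin Z).hasFDerivAt.comp z hβ.hasFDerivAt)
    have h2 := (h1.clm_apply (hasFDerivAt_const v z)).clm_apply (hasFDerivAt_const w z)
    have h3 : (fun y => β y ![v, w]) = fun y => twoFormBilin Z (β y) v w := by
      ext y; rw [twoFormBilin_apply]
    have h2' := h2.fderiv
    rw [h3]
    change fderiv ℝ (twoFormBilin Z ∘ β) z u v w = _
    rw [h1.fderiv]
    refine Eq.trans ?_ (congrArg (· u) h2').symm
    simp
  have h1 : extDeriv β z ![a, b, c] = 0 := by rw [h]; rfl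
  rw [extDeriv_apply hβ, Fin.sum_univ_three] at h1
  rw [key, key, key]
  rw [show (0 : Fin 3).removeNth ![a, b, c] = ![b, c] from by ext i; fin_cases i <;> rfl,
    show (1 : Fin 3).removeNth ![a, b, c] = ![a, c] from by ext i; fin_cases i <;> rfl,
    show (2 : Fin 3).removeNth ![a, b, c] = ![a, b] from by ext i; fin_cases i <;> rfl] at h1
  simp at h1
  linarith

/-! ### The canonical forms on the product of a vector space and its dual -/

section Standard

variable (E : Type*) [NormedAddCommGroup E] [NormedSpace ℝ E]

/-- The tautological one-form on `E × E*`. -/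
noncomputable def stdTautological :
    (E × (E →L[ℝ] ℝ)) →L[ℝ] (E × (E →L[ℝ] ℝ)) [⋀^Fin 1]→L[ℝ] ℝ :=
  (ContinuousAlternatingMap.ofSubsingletonLIE (𝕜 := ℝ) (E := E × (E →L[ℝ] ℝ)) (F := ℝ)
      (0 : Fin 1)).toContinuousLinearEquiv.toContinuousLinearMap.comp
    (((ContinuousLinearMap.compL ℝ (E × (E →L[ℝ] ℝ)) E ℝ).flip
      (ContinuousLinearMap.fst ℝ E (E →L[ℝ] ℝ))).comp (ContinuousLinearMap.snd ℝ E (E →L[ℝ] ℝ)))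

/-- The canonical symplectic form on `E × E*`. -/
noncomputable def stdSymplectic : (E × (E →L[ℝ] ℝ)) [⋀^Fin 2]→L[ℝ] ℝ :=
  -extDeriv (stdTautological E) 0

variable {E}

theorem stdTautological_apply (z : E × (E →L[ℝ] ℝ)) (v : Fin 1 → E × (E →L[ℝ] ℝ)) :
    stdTautological E z v = z.2 (v 0).1 := rfl

/-- `stdTautological E` is linear, so its derivative does not depend on the point. -/
theorem extDeriv_stdTautological (z : E × (E →L[ℝ] ℝ)) :
    extDeriv (stdTautological E) z = -stdSymplectic E := by
  rw [stdSymplectic, neg_neg, extDeriv, extDeriv, ContinuousLinearMap.fderiv,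
    ContinuousLinearMap.fderiv]

theorem stdSymplectic_apply (a b : E × (E →L[ℝ] ℝ)) :
    twoFormBilin _ (stdSymplectic E) a b = b.2 a.1 - a.2 b.1 := by
  rw [twoFormBilin_apply, stdSymplectic, extDeriv]
  simp [ContinuousAlternatingMap.alternatizeUncurryFin_apply, Fin.sum_univ_two,
    stdTautological_apply, Fin.removeNth]
  ring

variable (E)

/-- Pairing with `(0, g)` detects the vector component and pairing with `(v, 0)` the covector
component; in finite dimension injectivity suffices. -/
theorem isInvertible_stdSymplectic [FiniteDimensional ℝ E] : (twoFormBilin _ (stdSymplectic E)).IsInvertible := by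
  have hinj : Function.Injective (twoFormBilin _ (stdSymplectic E)) := by
    refine (injective_iff_map_eq_zero _).2 fun a ha => ?_
    have h : ∀ b : E × (E →L[ℝ] ℝ), b.2 a.1 - a.2 b.1 = 0 := fun b => by
      rw [← stdSymplectic_apply, ha]; rfl
    refine Prod.ext ?_ (ContinuousLinearMap.ext fun v => ?_)
    · by_contra hne
      obtain ⟨g, hg⟩ := SeparatingDual.exists_ne_zero (R := ℝ) hne
      exact hg (by simpa using h (0, g))
    · simpa using h (v, 0)
  have hdim : Module.finrank ℝ (E × (E →L[ℝ] ℝ)) =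
      Module.finrank ℝ (E × (E →L[ℝ] ℝ) →L[ℝ] ℝ) := by
    exact Subspace.dual_finrank_eq.symm.trans (LinearMap.toContinuousLinearMap.finrank_eq)
  exact ⟨(LinearMap.linearEquivOfInjective (twoFormBilin _ (stdSymplectic E)).toLinearMap hinj hdim).toContinuousLinearEquiv, rfl⟩

end Standard

end TwoForms
/-! ## Charts of the cotangent bundle -/

section Cotangent
variable {E : Type*} [NormedAddCommGroup E] [NormedSpace ℝ E]
  {H : Type*} [TopologicalSpace H] {I : ModelWithCorners ℝ E H}
  {N : Type*} [TopologicalSpace N] [ChartedSpace H N] [IsManifold I ∞ N] [I.Boundaryless]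

theorem extChartAt_cotangent_fst (P p : CotangentBundle I N) :
    (extChartAt (cotangentModel I) P p).1 = extChartAt I P.proj p.proj := by
  have h : chartAt (ModelProd H (E →L[ℝ] ℝ)) P p = (chartAt H P.proj p.proj,
      ContinuousLinearMap.inCoordinates E (fun x : N => TangentSpace I x) ℝ (Bundle.Trivial N ℝ)
        P.proj p.proj P.proj p.proj p.snd) := hom_chart P p
  exact congrArg (fun y => I y.1) h

/-- This identifies the bundle chart with canonical coordinates: the fibre coordinate is the
covector composed with the derivative of the inverse base chart. -/
theorem extChartAt_cotangent_snd (P p : CotangentBundle I N)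
    (hp : p.proj ∈ (chartAt H P.proj).source) (v : E) :
    (extChartAt (cotangentModel I) P p).2 v = p.snd (mfderiv 𝓘(ℝ, E) I (extChartAt I P.proj).symm
        (extChartAt I P.proj p.proj) v : E) := by
  have h : chartAt (ModelProd H (E →L[ℝ] ℝ)) P p = (chartAt H P.proj p.proj,
      ContinuousLinearMap.inCoordinates E (fun x : N => TangentSpace I x) ℝ (Bundle.Trivial N ℝ)
        P.proj p.proj P.proj p.proj p.snd) := hom_chart P p
  have h2 : (extChartAt (cotangentModel I) P p).2 =
      ContinuousLinearMap.inCoordinates E (fun x : N => TangentSpace I x) ℝ (Bundle.Trivial N ℝ)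
        P.proj p.proj P.proj p.proj p.snd := congrArg (fun y => y.2) h
  have h3 := TangentBundle.symmL_trivializationAt (I := I) (x := p.proj) (x₀ := P.proj) (𝕜 := ℝ) hp
  rw [I.range_eq_univ, mfderivWithin_univ] at h3
  rw [h2, ContinuousLinearMap.inCoordinates]
  simp only [ContinuousLinearMap.comp_apply]
  rw [h3]
  simp
  rfl
theorem mem_extChartAt_cotangent_source (P p : CotangentBundle I N) :
    p ∈ (extChartAt (cotangentModel I) P).source ↔ p.proj ∈ (chartAt H P.proj).source := by
  rw [extChartAt_source, FiberBundle.chartedSpace_chartAt]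
  simp only [OpenPartialHomeomorph.trans_source, Trivialization.source_eq, mem_inter_iff, mem_preimage,
    OpenPartialHomeomorph.prod_source, OpenPartialHomeomorph.refl_source, mem_prod, mem_univ, and_true,
    hom_trivializationAt_baseSet, TangentBundle.trivializationAt_baseSet, Bundle.Trivial.fiberBundle_trivializationAt', Bundle.Trivial.trivialization_baseSet]
  refine ⟨fun h => h.1, fun h => ⟨h, ?_⟩⟩
  change ((trivializationAt (E →L[ℝ] ℝ) (fun x : N => TangentSpace I x →L[ℝ] ℝ) P.proj) p).1 ∈ _
  rw [Trivialization.coe_fst']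
  · exact h
  · rw [hom_trivializationAt_baseSet]
    simpa using h
theorem extChartAt_cotangent_target (P : CotangentBundle I N) :
    (extChartAt (cotangentModel I) P).target = (extChartAt I P.proj).target ×ˢ univ := by
  rw [FiberBundle.extChartAt_target]
  congr 1
  refine inter_eq_left.2 fun y hy => ?_
  have := (extChartAt I P.proj).map_target hy
  rw [hom_trivializationAt_baseSet]
  simpa using this
theorem cotangent_symm_proj (P : CotangentBundle I N) {z : E × (E →L[ℝ] ℝ)}
    (hz : z ∈ (extChartAt (cotangentModel I) P).target) :
    ((extChartAt (cotangentModel I) P).symm z).proj = (extChartAt I P.proj).symm z.1 := by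
  have h1 := (extChartAt (cotangentModel I) P).map_target hz
  rw [mem_extChartAt_cotangent_source] at h1
  have h2 := extChartAt_cotangent_fst P ((extChartAt (cotangentModel I) P).symm z)
  rw [(extChartAt (cotangentModel I) P).right_inv hz] at h2
  rw [h2, (extChartAt I P.proj).left_inv (by rwa [extChartAt_source])]

/-- In the bundle chart the projection is `Prod.fst` followed by the inverse base chart; the rest is
the chain rule. -/
theorem mfderiv_proj_comp_symm (P : CotangentBundle I N) {z : E × (E →L[ℝ] ℝ)}
    (hz : z ∈ (extChartAt (cotangentModel I) P).target) (w : E × (E →L[ℝ] ℝ)) :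
    (mfderiv (cotangentModel I) I (fun q : CotangentBundle I N => q.proj)
      ((extChartAt (cotangentModel I) P).symm z)
      (mfderiv 𝓘(ℝ, E × (E →L[ℝ] ℝ)) (cotangentModel I) (extChartAt (cotangentModel I) P).symm z w) :
        E) = mfderiv 𝓘(ℝ, E) I (extChartAt I P.proj).symm z.1 w.1 := by
  have hz1 : z.1 ∈ (extChartAt I P.proj).target := by
    rw [extChartAt_cotangent_target] at hz
    exact hz.1
  have h1 : MDifferentiableAt (cotangentModel I) I (fun q : CotangentBundle I N => q.proj)
      ((extChartAt (cotangentModel I) P).symm z) :=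
    (Bundle.contMDiff_proj (n := ∞) (IB := I) (fun x : N => TangentSpace I x →L[ℝ] ℝ)
      ).mdifferentiableAt (by simp)
  have h2 := mfderiv_comp z h1 (mdifferentiableAt_extChartAt_symm hz)
  have h3 : (fun q : CotangentBundle I N => q.proj) ∘ (extChartAt (cotangentModel I) P).symm =ᶠ[𝓝 z]
      (extChartAt I P.proj).symm ∘ Prod.fst := by
    filter_upwards [extChartAt_target_mem_nhds_of_mem hz] with z' hz'
    exact cotangent_symm_proj P hz'
  have h4 := mfderiv_comp (I := 𝓘(ℝ, E × (E →L[ℝ] ℝ))) (I' := 𝓘(ℝ, E)) (I'' := I) z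
    (mdifferentiableAt_extChartAt_symm hz1)
    (differentiableAt_fst.mdifferentiableAt)
  rw [mfderiv_eq_fderiv, fderiv_fst] at h4
  have h5 : (mfderiv 𝓘(ℝ, E × (E →L[ℝ] ℝ)) I ((fun q : CotangentBundle I N => q.proj) ∘
      (extChartAt (cotangentModel I) P).symm) z : E × (E →L[ℝ] ℝ) →L[ℝ] E) =
      mfderiv 𝓘(ℝ, E × (E →L[ℝ] ℝ)) I ((extChartAt I P.proj).symm ∘ Prod.fst) z := h3.mfderiv_eq
  have h6 := (h2.symm.trans h5).trans h4
  exact congrArg (fun f : E × (E →L[ℝ] ℝ) →L[ℝ] E => f w) h6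

/-- The same derivative of the inverse base chart occurs in the projected coordinate vector and in
the fibre coordinate of the covector, so their pairing is `p dq`. -/
theorem formInChart_tautologicalForm (P : CotangentBundle I N) {z : E × (E →L[ℝ] ℝ)}
    (hz : z ∈ (extChartAt (cotangentModel I) P).target) :
    formInChart (cotangentModel I) (tautologicalForm I) P z = stdTautological E z := by
  have h1 := (extChartAt (cotangentModel I) P).map_target hz
  rw [mem_extChartAt_cotangent_source] at h1
  have h2 := extChartAt_cotangent_fst P ((extChartAt (cotangentModel I) P).symm z)
  refine ContinuousAlternatingMap.ext fun v => ?_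
  have h3 := extChartAt_cotangent_snd P _ h1 (v 0).1
  rw [(extChartAt (cotangentModel I) P).right_inv hz] at h2 h3
  rw [← h2] at h3
  refine Eq.trans ?_ h3.symm
  exact congrArg (fun u : E => ((extChartAt (cotangentModel I) P).symm z).snd u)
    (mfderiv_proj_comp_symm P hz (v 0))

theorem isSmoothForm_tautologicalForm :
    IsSmoothForm (cotangentModel I) (tautologicalForm I (N := N)) := fun P =>
  (stdTautological E).contDiff.contDiffOn.congr fun _ hz => formInChart_tautologicalForm P hz

/-- In canonical coordinates the canonical symplectic form is the standard one. -/
theorem formPullback_symm_canonicalForm (P : CotangentBundle I N) {z : E × (E →L[ℝ] ℝ)}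
    (hz : z ∈ (extChartAt (cotangentModel I) P).target) :
    formPullback 𝓘(ℝ, E × (E →L[ℝ] ℝ)) (cotangentModel I) (extChartAt (cotangentModel I) P).symm
      (canonicalForm I) z = stdSymplectic E := by
  have h1 := formPullback_symm_formExtDeriv (isSmoothForm_tautologicalForm (I := I) (N := N)) hz
  have h2 : formInChart (cotangentModel I) (tautologicalForm I) P =ᶠ[𝓝 z] stdTautological E := by
    filter_upwards [extChartAt_target_mem_nhds_of_mem hz] with z' hz'
    exact formInChart_tautologicalForm P hz'
  rw [h2.extDeriv_eq, extDeriv_stdTautological] at h1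
  rw [← neg_neg (stdSymplectic E), ← h1]
  rfl

end Cotangent

/-! ## Pullbacks of two-forms in coordinates -/

section PullbackCoordinates

variable {Z : Type} [NormedAddCommGroup Z] [NormedSpace ℝ Z]
  {E' : Type} [NormedAddCommGroup E'] [NormedSpace ℝ E']
  {H' : Type*} [TopologicalSpace H'] {J : ModelWithCorners ℝ E' H'} [J.Boundaryless]
  {M : Type*} [TopologicalSpace M] [ChartedSpace H' M] [IsManifold J ∞ M]
  {k : ℕ}

/-- Inserting a chart of `M` and its inverse leaves a pullback between vector spaces, where `fderiv`
and `extDeriv` are available. -/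
theorem formPullback_eq_formInChart (Ω : ∀ y : M, TangentSpace J y [⋀^Fin k]→L[ℝ] ℝ) {G : Z → M}
    {z : Z} (hG : MDifferentiableAt 𝓘(ℝ, Z) J G z) {y₀ : M} (hz : G z ∈ (extChartAt J y₀).source) :
    (formPullback 𝓘(ℝ, Z) J G Ω z : Z [⋀^Fin k]→L[ℝ] ℝ) =
      (formInChart J Ω y₀ ((extChartAt J y₀ ∘ G) z)).compContinuousLinearMap
        (fderiv ℝ (extChartAt J y₀ ∘ G) z) := by
  refine Eq.trans ?_ (formPullback_vectorSpace (extChartAt J y₀ ∘ G) (formInChart J Ω y₀) z)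
  refine Eq.trans ?_ (formPullback_comp (I := 𝓘(ℝ, Z)) (I'' := 𝓘(ℝ, E')) (formInChart J Ω y₀)
    (mdifferentiableAt_extChartAt_of_mem hz) hG).symm
  exact formPullback_congr_form (formPullback_extChartAt_symm Ω hz).symm

theorem mfderiv_symm_comp_fderiv {G : Z → M} {z : Z} (hG : MDifferentiableAt 𝓘(ℝ, Z) J G z) {y₀ : M}
    (hz : G z ∈ (extChartAt J y₀).source) (v : Z) :
    (mfderiv 𝓘(ℝ, E') J (extChartAt J y₀).symm (extChartAt J y₀ (G z))
      (fderiv ℝ (extChartAt J y₀ ∘ G) z v) : E') = mfderiv 𝓘(ℝ, Z) J G z v := by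
  have h1 : (extChartAt J y₀).symm ∘ (extChartAt J y₀ ∘ G) =ᶠ[𝓝 z] G := by
    filter_upwards [hG.continuousAt.eventually_mem ((isOpen_extChartAt_source y₀).mem_nhds hz)]
      with z' hz'
    exact (extChartAt J y₀).left_inv hz'
  have h2 : (mfderiv 𝓘(ℝ, Z) J ((extChartAt J y₀).symm ∘ (extChartAt J y₀ ∘ G)) z : Z →L[ℝ] E') =
      mfderiv 𝓘(ℝ, Z) J G z := h1.mfderiv_eq
  have h4 : MDifferentiableAt 𝓘(ℝ, Z) 𝓘(ℝ, E') (extChartAt J y₀ ∘ G) z :=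
    (mdifferentiableAt_extChartAt_of_mem hz).comp z hG
  have h3 := mfderiv_comp (I := 𝓘(ℝ, Z)) (I' := 𝓘(ℝ, E')) (I'' := J) (f := extChartAt J y₀ ∘ G) z
    (mdifferentiableAt_extChartAt_symm ((extChartAt J y₀).map_source hz)) h4
  rw [mfderiv_eq_fderiv] at h3
  exact congrArg (fun f : Z →L[ℝ] E' => f v) (h3.symm.trans h2)

/-- With flips, pullback is expressed by compositions alone, so its smooth dependence on `β` and `f`
comes from that of composition. -/
theorem twoFormBilin_comp_eq {Y : Type*} [NormedAddCommGroup Y] [NormedSpace ℝ Y]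
    (β : Y [⋀^Fin 2]→L[ℝ] ℝ) (f : Z →L[ℝ] Y) :
    twoFormBilin Z (β.compContinuousLinearMap f) =
      (ContinuousLinearMap.flipₗᵢ ℝ Z Z ℝ)
        (((ContinuousLinearMap.flipₗᵢ ℝ Z Y ℝ) ((twoFormBilin Y β).comp f)).comp f) :=
  ContinuousLinearMap.ext fun a => ContinuousLinearMap.ext fun b => twoFormBilin_comp β f a b

theorem eventually_formPullback_eq (Ω : ∀ y : M, TangentSpace J y [⋀^Fin k]→L[ℝ] ℝ) {G : Z → M} {z : Z}
    (hG : ContMDiffAt 𝓘(ℝ, Z) J ∞ G z) {y₀ : M} (hz : G z ∈ (extChartAt J y₀).source) :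
    ∀ᶠ z' in 𝓝 z, (formPullback 𝓘(ℝ, Z) J G Ω z' : Z [⋀^Fin k]→L[ℝ] ℝ) =
      (formInChart J Ω y₀ ((extChartAt J y₀ ∘ G) z')).compContinuousLinearMap
        (fderiv ℝ (extChartAt J y₀ ∘ G) z') := by
  -- Passing from a point to a neighbourhood is done at the finite order `1`, which is all the
  -- formula needs.
  have h1 : ∀ᶠ z' in 𝓝 z, ContMDiffAt 𝓘(ℝ, Z) J 1 G z' := 
    contMDiffAt_iff_contMDiffAt_nhds (by simp) |>.1 (hG.of_le (mod_cast le_top))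
  filter_upwards [h1, hG.continuousAt.eventually_mem ((isOpen_extChartAt_source y₀).mem_nhds hz)]
    with z' hz' hz''
  exact formPullback_eq_formInChart Ω (hz'.mdifferentiableAt (by simp)) hz''

theorem contDiffAt_extChartAt_comp {G : Z → M} {z : Z}
    (hG : ContMDiffAt 𝓘(ℝ, Z) J ∞ G z) {y₀ : M} (hz : G z ∈ (extChartAt J y₀).source) :
    ContDiffAt ℝ ∞ (extChartAt J y₀ ∘ G) z :=
  ((contMDiffAt_extChartAt_of_mem hz).comp z hG).contDiffAt

theorem contDiffAt_twoFormBilin_formPullback {Ω : ∀ y : M, TangentSpace J y [⋀^Fin 2]→L[ℝ] ℝ}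
    (hΩ : IsSmoothForm J Ω) {G : Z → M} {z : Z}
    (hG : ContMDiffAt 𝓘(ℝ, Z) J ∞ G z) :
    ContDiffAt ℝ ∞ (fun z' => twoFormBilin Z (formPullback 𝓘(ℝ, Z) J G Ω z')) z := by
  have hz := mem_extChartAt_source (I := J) (G z)
  have hg := contDiffAt_extChartAt_comp hG hz
  have h1 : ContDiffAt ℝ ∞ (formInChart J Ω (G z)) ((extChartAt J (G z) ∘ G) z) :=
    (hΩ (G z)).contDiffAt (extChartAt_target_mem_nhds_of_mem ((extChartAt J (G z)).map_source hz))
  have h2 : ContDiffAt ℝ ∞ (fun z' => twoFormBilin E' (formInChart J Ω (G z)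
      ((extChartAt J (G z) ∘ G) z'))) z :=
    (twoFormBilin E').contDiff.contDiffAt.comp z (h1.comp z hg)
  have h3 : ContDiffAt ℝ ∞ (fderiv ℝ (extChartAt J (G z) ∘ G)) z := hg.fderiv_right (by simp)
  have h4 := (ContinuousLinearMap.flipₗᵢ ℝ Z Z ℝ).contDiff.contDiffAt.comp z
    (((ContinuousLinearMap.flipₗᵢ ℝ Z E' ℝ).contDiff.contDiffAt.comp z (h2.clm_comp h3)).clm_comp h3)
  refine h4.congr_of_eventuallyEq ?_
  filter_upwards [eventually_formPullback_eq Ω hG hz] with z' hz'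
  rw [hz', twoFormBilin_comp_eq]
  rfl

theorem extDeriv_formInChart_eq_zero {Ω : ∀ y : M, TangentSpace J y [⋀^Fin k]→L[ℝ] ℝ}
    (hΩ : IsSmoothForm J Ω) (hcl : ∀ y, formExtDeriv J Ω y = 0) {y₀ : M} {w : E'}
    (hw : w ∈ (extChartAt J y₀).target) : extDeriv (formInChart J Ω y₀) w = 0 := by
  refine (formPullback_symm_formExtDeriv hΩ hw).symm.trans ?_
  unfold formPullback
  rw [hcl]
  rfl

/-- The exterior derivative commutes with pullback, and it vanishes for the coordinate expression of
`Ω`. -/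
theorem isClosedAt_formPullback {Ω : ∀ y : M, TangentSpace J y [⋀^Fin 2]→L[ℝ] ℝ}
    (hΩ : IsSmoothForm J Ω) (hcl : ∀ y, formExtDeriv J Ω y = 0) {G : Z → M} {z : Z}
    (hG : ContMDiffAt 𝓘(ℝ, Z) J ∞ G z) :
    IsClosedAt (fun z' => twoFormBilin Z (formPullback 𝓘(ℝ, Z) J G Ω z')) z := by
  have hz := mem_extChartAt_source (I := J) (G z)
  have hg := contDiffAt_extChartAt_comp hG hz
  have hev := eventually_formPullback_eq Ω hG hz
  have ht := (extChartAt J (G z)).map_source hz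
  have h1 : ContDiffAt ℝ ∞ (formInChart J Ω (G z)) ((extChartAt J (G z) ∘ G) z) :=
    (hΩ (G z)).contDiffAt (extChartAt_target_mem_nhds_of_mem ht)
  have h1' := h1.differentiableAt (by simp)
  have h2 := extDeriv_pullback (r := ∞) h1' hg
    (by simpa using (mod_cast le_top : ((2 : ℕ∞) : WithTop ℕ∞) ≤ ((⊤ : ℕ∞) : WithTop ℕ∞)))
  have h3 : extDeriv (formInChart J Ω (G z)) ((extChartAt J (G z) ∘ G) z) = 0 :=
    extDeriv_formInChart_eq_zero hΩ hcl ht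
  rw [h3] at h2
  have h5 : ContDiffAt ℝ ∞ (fderiv ℝ (extChartAt J (G z) ∘ G)) z := hg.fderiv_right (by simp)
  have h4 := isClosedAt_twoFormBilin (β := fun z' => (formInChart J Ω (G z)
      ((extChartAt J (G z) ∘ G) z')).compContinuousLinearMap
        (fderiv ℝ (extChartAt J (G z) ∘ G) z'))
    ((h1'.comp z (hg.differentiableAt (by simp))).hasFDerivAt.continuousAlternatingMapCompContinuousLinearMap
      (h5.differentiableAt (by simp)).hasFDerivAt).differentiableAt (h2.trans (by ext; rfl))
  have h6 : (fun z' => twoFormBilin Z (formPullback 𝓘(ℝ, Z) J G Ω z')) =ᶠ[𝓝 z]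
      fun z' => twoFormBilin Z ((formInChart J Ω (G z)
      ((extChartAt J (G z) ∘ G) z')).compContinuousLinearMap
        (fderiv ℝ (extChartAt J (G z) ∘ G) z')) := by
    filter_upwards [hev] with z' hz'
    rw [hz']
  intro a b c
  rw [h6.fderiv_eq]
  exact h4 a b c

end PullbackCoordinates

/-! ## Germs of maps along the zero section -/

section Germs

variable {E : Type} [NormedAddCommGroup E] [NormedSpace ℝ E]
  {H : Type*} [TopologicalSpace H] {I : ModelWithCorners ℝ E H} [I.Boundaryless]
  {N : Type*} [TopologicalSpace N] [ChartedSpace H N] [IsManifold I ∞ N]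
  {E' : Type} [NormedAddCommGroup E'] [NormedSpace ℝ E']
  {H' : Type*} [TopologicalSpace H'] {J : ModelWithCorners ℝ E' H'} [J.Boundaryless]
  {M : Type*} [TopologicalSpace M] [ChartedSpace H' M] [IsManifold J ∞ M]

variable (I) in
/-- The preferred chart of the cotangent bundle around a point of the zero section. -/
noncomputable abbrev cotangentChart (x₀ : N) :
    PartialEquiv (CotangentBundle I N) (E × (E →L[ℝ] ℝ)) :=
  extChartAt (cotangentModel I) (zeroCovector I x₀)

theorem mem_cotangentChart_target {x₀ : N} {z : E × (E →L[ℝ] ℝ)} :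
    z ∈ (cotangentChart I x₀).target ↔ z.1 ∈ (extChartAt I x₀).target := by
  rw [cotangentChart, extChartAt_cotangent_target]
  simp [zeroCovector]

theorem mem_cotangentChart_source {x₀ : N} {p : CotangentBundle I N} :
    p ∈ (cotangentChart I x₀).source ↔ p.proj ∈ (extChartAt I x₀).source := by
  rw [cotangentChart, mem_extChartAt_cotangent_source, extChartAt_source]
  rfl

theorem cotangentChart_fst (x₀ : N) (p : CotangentBundle I N) :
    (cotangentChart I x₀ p).1 = extChartAt I x₀ p.proj := extChartAt_cotangent_fst _ _

theorem cotangentChart_symm_proj {x₀ : N} {z : E × (E →L[ℝ] ℝ)}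
    (hz : z.1 ∈ (extChartAt I x₀).target) :
    ((cotangentChart I x₀).symm z).proj = (extChartAt I x₀).symm z.1 :=
  cotangent_symm_proj _ (mem_cotangentChart_target.2 hz)

theorem cotangentChart_zeroCovector {x₀ x : N} (hx : x ∈ (extChartAt I x₀).source) :
    cotangentChart I x₀ (zeroCovector I x) = (extChartAt I x₀ x, 0) := by
  refine Prod.ext (cotangentChart_fst x₀ _) (ContinuousLinearMap.ext fun v => ?_)
  exact extChartAt_cotangent_snd (zeroCovector I x₀) (zeroCovector I x)
    (by rwa [extChartAt_source] at hx) v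

theorem cotangentChart_symm_zero {x₀ : N} {q : E} (hq : q ∈ (extChartAt I x₀).target) :
    (cotangentChart I x₀).symm (q, 0) = zeroCovector I ((extChartAt I x₀).symm q) := by
  have h := cotangentChart_zeroCovector ((extChartAt I x₀).map_target hq)
  rw [(extChartAt I x₀).right_inv hq] at h
  rw [← h, (cotangentChart I x₀).left_inv]
  exact mem_cotangentChart_source.2 ((extChartAt I x₀).map_target hq)

theorem continuous_zeroCovector : Continuous (zeroCovector I : N → CotangentBundle I N) := by
  refine continuous_iff_continuousAt.2 fun x => ?_
  have hx := mem_extChartAt_source (I := I) x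
  have h1 : ContinuousAt (fun y => (cotangentChart I x).symm (extChartAt I x y, 0)) x := by
    refine ContinuousAt.comp (f := fun y => (extChartAt I x y, (0 : E →L[ℝ] ℝ))) ?_
      ((continuousAt_extChartAt x).prodMk continuousAt_const)
    exact (contMDiffAt_extChartAt_symm
      (mem_cotangentChart_target.2 ((extChartAt I x).map_source hx))).continuousAt
  refine h1.congr ?_
  filter_upwards [(isOpen_extChartAt_source x).mem_nhds hx] with y hy
  rw [cotangentChart_symm_zero ((extChartAt I x).map_source hy), (extChartAt I x).left_inv hy]

/-- The chart and its inverse are continuous at corresponding points. Through this, every statement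
about germs at the zero section becomes one about germs at `(q, 0)`. -/
theorem eventually_zeroCovector_iff {x₀ x : N} (hx : x ∈ (extChartAt I x₀).source)
    {Q : CotangentBundle I N → Prop} :
    (∀ᶠ p in 𝓝 (zeroCovector I x), Q p) ↔
      ∀ᶠ z in 𝓝 (extChartAt I x₀ x, (0 : E →L[ℝ] ℝ)), Q ((cotangentChart I x₀).symm z) := by
  have hs : zeroCovector I x ∈ (cotangentChart I x₀).source := mem_cotangentChart_source.2 hx
  have ht := (extChartAt I x₀).map_source hx
  have h1 := (contMDiffAt_extChartAt_of_mem hs).continuousAt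
  have h2 := (contMDiffAt_extChartAt_symm (I := cotangentModel I) (x₀ := zeroCovector I x₀)
    (y := (extChartAt I x₀ x, 0)) (mem_cotangentChart_target.2 ht)).continuousAt
  rw [ContinuousAt, cotangentChart_zeroCovector hx] at h1
  rw [ContinuousAt, cotangentChart_symm_zero ht, (extChartAt I x₀).left_inv hx] at h2
  refine ⟨fun h => h2.eventually h, fun h => ?_⟩
  filter_upwards [h1.eventually h, (isOpen_extChartAt_source (I := cotangentModel I)
    (zeroCovector I x₀)).mem_nhds hs] with p hp hp'
  rwa [(cotangentChart I x₀).left_inv hp'] at hp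

variable (I J) in
/-- A map defined near the zero section that is smooth there and restricts to `ι`. -/
def IsSmoothExtensionAt (ι : N → M) (Φ : CotangentBundle I N → M) (x : N) : Prop :=
  Φ (zeroCovector I x) = ι x ∧ ∀ᶠ p in 𝓝 (zeroCovector I x), ContMDiffAt (cotangentModel I) J ∞ Φ p

theorem contMDiffAt_comp_cotangentChart_symm_iff {x₀ : N} {Φ : CotangentBundle I N → M}
    {z : E × (E →L[ℝ] ℝ)} (hz : z ∈ (cotangentChart I x₀).target) :
    ContMDiffAt (cotangentModel I) J ∞ Φ ((cotangentChart I x₀).symm z) ↔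
      ContMDiffAt 𝓘(ℝ, E × (E →L[ℝ] ℝ)) J ∞ (Φ ∘ (cotangentChart I x₀).symm) z := by
  refine ⟨fun h => h.comp z (contMDiffAt_extChartAt_symm hz), fun h => ?_⟩
  have hs := (cotangentChart I x₀).map_target hz
  have h1 : ContMDiffAt (cotangentModel I) J ∞ ((Φ ∘ (cotangentChart I x₀).symm) ∘
      cotangentChart I x₀) ((cotangentChart I x₀).symm z) := by
    refine ContMDiffAt.comp (I' := 𝓘(ℝ, E × (E →L[ℝ] ℝ))) _ ?_ (contMDiffAt_extChartAt_of_mem hs)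
    rwa [(cotangentChart I x₀).right_inv hz]
  refine h1.congr_of_eventuallyEq ?_
  filter_upwards [(isOpen_extChartAt_source (I := cotangentModel I)
    (zeroCovector I x₀)).mem_nhds hs] with p hp
  simp only [Function.comp_apply]
  rw [(cotangentChart I x₀).left_inv hp]

theorem eventually_mem_cotangentChart_target {x₀ x : N} (hx : x ∈ (extChartAt I x₀).source) :
    ∀ᶠ z in 𝓝 (extChartAt I x₀ x, (0 : E →L[ℝ] ℝ)), z ∈ (cotangentChart I x₀).target :=
  extChartAt_target_mem_nhds_of_mem (mem_cotangentChart_target.2 ((extChartAt I x₀).map_source hx))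

/-- Only the germ of the coordinate expression matters; allowing any `G` with that germ lets a glued
map be tested on the formula that prescribes it. -/
theorem isSmoothExtensionAt_iff {ι : N → M} {Φ : CotangentBundle I N → M} {x₀ x : N}
    (hx : x ∈ (extChartAt I x₀).source) {G : E × (E →L[ℝ] ℝ) → M}
    (hG : Φ ∘ (cotangentChart I x₀).symm =ᶠ[𝓝 (extChartAt I x₀ x, 0)] G) :
    IsSmoothExtensionAt I J ι Φ x ↔ G (extChartAt I x₀ x, 0) = ι x ∧
      ∀ᶠ z in 𝓝 (extChartAt I x₀ x, (0 : E →L[ℝ] ℝ)), ContMDiffAt 𝓘(ℝ, E × (E →L[ℝ] ℝ)) J ∞ G z := by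
  have h1 : Φ (zeroCovector I x) = G (extChartAt I x₀ x, 0) := by
    rw [← hG.eq_of_nhds, Function.comp_apply,
      cotangentChart_symm_zero ((extChartAt I x₀).map_source hx), (extChartAt I x₀).left_inv hx]
  rw [IsSmoothExtensionAt, h1, eventually_zeroCovector_iff hx]
  refine and_congr_right fun _ => Filter.eventually_congr ?_
  filter_upwards [eventually_mem_cotangentChart_target hx, hG.eventuallyEq_nhds] with z hz hz'
  rw [contMDiffAt_comp_cotangentChart_symm_iff hz]
  exact hz'.contMDiffAt_iff

variable (I J) in
/-- Near the zero covector at `x` the map pulls back the form to the canonical one. -/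
def IsSymplecticNear (Ω : ∀ y : M, TangentSpace J y [⋀^Fin 2]→L[ℝ] ℝ)
    (Φ : CotangentBundle I N → M) (x : N) : Prop :=
  ∀ᶠ p in 𝓝 (zeroCovector I x), formPullback (cotangentModel I) J Φ Ω p = canonicalForm I p

theorem formPullback_eq_canonicalForm_iff {Ω : ∀ y : M, TangentSpace J y [⋀^Fin 2]→L[ℝ] ℝ} {x₀ : N}
    {Φ : CotangentBundle I N → M} {z : E × (E →L[ℝ] ℝ)} (hz : z ∈ (cotangentChart I x₀).target)
    (hΦ : MDifferentiableAt (cotangentModel I) J Φ ((cotangentChart I x₀).symm z)) :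
    formPullback (cotangentModel I) J Φ Ω ((cotangentChart I x₀).symm z) =
      canonicalForm I ((cotangentChart I x₀).symm z) ↔
    formPullback 𝓘(ℝ, E × (E →L[ℝ] ℝ)) J (Φ ∘ (cotangentChart I x₀).symm) Ω z =
      (stdSymplectic E : (E × (E →L[ℝ] ℝ)) [⋀^Fin 2]→L[ℝ] ℝ) := by
  have h1 := formPullback_comp (I := 𝓘(ℝ, E × (E →L[ℝ] ℝ))) Ω hΦ (mdifferentiableAt_extChartAt_symm hz)
  have h2 := formPullback_symm_canonicalForm (zeroCovector I x₀) hz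
  constructor
  · intro h
    exact (h1.trans (formPullback_congr_form h)).trans h2
  · intro h
    have hs := (cotangentChart I x₀).map_target hz
    have h3 : (formPullback 𝓘(ℝ, E × (E →L[ℝ] ℝ)) (cotangentModel I) (cotangentChart I x₀).symm
      (formPullback (cotangentModel I) J Φ Ω) z : (E × (E →L[ℝ] ℝ)) [⋀^Fin 2]→L[ℝ] ℝ) =
      formPullback 𝓘(ℝ, E × (E →L[ℝ] ℝ)) (cotangentModel I) (cotangentChart I x₀).symm
      (canonicalForm I) z := (h1.symm.trans h).trans h2.symm
    rw [← formPullback_extChartAt_symm (formPullback (cotangentModel I) J Φ Ω) hs,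
      ← formPullback_extChartAt_symm (canonicalForm I) hs]
    refine formPullback_congr_form ?_
    rw [(cotangentChart I x₀).right_inv hz]
    exact h3

theorem formPullback_eq_canonicalForm_iff_bilin {Ω : ∀ y : M, TangentSpace J y [⋀^Fin 2]→L[ℝ] ℝ}
    {x₀ : N} {Φ : CotangentBundle I N → M} {z : E × (E →L[ℝ] ℝ)}
    (hz : z ∈ (cotangentChart I x₀).target)
    (hΦ : MDifferentiableAt (cotangentModel I) J Φ ((cotangentChart I x₀).symm z))
    {G : E × (E →L[ℝ] ℝ) → M} (hG : Φ ∘ (cotangentChart I x₀).symm =ᶠ[𝓝 z] G) :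
    formPullback (cotangentModel I) J Φ Ω ((cotangentChart I x₀).symm z) =
      canonicalForm I ((cotangentChart I x₀).symm z) ↔
    twoFormBilin _ (formPullback 𝓘(ℝ, E × (E →L[ℝ] ℝ)) J G Ω z) =
      twoFormBilin _ (stdSymplectic E) := by
  refine (formPullback_eq_canonicalForm_iff hz hΦ).trans ?_
  have h := formPullback_congr (I := 𝓘(ℝ, E × (E →L[ℝ] ℝ))) Ω hG
  constructor
  · intro h1
    exact congrArg (twoFormBilin _) (h.symm.trans h1)
  · intro h1
    exact h.trans (twoFormBilin_injective h1)

theorem isSymplecticNear_iff {Ω : ∀ y : M, TangentSpace J y [⋀^Fin 2]→L[ℝ] ℝ}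
    {ι : N → M} {Φ : CotangentBundle I N → M} {x₀ x : N}
    (hx : x ∈ (extChartAt I x₀).source) (hΦ : IsSmoothExtensionAt I J ι Φ x) {G : E × (E →L[ℝ] ℝ) → M}
    (hG : Φ ∘ (cotangentChart I x₀).symm =ᶠ[𝓝 (extChartAt I x₀ x, 0)] G) :
    IsSymplecticNear I J Ω Φ x ↔ ∀ᶠ z in 𝓝 (extChartAt I x₀ x, (0 : E →L[ℝ] ℝ)),
      twoFormBilin _ (formPullback 𝓘(ℝ, E × (E →L[ℝ] ℝ)) J G Ω z) = twoFormBilin _ (stdSymplectic E) := by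
  have h1 := (eventually_zeroCovector_iff hx).1 hΦ.2
  rw [IsSymplecticNear, eventually_zeroCovector_iff hx]
  refine Filter.eventually_congr ?_
  filter_upwards [eventually_mem_cotangentChart_target hx, hG.eventuallyEq_nhds, h1] with z hz hz' hz1
  exact formPullback_eq_canonicalForm_iff_bilin hz (hz1.mdifferentiableAt (by simp)) hz'

theorem mfderiv_extChartAt_symm_comp {y₀ : M} {w : E'} (hw : w ∈ (extChartAt J y₀).target) (v : E') :
    (mfderiv 𝓘(ℝ, E') J (extChartAt J y₀).symm w (mfderiv J 𝓘(ℝ, E') (extChartAt J y₀)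
      ((extChartAt J y₀).symm w) v : E') : E') = v := by
  have hs := (extChartAt J y₀).map_target hw
  have h1 : (extChartAt J y₀).symm ∘ extChartAt J y₀ =ᶠ[𝓝 ((extChartAt J y₀).symm w)] id := by
    filter_upwards [(isOpen_extChartAt_source y₀).mem_nhds hs] with y hy
    exact (extChartAt J y₀).left_inv hy
  have h2 : (mfderiv J J ((extChartAt J y₀).symm ∘ extChartAt J y₀) ((extChartAt J y₀).symm w) :
      E' →L[ℝ] E') = mfderiv J J id ((extChartAt J y₀).symm w) := h1.mfderiv_eq
  have h3 := mfderiv_comp (I := J) (I' := 𝓘(ℝ, E')) (I'' := J) ((extChartAt J y₀).symm w)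
    (mdifferentiableAt_extChartAt_symm (x₀ := y₀) ((extChartAt J y₀).map_source hs))
    (mdifferentiableAt_extChartAt_of_mem hs)
  rw [(extChartAt J y₀).right_inv hw] at h3
  rw [mfderiv_id] at h2
  exact congrArg (fun f : E' →L[ℝ] E' => f v) (h3.symm.trans h2)

theorem mfderiv_extChartAt_comp_symm {y₀ : M} {w : E'} (hw : w ∈ (extChartAt J y₀).target) (v : E') :
    (mfderiv J 𝓘(ℝ, E') (extChartAt J y₀) ((extChartAt J y₀).symm w)
      (mfderiv 𝓘(ℝ, E') J (extChartAt J y₀).symm w v : E') : E') = v := by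
  have hs := (extChartAt J y₀).map_target hw
  have h1 : extChartAt J y₀ ∘ (extChartAt J y₀).symm =ᶠ[𝓝 w] id := by
    filter_upwards [extChartAt_target_mem_nhds_of_mem hw] with y hy
    exact (extChartAt J y₀).right_inv hy
  have h2 : (mfderiv 𝓘(ℝ, E') 𝓘(ℝ, E') (extChartAt J y₀ ∘ (extChartAt J y₀).symm) w :
      E' →L[ℝ] E') = mfderiv 𝓘(ℝ, E') 𝓘(ℝ, E') id w := h1.mfderiv_eq
  have h3 := mfderiv_comp (I := 𝓘(ℝ, E')) (I' := J) (I'' := 𝓘(ℝ, E')) w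
    (mdifferentiableAt_extChartAt_of_mem (x₀ := y₀) hs) (mdifferentiableAt_extChartAt_symm hw)
  rw [mfderiv_id] at h2
  exact congrArg (fun f : E' →L[ℝ] E' => f v) (h3.symm.trans h2)

/-- In the chart the kernel of the projection is `w.1 = 0`, because the inverse base chart has
injective derivative. -/
theorem mem_fibreTangent_iff {x₀ x : N} (hx : x ∈ (extChartAt I x₀).source)
    (v : E × (E →L[ℝ] ℝ)) :
    v ∈ fibreTangent I (zeroCovector I x) ↔ ∃ p : E →L[ℝ] ℝ,
      v = mfderiv 𝓘(ℝ, E × (E →L[ℝ] ℝ)) (cotangentModel I) (cotangentChart I x₀).symm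
        (extChartAt I x₀ x, 0) ((0, p) : E × (E →L[ℝ] ℝ)) := by
  have ht := (extChartAt I x₀).map_source hx
  have htc : (extChartAt I x₀ x, (0 : E →L[ℝ] ℝ)) ∈ (cotangentChart I x₀).target :=
    mem_cotangentChart_target.2 ht
  have h0 : (cotangentChart I x₀).symm (extChartAt I x₀ x, 0) = zeroCovector I x := by
    rw [cotangentChart_symm_zero ht, (extChartAt I x₀).left_inv hx]
  rw [← h0]
  set de := mfderiv (cotangentModel I) 𝓘(ℝ, E × (E →L[ℝ] ℝ)) (cotangentChart I x₀)
    ((cotangentChart I x₀).symm (extChartAt I x₀ x, 0)) with hde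
  have hker : ∀ w : E × (E →L[ℝ] ℝ), (mfderiv 𝓘(ℝ, E × (E →L[ℝ] ℝ)) (cotangentModel I)
      (cotangentChart I x₀).symm (extChartAt I x₀ x, 0) w : E × (E →L[ℝ] ℝ)) ∈ fibreTangent I
        ((cotangentChart I x₀).symm (extChartAt I x₀ x, (0 : E →L[ℝ] ℝ))) ↔ w.1 = 0 := by
    intro w
    have h1 := mfderiv_proj_comp_symm (zeroCovector I x₀) htc w
    have h2 : (mfderiv 𝓘(ℝ, E) I (extChartAt I x₀).symm (extChartAt I x₀ x) w.1 : E) = 0 ↔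
        w.1 = 0 := by
      constructor
      · intro h
        rw [← mfderiv_extChartAt_comp_symm ht w.1, h]
        exact map_zero _
      · intro h
        rw [h]
        exact map_zero _
    exact (show _ ↔ _ from ⟨fun h => h1.symm.trans h, fun h => h1.trans h⟩).trans h2
  have hv := mfderiv_extChartAt_symm_comp (J := cotangentModel I) (y₀ := zeroCovector I x₀) htc v
  constructor
  · intro h
    refine ⟨(de v : E × (E →L[ℝ] ℝ)).2, ?_⟩
    have h3 : (de v : E × (E →L[ℝ] ℝ)).1 = 0 := (hker _).1 (by rw [hv]; exact h)
    refine hv.symm.trans ?_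
    congr 1
    exact Prod.ext h3 rfl
  · rintro ⟨p, rfl⟩
    exact (hker (0, p)).2 rfl

variable (I J) in
/-- To first order along the zero section the map is symplectic and tangent to `Γ`. -/
def IsFirstOrderAdapted (Ω : ∀ y : M, TangentSpace J y [⋀^Fin 2]→L[ℝ] ℝ) {ι : N → M}
    (Γ : ∀ x : N, Submodule ℝ (TangentSpace J (ι x)))
    (Φ : CotangentBundle I N → M) (x : N) : Prop :=
  formPullback (cotangentModel I) J Φ Ω (zeroCovector I x) = canonicalForm I (zeroCovector I x) ∧
    ∀ v ∈ fibreTangent I (zeroCovector I x),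
      (mfderiv (cotangentModel I) J Φ (zeroCovector I x) v : E') ∈ Γ x

theorem isFirstOrderAdapted_iff {Ω : ∀ y : M, TangentSpace J y [⋀^Fin 2]→L[ℝ] ℝ}
    {ι : N → M} {Γ : ∀ x : N, Submodule ℝ (TangentSpace J (ι x))}
    {Φ : CotangentBundle I N → M} {x₀ x : N}
    (hx : x ∈ (extChartAt I x₀).source) (hΦ : IsSmoothExtensionAt I J ι Φ x) {G : E × (E →L[ℝ] ℝ) → M}
    (hG : Φ ∘ (cotangentChart I x₀).symm =ᶠ[𝓝 (extChartAt I x₀ x, 0)] G) :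
    IsFirstOrderAdapted I J Ω Γ Φ x ↔
      twoFormBilin _ (formPullback 𝓘(ℝ, E × (E →L[ℝ] ℝ)) J G Ω (extChartAt I x₀ x, 0)) =
        twoFormBilin _ (stdSymplectic E) ∧
      ∀ p : E →L[ℝ] ℝ, (mfderiv 𝓘(ℝ, E × (E →L[ℝ] ℝ)) J G (extChartAt I x₀ x, 0)
        ((0, p) : E × (E →L[ℝ] ℝ)) : E') ∈ Γ x := by
  have ht := (extChartAt I x₀).map_source hx
  have htc : (extChartAt I x₀ x, (0 : E →L[ℝ] ℝ)) ∈ (cotangentChart I x₀).target :=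
    mem_cotangentChart_target.2 ht
  have h0 : (cotangentChart I x₀).symm (extChartAt I x₀ x, 0) = zeroCovector I x := by
    rw [cotangentChart_symm_zero ht, (extChartAt I x₀).left_inv hx]
  have hd : MDifferentiableAt (cotangentModel I) J Φ
      ((cotangentChart I x₀).symm (extChartAt I x₀ x, 0)) := by
    rw [h0]; exact hΦ.2.self_of_nhds.mdifferentiableAt (by simp)
  have hcomp : ∀ w : E × (E →L[ℝ] ℝ), (mfderiv 𝓘(ℝ, E × (E →L[ℝ] ℝ)) J G (extChartAt I x₀ x, 0) w : E')
      = mfderiv (cotangentModel I) J Φ ((cotangentChart I x₀).symm (extChartAt I x₀ x, 0))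
        (mfderiv 𝓘(ℝ, E × (E →L[ℝ] ℝ)) (cotangentModel I)
          (cotangentChart I x₀).symm (extChartAt I x₀ x, 0) w) := by
    intro w
    have h1 := mfderiv_comp (I := 𝓘(ℝ, E × (E →L[ℝ] ℝ))) (extChartAt I x₀ x, (0 : E →L[ℝ] ℝ)) hd
      (mdifferentiableAt_extChartAt_symm htc)
    have h2 : (mfderiv 𝓘(ℝ, E × (E →L[ℝ] ℝ)) J (Φ ∘ (cotangentChart I x₀).symm)
      (extChartAt I x₀ x, 0) : E × (E →L[ℝ] ℝ) →L[ℝ] E') =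
        mfderiv 𝓘(ℝ, E × (E →L[ℝ] ℝ)) J G (extChartAt I x₀ x, 0) := hG.mfderiv_eq
    exact congrArg (fun f : E × (E →L[ℝ] ℝ) →L[ℝ] E' => f w) (h2.symm.trans h1)
  have hform := formPullback_eq_canonicalForm_iff_bilin (Ω := Ω) htc hd hG
  rw [h0] at hform
  rw [IsFirstOrderAdapted]
  refine and_congr hform ?_
  rw [h0] at hcomp
  constructor
  · intro h p
    rw [hcomp]
    exact h _ ((mem_fibreTangent_iff hx _).2 ⟨p, rfl⟩)
  · intro h v hv
    obtain ⟨p, rfl⟩ := (mem_fibreTangent_iff hx v).1 hv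
    have := h p
    rw [hcomp] at this
    exact this

theorem IsSmoothExtensionAt.congr {ι : N → M} {Φ Ψ : CotangentBundle I N → M} {x : N}
    (h : Φ =ᶠ[𝓝 (zeroCovector I x)] Ψ) (hΦ : IsSmoothExtensionAt I J ι Φ x) :
    IsSmoothExtensionAt I J ι Ψ x := by
  refine ⟨h.eq_of_nhds.symm.trans hΦ.1, ?_⟩
  filter_upwards [hΦ.2, h.eventuallyEq_nhds] with p hp hp'
  exact hp.congr_of_eventuallyEq hp'.symm

theorem IsSymplecticNear.congr {Ω : ∀ y : M, TangentSpace J y [⋀^Fin 2]→L[ℝ] ℝ}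
    {Φ Ψ : CotangentBundle I N → M} {x : N}
    (h : Φ =ᶠ[𝓝 (zeroCovector I x)] Ψ) (hΦ : IsSymplecticNear I J Ω Φ x) :
    IsSymplecticNear I J Ω Ψ x := by
  unfold IsSymplecticNear at hΦ ⊢
  filter_upwards [hΦ, h.eventuallyEq_nhds] with p hp hp'
  rw [← hp, formPullback_congr Ω hp']

theorem IsFirstOrderAdapted.congr {Ω : ∀ y : M, TangentSpace J y [⋀^Fin 2]→L[ℝ] ℝ}
    {ι : N → M} {Γ : ∀ x : N, Submodule ℝ (TangentSpace J (ι x))}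
    {Φ Ψ : CotangentBundle I N → M} {x : N}
    (h : Φ =ᶠ[𝓝 (zeroCovector I x)] Ψ) (hΦ : IsFirstOrderAdapted I J Ω Γ Φ x) :
    IsFirstOrderAdapted I J Ω Γ Ψ x := by
  refine ⟨(formPullback_congr Ω h).symm.trans hΦ.1, fun v hv => ?_⟩
  have h2 : (mfderiv (cotangentModel I) J Φ (zeroCovector I x) : E × (E →L[ℝ] ℝ) →L[ℝ] E') =
      mfderiv (cotangentModel I) J Ψ (zeroCovector I x) := h.mfderiv_eq
  rw [← h2]
  exact hΦ.2 v hv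

/-- Changing a map over a closed subset of the base. -/
theorem exists_glue {K : Set N} (hK : IsClosed K) {F Φ : CotangentBundle I N → M}
    (h : ∀ x ∈ K, ∀ᶠ p in 𝓝 (zeroCovector I x), p.proj ∉ K → F p = Φ p) :
    ∃ Ψ : CotangentBundle I N → M, (∀ x ∈ K, Ψ =ᶠ[𝓝 (zeroCovector I x)] F) ∧
      ∀ x, x ∉ K → Ψ =ᶠ[𝓝 (zeroCovector I x)] Φ := by
  classical
  -- Closedness of `K` settles the points off `K`; at points of `K`, its frontier included, `h`
  -- absorbs the nearby fibres that lie off `K`.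
  refine ⟨fun p => if p.proj ∈ K then F p else Φ p, fun x hx => ?_, fun x hx => ?_⟩
  · filter_upwards [h x hx] with p hp
    split_ifs with hpK
    · rfl
    · exact (hp hpK).symm
  · have h1 : Continuous fun p : CotangentBundle I N => p.proj :=
      FiberBundle.continuous_proj (E →L[ℝ] ℝ) fun x : N => TangentSpace I x →L[ℝ] ℝ
    filter_upwards [h1.continuousAt.eventually_mem (hK.isOpen_compl.mem_nhds hx)] with p hp
    exact if_neg hp

end Germs

/-- Local modifications that never destroy what is already achieved can be patched over a compact
space. -/
theorem exists_forall_of_local_modification {X Y : Type*} [TopologicalSpace X] [CompactSpace X]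
    {A B : Y → X → Prop} (h : ∀ x₀, ∃ V ∈ 𝓝 x₀, ∀ y, (∀ x, A y x) → ∃ y', (∀ x, A y' x) ∧
      (∀ x, B y x → B y' x) ∧ ∀ x ∈ V, B y' x) {y : Y} (hy : ∀ x, A y x) :
    ∃ y', ∀ x, A y' x ∧ B y' x := by
  have key : ∀ y, (∀ x, A y x) → ∃ y', (∀ x, A y' x) ∧
      (∀ x, B y x → B y' x) ∧ ∀ x ∈ (univ : Set X), B y' x := by
    -- The induction property quantifies over every starting `y`, so for a union the second
    -- modification is applied to the output of the first and keeps its gains.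
    refine isCompact_univ.induction_on (p := fun V => ∀ y, (∀ x, A y x) → ∃ y', (∀ x, A y' x) ∧
      (∀ x, B y x → B y' x) ∧ ∀ x ∈ V, B y' x) ?_ ?_ ?_ ?_
    · exact fun y hy => ⟨y, hy, fun _ h => h, fun x hx => hx.elim⟩
    · intro s t hst ht y hy
      obtain ⟨y', h1, h2, h3⟩ := ht y hy
      exact ⟨y', h1, h2, fun x hx => h3 x (hst hx)⟩
    · intro s t hs ht y hy
      obtain ⟨y', h1, h2, h3⟩ := hs y hy
      obtain ⟨y'', h1', h2', h3'⟩ := ht y' h1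
      exact ⟨y'', h1', fun x hx => h2' x (h2 x hx), fun x hx => hx.elim (fun hx => h2' x (h3 x hx))
        (h3' x)⟩
    · intro x _
      obtain ⟨V, hV, hV'⟩ := h x
      exact ⟨V, mem_nhdsWithin_of_mem_nhds hV, hV'⟩
  obtain ⟨y', h1, -, h2⟩ := key y hy
  exact ⟨y', fun x => ⟨h1 x, h2 x trivial⟩⟩

/-! ## Moser's correction over a chart of the base -/

/-- Off the topological support of `β` the product is locally zero, so `f` may be arbitrary there.
-/
theorem contDiff_smul_of_tsupport {Z W : Type*} [NormedAddCommGroup Z] [NormedSpace ℝ Z]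
    [NormedAddCommGroup W] [NormedSpace ℝ W] {β : Z → ℝ} (hβ : ContDiff ℝ ∞ β) {f : Z → W}
    (hf : ∀ z ∈ tsupport β, ContDiffAt ℝ ∞ f z) : ContDiff ℝ ∞ fun z => β z • f z := by
  refine contDiff_iff_contDiffAt.2 fun z => ?_
  by_cases hz : z ∈ tsupport β
  · exact hβ.contDiffAt.smul (hf z hz)
  · refine (contDiffAt_const (c := (0 : W))).congr_of_eventuallyEq ?_
    filter_upwards [(isClosed_tsupport β).isOpen_compl.mem_nhds hz] with z' hz'
    rw [image_eq_zero_of_notMem_tsupport hz', zero_smul]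

section

variable {E F : Type} [NormedAddCommGroup E] [NormedSpace ℝ E] [FiniteDimensional ℝ E]
  [NormedAddCommGroup F] [NormedSpace ℝ F] [FiniteDimensional ℝ F]

/-- A property holding near a compact part of the zero section holds on a uniform neighbourhood. -/
theorem exists_uniform_of_eventually {K : Set E} (hK : IsCompact K) {Q : E × F → Prop}
    (h : ∀ q ∈ K, ∀ᶠ z in 𝓝 (q, (0 : F)), Q z) :
    ∃ δ > 0, ∀ q ∈ K, ∀ p : F, ‖p‖ ≤ δ → ∀ᶠ z in 𝓝 (q, p), Q z := by
  have hcomp : IsCompact (K ×ˢ ({0} : Set F)) := hK.prod isCompact_singleton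
  obtain ⟨δ, hδ, hsub⟩ := hcomp.exists_thickening_subset_open (t := interior {z | Q z})
    isOpen_interior (by
      rintro ⟨q, p⟩ ⟨hq, hp⟩
      rw [mem_singleton_iff] at hp
      simp only at hp
      subst hp
      exact mem_interior_iff_mem_nhds.2 (h q hq))
  refine ⟨δ / 2, half_pos hδ, fun q hq p hp => mem_interior_iff_mem_nhds.1 (hsub ?_)⟩
  rw [Metric.mem_thickening_iff]
  refine ⟨(q, 0), ⟨hq, rfl⟩, ?_⟩
  rw [Prod.dist_eq]
  simp only [dist_self, dist_zero_right]
  exact max_lt hδ (by linarith)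

/-- Moser's method for a two-form that is only defined near a compact part of the zero section. -/
theorem exists_local_moser_of_eventually {θ₀ : E × F →L[ℝ] E × F →L[ℝ] ℝ}
    (hθ₀ : ∀ a b, θ₀ a b = -θ₀ b a) (hinv : θ₀.IsInvertible)
    {θ : E × F → E × F →L[ℝ] E × F →L[ℝ] ℝ} (hanti : ∀ z a b, θ z a b = -θ z b a)
    {q₀ : E} {r : ℝ} (hr : 0 < r)
    (hθ : ∀ q ∈ Metric.closedBall q₀ (4 * r), θ (q, 0) = θ₀ ∧
      ∀ᶠ z in 𝓝 (q, 0), ContDiffAt ℝ ∞ θ z ∧ IsClosedAt θ z) :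
    ∃ φ : E × F → E × F, ContDiff ℝ ∞ φ ∧
      (∀ q p, q ∉ Metric.closedBall q₀ (2 * r) → φ (q, p) = (q, p)) ∧
      (∀ q, φ (q, 0) = (q, 0) ∧ HasFDerivAt φ (ContinuousLinearMap.id ℝ (E × F)) (q, 0)) ∧
      (∀ q, (∀ᶠ z in 𝓝 (q, 0), θ z = θ₀) → ∀ᶠ z in 𝓝 (q, 0), φ z = z) ∧
      ∀ q ∈ Metric.ball q₀ r, ∀ᶠ z in 𝓝 (q, 0),
        ∀ a b, θ (φ z) (fderiv ℝ φ z a) (fderiv ℝ φ z b) = θ₀ a b := by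
  obtain ⟨δ, hδ, hgood⟩ := exists_uniform_of_eventually (isCompact_closedBall q₀ (4 * r))
    fun q hq => (hθ q hq).2
  -- The radii are nested: the correction is complete within `r`, its cutoff lives in `2 * r`, the
  -- truncated form is unaltered within `3 * r`, and `θ` is controlled up to `4 * r`.
  let β₁ : ContDiffBump q₀ := ⟨3 * r, 4 * r, by linarith, by linarith⟩
  let β₂ : ContDiffBump (0 : F) := ⟨δ / 2, δ, by linarith, by linarith⟩
  let χ : ContDiffBump q₀ := ⟨r, 2 * r, by linarith, by linarith⟩
  set β : E × F → ℝ := fun z => β₁ z.1 * β₂ z.2 with hβdef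
  have hβ : ContDiff ℝ ∞ β := (β₁.contDiff.comp contDiff_fst).mul (β₂.contDiff.comp contDiff_snd)
  have hβs : tsupport β ⊆ Metric.closedBall q₀ (4 * r) ×ˢ Metric.closedBall (0 : F) δ := by
    refine closure_minimal ?_ (Metric.isClosed_closedBall.prod Metric.isClosed_closedBall)
    intro z hz
    have hz' : β₁ z.1 * β₂ z.2 ≠ 0 := hz
    have h1 : z.1 ∈ Function.support β₁ := left_ne_zero_of_mul hz'
    have h2 : z.2 ∈ Function.support β₂ := right_ne_zero_of_mul hz'
    rw [β₁.support_eq] at h1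
    rw [β₂.support_eq] at h2
    exact ⟨Metric.ball_subset_closedBall h1, Metric.ball_subset_closedBall h2⟩
  have hβgood : ∀ z ∈ Metric.closedBall q₀ (4 * r) ×ˢ Metric.closedBall (0 : F) δ,
      ContDiffAt ℝ ∞ θ z ∧ IsClosedAt θ z := fun z hz =>
    (hgood z.1 hz.1 z.2 (by simpa using hz.2)).self_of_nhds
  set O : Set (E × F) := Metric.ball q₀ (3 * r) ×ˢ Metric.ball (0 : F) (δ / 2) with hOdef
  have hO : IsOpen O := Metric.isOpen_ball.prod Metric.isOpen_ball
  have hβ1 : ∀ z ∈ O, β z = 1 := fun z hz => by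
    have h1 := β₁.one_of_mem_closedBall (Metric.ball_subset_closedBall hz.1)
    have h2 := β₂.one_of_mem_closedBall (Metric.ball_subset_closedBall hz.2)
    simp [hβdef, h1, h2]
  -- Multiplying by `β` can destroy closedness only outside `O`, where `exists_local_moser` does not
  -- ask for it.
  set τ : E × F → E × F →L[ℝ] E × F →L[ℝ] ℝ := fun z => β z • (θ z - θ₀) with hτdef
  have hτO : ∀ z ∈ O, θ₀ + τ z = θ z := fun z hz => by simp [hτdef, hβ1 z hz]
  have hτ : ContDiff ℝ ∞ τ := contDiff_smul_of_tsupport hβ fun z hz =>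
    (hβgood z (hβs hz)).1.sub contDiffAt_const
  obtain ⟨φ, h1, h2, h3, h4, h5⟩ := exists_local_moser (B := Metric.ball q₀ (3 * r)) (δ := δ / 2)
    (χ := χ) (K := Metric.closedBall q₀ (2 * r)) hθ₀ hinv hτ
    (fun z a b => by
      simp only [hτdef, smul_apply, sub_apply, smul_eq_mul]
      rw [hanti z a b, hθ₀ a b]; ring)
    (fun q => by
      by_cases hq : q ∈ Metric.closedBall q₀ (4 * r)
      · simp [hτdef, (hθ q hq).1]
      · have : β (q, 0) = 0 := image_eq_zero_of_notMem_tsupport fun h => hq (hβs h).1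
        simp [hτdef, this])
    Metric.isOpen_ball (half_pos hδ)
    (fun z hz1 hz2 => by
      have hzO : z ∈ O := ⟨hz1, by simpa using hz2⟩
      have hcl := (hβgood z ⟨Metric.ball_subset_closedBall
        (Metric.ball_subset_ball (by linarith) hz1), by simpa using by linarith⟩).2
      have hev : τ =ᶠ[𝓝 z] fun z => θ z - θ₀ := by
        filter_upwards [hO.mem_nhds hzO] with z' hz'
        simp [hτdef, hβ1 z' hz']
      intro a b c
      rw [hev.fderiv_eq, fderiv_sub_const]
      exact hcl a b c)
    χ.contDiff (isCompact_closedBall _ _)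
    (fun q hq => by
      have : q ∉ Function.support χ := by
        rw [χ.support_eq]
        exact fun h => hq (Metric.ball_subset_closedBall h)
      simpa using this)
  refine ⟨φ, h1, h2, h3, fun q hq => h4 q ?_, fun q hq => ?_⟩
  · filter_upwards [hq] with z hz
    simp [hτdef, hz]
  · have hq3 : q ∈ Metric.ball q₀ (3 * r) := Metric.ball_subset_ball (by linarith) hq
    have hχ : ∀ᶠ q' in 𝓝 q, χ q' = 1 := by
      filter_upwards [Metric.isOpen_ball.mem_nhds hq] with q' hq'
      exact χ.one_of_mem_closedBall (Metric.ball_subset_closedBall hq')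
    have hO' : ∀ᶠ z in 𝓝 (q, (0 : F)), φ z ∈ O := by
      refine h1.continuous.continuousAt.eventually_mem (hO.mem_nhds ?_)
      rw [(h3 q).1]
      exact ⟨hq3, by simpa using hδ⟩
    filter_upwards [h5 q hq3 hχ, hO'] with z hz hzO a b
    rw [← hz a b, hτO _ hzO]

end

section

variable {E : Type} [NormedAddCommGroup E] [NormedSpace ℝ E] [FiniteDimensional ℝ E]
  {H : Type*} [TopologicalSpace H] {I : ModelWithCorners ℝ E H} [I.Boundaryless]
  {N : Type*} [TopologicalSpace N] [T2Space N] [ChartedSpace H N] [IsManifold I ∞ N]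
  {E' : Type} [NormedAddCommGroup E'] [NormedSpace ℝ E']
  {H' : Type*} [TopologicalSpace H'] {J : ModelWithCorners ℝ E' H'} [J.Boundaryless]
  {M : Type*} [TopologicalSpace M] [ChartedSpace H' M] [IsManifold J ∞ M]

theorem twoFormBilin_formPullback_comp {Z : Type} [NormedAddCommGroup Z] [NormedSpace ℝ Z]
    (Ω : ∀ y : M, TangentSpace J y [⋀^Fin 2]→L[ℝ] ℝ)
    {G : Z → M} {φ : Z → Z} {z : Z} (hG : MDifferentiableAt 𝓘(ℝ, Z) J G (φ z))
    (hφ : DifferentiableAt ℝ φ z) (a b : Z) :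
    twoFormBilin Z (formPullback 𝓘(ℝ, Z) J (G ∘ φ) Ω z) a b =
      twoFormBilin Z (formPullback 𝓘(ℝ, Z) J G Ω (φ z)) (fderiv ℝ φ z a) (fderiv ℝ φ z b) := by
  refine Eq.trans ?_ (twoFormBilin_comp (Y := Z) (formPullback 𝓘(ℝ, Z) J G Ω (φ z)) (fderiv ℝ φ z) a b)
  refine congrArg (fun β : Z [⋀^Fin 2]→L[ℝ] ℝ => twoFormBilin Z β a b) ?_
  exact (formPullback_comp (I := 𝓘(ℝ, Z)) (I' := 𝓘(ℝ, Z)) Ω hG hφ.mdifferentiableAt).trans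
    (formPullback_vectorSpace φ (formPullback 𝓘(ℝ, Z) J G Ω) z)

/-- A modification over a compact subset of a chart domain, prescribed in coordinates. -/
theorem exists_glue_chart {x₀ : N} {K : Set E} (hK : IsCompact K) (hKt : K ⊆ (extChartAt I x₀).target)
    {Φ : CotangentBundle I N → M} {G' : E × (E →L[ℝ] ℝ) → M}
    (h : ∀ q ∈ K, ∀ᶠ z in 𝓝 (q, (0 : E →L[ℝ] ℝ)), z.1 ∉ K → G' z = Φ ((cotangentChart I x₀).symm z)) :
    ∃ Ψ : CotangentBundle I N → M, (∀ x ∈ (extChartAt I x₀).source, extChartAt I x₀ x ∈ K →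
        Ψ ∘ (cotangentChart I x₀).symm =ᶠ[𝓝 (extChartAt I x₀ x, 0)] G') ∧
      ∀ x, ¬(x ∈ (extChartAt I x₀).source ∧ extChartAt I x₀ x ∈ K) →
        Ψ =ᶠ[𝓝 (zeroCovector I x)] Φ := by
  have hmem : ∀ x, x ∈ (extChartAt I x₀).symm '' K ↔
      x ∈ (extChartAt I x₀).source ∧ extChartAt I x₀ x ∈ K := by
    intro x
    constructor
    · rintro ⟨q, hq, rfl⟩
      refine ⟨(extChartAt I x₀).map_target (hKt hq), ?_⟩
      rwa [(extChartAt I x₀).right_inv (hKt hq)]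
    · rintro ⟨hx, hq⟩
      exact ⟨_, hq, (extChartAt I x₀).left_inv hx⟩
  have hKc : IsClosed ((extChartAt I x₀).symm '' K) :=
    (hK.image_of_continuousOn ((continuousOn_extChartAt_symm x₀).mono hKt)).isClosed
  obtain ⟨Ψ, h1, h2⟩ := exists_glue (Φ := Φ) (F := G' ∘ cotangentChart I x₀) hKc (fun x hx => by
    obtain ⟨hxs, hxK⟩ := (hmem x).1 hx
    rw [eventually_zeroCovector_iff hxs]
    filter_upwards [h _ hxK, eventually_mem_cotangentChart_target hxs] with z hz hzt hzK
    rw [Function.comp_apply, (cotangentChart I x₀).right_inv hzt]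
    refine hz fun hz1 => hzK ?_
    rw [cotangentChart_symm_proj (hKt hz1)]
    exact mem_image_of_mem _ hz1)
  refine ⟨Ψ, fun x hxs hxK => ?_, fun x hx => h2 x fun h => hx ((hmem x).1 h)⟩
  have h3 := (eventually_zeroCovector_iff hxs).1 (h1 x ((hmem x).2 ⟨hxs, hxK⟩))
  filter_upwards [h3, eventually_mem_cotangentChart_target hxs] with z hz hzt
  rw [Function.comp_apply, hz, Function.comp_apply, (cotangentChart I x₀).right_inv hzt]

/-- First-order adaptedness says that the pulled back form is standard on the zero section, so
Moser's method applies and the new map is `G ∘ φ`. The identity differential of `φ` along the zero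
section preserves the first-order data, and `φ` is the identity near points where the form was
already standard. -/
theorem exists_symplectic_modification {Ω : ∀ y : M, TangentSpace J y [⋀^Fin 2]→L[ℝ] ℝ}
    (hΩ : IsSmoothForm J Ω) (hcl : ∀ y, formExtDeriv J Ω y = 0) {ι : N → M}
    {Γ : ∀ x : N, Submodule ℝ (TangentSpace J (ι x))} (x₀ : N) :
    ∃ V ∈ 𝓝 x₀, ∀ Φ : CotangentBundle I N → M,
      (∀ x, IsSmoothExtensionAt I J ι Φ x ∧ IsFirstOrderAdapted I J Ω Γ Φ x) →
      ∃ Ψ : CotangentBundle I N → M,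
        (∀ x, IsSmoothExtensionAt I J ι Ψ x ∧ IsFirstOrderAdapted I J Ω Γ Ψ x) ∧
        (∀ x, IsSymplecticNear I J Ω Φ x → IsSymplecticNear I J Ω Ψ x) ∧
        ∀ x ∈ V, IsSymplecticNear I J Ω Ψ x := by
  set c := extChartAt I x₀ with hc
  have hx₀ : x₀ ∈ c.source := mem_extChartAt_source x₀
  obtain ⟨R, hR, hRt⟩ := Metric.nhds_basis_closedBall.mem_iff.1
    (extChartAt_target_mem_nhds_of_mem (c.map_source hx₀))
  set r := R / 4 with hrdef
  have hr : 0 < r := by positivity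
  have hRr : 4 * r = R := by rw [hrdef]; ring
  have hKt : Metric.closedBall (c x₀) (2 * r) ⊆ c.target :=
    (Metric.closedBall_subset_closedBall (by linarith)).trans hRt
  refine ⟨c.source ∩ c ⁻¹' Metric.ball (c x₀) r, Filter.inter_mem (extChartAt_source_mem_nhds x₀)
    ((continuousAt_extChartAt x₀).preimage_mem_nhds (Metric.ball_mem_nhds _ hr)), fun Φ hΦ => ?_⟩
  set G := Φ ∘ (cotangentChart I x₀).symm with hG
  have hGx : ∀ x ∈ c.source, _ := fun x hx =>
    (isSmoothExtensionAt_iff (J := J) (ι := ι) (Φ := Φ) hx (Filter.EventuallyEq.refl _ G)).1 (hΦ x).1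
  have hGf : ∀ x ∈ c.source, _ := fun x hx =>
    (isFirstOrderAdapted_iff (Γ := Γ) hx (hΦ x).1 (Filter.EventuallyEq.refl _ G)).1 (hΦ x).2
  set θ : E × (E →L[ℝ] ℝ) → E × (E →L[ℝ] ℝ) →L[ℝ] E × (E →L[ℝ] ℝ) →L[ℝ] ℝ := fun z =>
    twoFormBilin _ (formPullback 𝓘(ℝ, E × (E →L[ℝ] ℝ)) J G Ω z) with hθ
  obtain ⟨φ, hφ, hφK, hφ0, hφid, hφs⟩ := exists_local_moser_of_eventually
    (θ₀ := twoFormBilin _ (stdSymplectic E)) (θ := θ) (fun a b => twoFormBilin_swap _ a b)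
    (isInvertible_stdSymplectic E) (fun z a b => twoFormBilin_swap _ a b) hr (q₀ := c x₀)
    (fun q hq => by
      rw [hRr] at hq
      have hxs := c.map_target (hRt hq)
      have h1 := hGx _ hxs
      have h2 := hGf _ hxs
      rw [← hc, c.right_inv (hRt hq)] at h1 h2
      refine ⟨h2.1, ?_⟩
      filter_upwards [h1.2] with z hz
      exact ⟨contDiffAt_twoFormBilin_formPullback hΩ hz, isClosedAt_formPullback hΩ hcl hz⟩)
  obtain ⟨Ψ, hΨ1, hΨ2⟩ := exists_glue_chart (Φ := Φ) (G' := G ∘ φ) (isCompact_closedBall _ (2 * r))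
    hKt (fun q hq => Filter.Eventually.of_forall fun z hz => by
      have : φ z = z := hφK z.1 z.2 hz
      rw [Function.comp_apply, this]; rfl)
  have hφt : ∀ q, Filter.Tendsto φ (𝓝 (q, 0)) (𝓝 (q, 0)) := fun q => by
    have := hφ.continuous.tendsto (q, (0 : E →L[ℝ] ℝ))
    rwa [(hφ0 q).1] at this
  have hS : ∀ x, IsSmoothExtensionAt I J ι Ψ x := by
    intro x
    by_cases hx : x ∈ c.source ∧ c x ∈ Metric.closedBall (c x₀) (2 * r)
    · refine (isSmoothExtensionAt_iff hx.1 (hΨ1 x hx.1 hx.2)).2 ⟨?_, ?_⟩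
      · rw [Function.comp_apply, (hφ0 _).1]
        exact (hGx x hx.1).1
      · filter_upwards [(hφt (c x)).eventually (hGx x hx.1).2] with z hz
        exact hz.comp z hφ.contDiffAt.contMDiffAt
    · exact (hΦ x).1.congr (hΨ2 x hx).symm
  refine ⟨Ψ, fun x => ⟨hS x, ?_⟩, fun x hΦx => ?_, fun x hx => ?_⟩
  · by_cases hx : x ∈ c.source ∧ c x ∈ Metric.closedBall (c x₀) (2 * r)
    · have hd : MDifferentiableAt 𝓘(ℝ, E × (E →L[ℝ] ℝ)) J G (φ (c x, 0)) := by
        rw [(hφ0 _).1]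
        exact (hGx x hx.1).2.self_of_nhds.mdifferentiableAt (by simp)
      have hφd : DifferentiableAt ℝ φ (c x, 0) := hφ.differentiable (by simp) _
      refine (isFirstOrderAdapted_iff hx.1 (hS x) (hΨ1 x hx.1 hx.2)).2 ⟨?_, fun p => ?_⟩
      · refine ContinuousLinearMap.ext fun a => ContinuousLinearMap.ext fun b => ?_
        rw [twoFormBilin_formPullback_comp Ω hd hφd, (hφ0 _).2.fderiv, (hφ0 _).1]
        exact congrArg (fun B : E × (E →L[ℝ] ℝ) →L[ℝ] E × (E →L[ℝ] ℝ) →L[ℝ] ℝ => B a b)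
          (hGf x hx.1).1
      · have h1 := mfderiv_comp (I := 𝓘(ℝ, E × (E →L[ℝ] ℝ))) (c x, (0 : E →L[ℝ] ℝ)) hd
          hφd.mdifferentiableAt
        rw [mfderiv_eq_fderiv, (hφ0 _).2.fderiv, (hφ0 _).1] at h1
        have h2 := congrArg (fun f : E × (E →L[ℝ] ℝ) →L[ℝ] E' => f (0, p)) h1
        have h3 := (hGf x hx.1).2 p
        exact Eq.mpr (congrArg (fun w : E' => w ∈ (Γ x : Submodule ℝ E')) h2) h3
    · exact (hΦ x).2.congr (hΨ2 x hx).symm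
  · by_cases hx : x ∈ c.source ∧ c x ∈ Metric.closedBall (c x₀) (2 * r)
    · have h1 := (isSymplecticNear_iff hx.1 (hΦ x).1 (Filter.EventuallyEq.refl _ G)).1 hΦx
      refine (isSymplecticNear_iff hx.1 (hS x) (G := G) ((hΨ1 x hx.1 hx.2).trans ?_)).2 h1
      filter_upwards [hφid _ h1] with z hz
      rw [Function.comp_apply, hz]
    · exact hΦx.congr (hΨ2 x hx).symm
  · have hx2 : c x ∈ Metric.closedBall (c x₀) (2 * r) :=
      Metric.ball_subset_closedBall (Metric.ball_subset_ball (by linarith) hx.2)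
    refine (isSymplecticNear_iff hx.1 (hS x) (hΨ1 x hx.1 hx2)).2 ?_
    filter_upwards [hφs _ hx.2, (hφt (c x)).eventually (hGx x hx.1).2] with z hz hz'
    refine ContinuousLinearMap.ext fun a => ContinuousLinearMap.ext fun b => ?_
    rw [twoFormBilin_formPullback_comp Ω (hz'.mdifferentiableAt (by simp))
      (hφ.differentiable (by simp) _)]
    exact hz a b

end

/-! ## First-order correction along the zero section -/

section

variable {E : Type} [NormedAddCommGroup E] [NormedSpace ℝ E] [FiniteDimensional ℝ E]
  {H : Type*} [TopologicalSpace H] {I : ModelWithCorners ℝ E H} [I.Boundaryless]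
  {N : Type*} [TopologicalSpace N] [ChartedSpace H N] [IsManifold I ∞ N]
  {E' : Type} [NormedAddCommGroup E'] [NormedSpace ℝ E'] [FiniteDimensional ℝ E']
  {H' : Type*} [TopologicalSpace H'] {J : ModelWithCorners ℝ E' H'} [J.Boundaryless]
  {M : Type*} [TopologicalSpace M] [ChartedSpace H' M] [IsManifold J ∞ M]

/-- The coordinate expression of a smooth vector field along a map is smooth. -/
theorem contDiffAt_coord_of_contMDiffAt {ι : N → M} {s : ∀ x, TangentSpace J (ι x)} {x₀ : N} {q : E}
    {y₀ : M} (hq : q ∈ (extChartAt I x₀).target)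
    (hy : ι ((extChartAt I x₀).symm q) ∈ (extChartAt J y₀).source)
    (hs : ContMDiffAt I J.tangent ∞ (fun x => (⟨ι x, s x⟩ : TangentBundle J M))
      ((extChartAt I x₀).symm q)) :
    ContDiffAt ℝ ∞ (fun q' => (mfderiv J 𝓘(ℝ, E') (extChartAt J y₀) (ι ((extChartAt I x₀).symm q'))
      (s ((extChartAt I x₀).symm q')) : E')) q := by
  have hy' : ι ((extChartAt I x₀).symm q) ∈ (chartAt H' y₀).source := by
    rwa [extChartAt_source] at hy
  have h1 := ((Bundle.Trivialization.contMDiffAt_iff (e := trivializationAt E' (TangentSpace J : M → Type _) y₀)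
    (by simpa using hy')).1 hs)
  have h2 := (h1.2.comp q (contMDiffAt_extChartAt_symm hq)).contDiffAt
  refine h2.congr_of_eventuallyEq ?_
  have h3 : ContinuousAt (fun q' => ι ((extChartAt I x₀).symm q')) q :=
    ContinuousAt.comp (g := ι) h1.1.continuousAt (contMDiffAt_extChartAt_symm hq).continuousAt
  filter_upwards [h3.eventually_mem ((chartAt H' y₀).open_source.mem_nhds hy')] with q' hq'
  have h4 := TangentBundle.continuousLinearMapAt_trivializationAt (I := J) (𝕜 := ℝ) hq'
  have h5 := congrArg (fun f : E' →L[ℝ] E' => f (s ((extChartAt I x₀).symm q') : E')) h4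
  refine h5.symm.trans ?_
  change ((trivializationAt E' (TangentSpace J : M → Type _) y₀).continuousLinearMapAt ℝ _) _ = _
  rw [Bundle.Trivialization.continuousLinearMapAt_apply, Bundle.Trivialization.linearMapAt_apply]
  rw [if_pos (by simpa using hq')]
  rfl

theorem twoFormBilin_formInChart (Ω : ∀ y : M, TangentSpace J y [⋀^Fin 2]→L[ℝ] ℝ) {y₀ y : M}
    (hy : y ∈ (extChartAt J y₀).source) (a b : E') :
    twoFormBilin E' (formInChart J Ω y₀ (extChartAt J y₀ y)) a b =
      twoFormBilin E' (Ω y) (mfderiv 𝓘(ℝ, E') J (extChartAt J y₀).symm (extChartAt J y₀ y) a : E')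
        (mfderiv 𝓘(ℝ, E') J (extChartAt J y₀).symm (extChartAt J y₀ y) b : E') := by
  have h1 : (Ω ((extChartAt J y₀).symm (extChartAt J y₀ y)) : E' [⋀^Fin 2]→L[ℝ] ℝ) = Ω y := by
    rw [(extChartAt J y₀).left_inv hy]
  rw [← h1]
  exact twoFormBilin_comp (Z := E') (Y := E') (Ω ((extChartAt J y₀).symm (extChartAt J y₀ y))) (mfderiv 𝓘(ℝ, E') J (extChartAt J y₀).symm (extChartAt J y₀ y)) a b

theorem mfderiv_comp_extChartAt_symm {ι : N → M} {x₀ : N} {q : E}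
    (hq : q ∈ (extChartAt I x₀).target) (hι : MDifferentiableAt I J ι ((extChartAt I x₀).symm q))
    (v : E) : (mfderiv 𝓘(ℝ, E) J (ι ∘ (extChartAt I x₀).symm) q v : E') =
      mfderiv I J ι ((extChartAt I x₀).symm q)
        (mfderiv 𝓘(ℝ, E) I (extChartAt I x₀).symm q v : E) :=
  congrArg (fun f : E →L[ℝ] E' => f v)
    (mfderiv_comp (I := 𝓘(ℝ, E)) q hι (mdifferentiableAt_extChartAt_symm hq))

/-- In coordinates, the linear maps from covectors into the given transverse Lagrangian
distribution which are dual to the tangent spaces of the Lagrangian submanifold. -/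
theorem exists_dual_frame {m : ℕ} (hm : Module.finrank ℝ E = m)
    {Ω : ∀ y : M, TangentSpace J y [⋀^Fin 2]→L[ℝ] ℝ}
    (hΩ : IsSmoothForm J Ω) {ι : N → M} (hι : ContMDiff I J ∞ ι)
    (hN : ∀ x, IsLagrangianSubspace (Ω (ι x)) (mfderiv I J ι x).range)
    {Γ : ∀ x : N, Submodule ℝ (TangentSpace J (ι x))} (hΓ : IsSmoothDistributionAlong I J m ι Γ)
    (hΓN : ∀ x, Γ x ⊓ (mfderiv I J ι x).range = ⊥) (x₀ : N) :
    ∃ D ∈ 𝓝 (extChartAt I x₀ x₀), ∃ A : E → (E →L[ℝ] ℝ) →L[ℝ] E', ∀ q ∈ D,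
      q ∈ (extChartAt I x₀).target ∧ ι ((extChartAt I x₀).symm q) ∈ (extChartAt J (ι x₀)).source ∧
      ContDiffAt ℝ ∞ A q ∧
      (∀ p, (mfderiv 𝓘(ℝ, E') J (extChartAt J (ι x₀)).symm
        (extChartAt J (ι x₀) (ι ((extChartAt I x₀).symm q))) (A q p) : E') ∈
          Γ ((extChartAt I x₀).symm q)) ∧
      (∀ p v, twoFormBilin E' (formInChart J Ω (ι x₀)
        (extChartAt J (ι x₀) (ι ((extChartAt I x₀).symm q))))
        (fderiv ℝ (extChartAt J (ι x₀) ∘ (ι ∘ (extChartAt I x₀).symm)) q v) (A q p) = p v) ∧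
      ∀ (p : E →L[ℝ] ℝ) (w : E'), (mfderiv 𝓘(ℝ, E') J (extChartAt J (ι x₀)).symm
        (extChartAt J (ι x₀) (ι ((extChartAt I x₀).symm q))) w : E') ∈ Γ ((extChartAt I x₀).symm q) →
        (∀ v, twoFormBilin E' (formInChart J Ω (ι x₀)
          (extChartAt J (ι x₀) (ι ((extChartAt I x₀).symm q))))
          (fderiv ℝ (extChartAt J (ι x₀) ∘ (ι ∘ (extChartAt I x₀).symm)) q v) w = p v) →
        w = A q p := by
  set c := extChartAt I x₀ with hc
  set d := extChartAt J (ι x₀) with hd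
  have hx₀ : x₀ ∈ c.source := mem_extChartAt_source x₀
  obtain ⟨V, hV, s, hs, hsΓ⟩ := hΓ x₀
  have hD1 : ∀ᶠ q in 𝓝 (c x₀), q ∈ c.target := extChartAt_target_mem_nhds_of_mem (c.map_source hx₀)
  have hcs : Filter.Tendsto c.symm (𝓝 (c x₀)) (𝓝 x₀) := by
    have := (contMDiffAt_extChartAt_symm (I := I) (c.map_source hx₀)).continuousAt
    rw [ContinuousAt, ← hc, c.left_inv hx₀] at this
    exact this
  have hD2 : ∀ᶠ q in 𝓝 (c x₀), ∀ᶠ x in 𝓝 (c.symm q), x ∈ V := hcs.eventually (eventually_mem_nhds_iff.2 hV)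
  have hD3 : ∀ᶠ q in 𝓝 (c x₀), ι (c.symm q) ∈ d.source :=
    (hι.continuous.continuousAt.tendsto.comp hcs).eventually
      ((isOpen_extChartAt_source (ι x₀)).mem_nhds (mem_extChartAt_source (ι x₀)))
  -- `S₀` is the frame of `Γ` read in the chart of `M`; `T` pairs its combinations with the tangent
  -- vectors of `N`, and the required map is `S` after the inverse of `T`.
  set S₀ : Fin m → E → E' := fun i q => mfderiv J 𝓘(ℝ, E') d (ι (c.symm q)) (s i (c.symm q)) with hS₀
  set S : E → (Fin m → ℝ) →L[ℝ] E' := fun q =>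
    ∑ i, (ContinuousLinearMap.proj (R := ℝ) (φ := fun _ : Fin m => ℝ) i).smulRight (S₀ i q) with hS
  set W : E → E' →L[ℝ] E' →L[ℝ] ℝ := fun q =>
    twoFormBilin E' (formInChart J Ω (ι x₀) ((d ∘ (ι ∘ c.symm)) q)) with hW
  set T : E → (Fin m → ℝ) →L[ℝ] E →L[ℝ] ℝ := fun q =>
    (ContinuousLinearMap.flipₗᵢ ℝ E E' ℝ ((W q).comp (fderiv ℝ (d ∘ (ι ∘ c.symm)) q))).comp (S q) with hT
  have hSa : ∀ q a, S q a = ∑ i, a i • S₀ i q := fun q a => by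
    simp [hS]
  have hTa : ∀ q a v, T q a v = W q (fderiv ℝ (d ∘ (ι ∘ c.symm)) q v) (S q a) := fun q a v => rfl
  refine ⟨_, hD1.and (hD2.and hD3), fun q => (S q).comp (T q).inverse, ?_⟩
  rintro q ⟨hq1, hq2, hq3⟩
  set x := c.symm q with hx
  set L : E' →L[ℝ] E' := mfderiv 𝓘(ℝ, E') J d.symm (d (ι x)) with hL
  set σ : Fin m → E' := fun i => s i x with hσ
  have hLs : ∀ i, L (S₀ i q) = σ i := fun i => by
    have := mfderiv_extChartAt_symm_comp (d.map_source hq3) (s i x : E')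
    rw [← hd, d.left_inv hq3] at this
    exact this
  have hLinj : Function.Injective L := fun u v huv => by
    have h1 := mfderiv_extChartAt_comp_symm (d.map_source hq3) u
    have h2 := mfderiv_extChartAt_comp_symm (d.map_source hq3) v
    rw [← h1, ← h2]
    exact congrArg _ huv
  have hLS : ∀ a, L (S q a) = ∑ i, a i • σ i := fun a => by
    rw [hSa, map_sum]
    simp only [map_smul, hLs]
  have hxV := hsΓ x hq2.self_of_nhds
  have hspan : Submodule.span ℝ (Set.range σ) = (Γ x : Submodule ℝ E') := hxV.2
  have hLSΓ : ∀ a, L (S q a) ∈ (Γ x : Submodule ℝ E') := fun a => by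
    rw [hLS, ← hspan]
    exact Submodule.sum_mem _ fun i _ => Submodule.smul_mem _ _ (Submodule.subset_span ⟨i, rfl⟩)
  have hιd : MDifferentiableAt 𝓘(ℝ, E) J (ι ∘ c.symm) q :=
    (hι.mdifferentiableAt (by simp)).comp q (mdifferentiableAt_extChartAt_symm hq1)
  have hLd : ∀ v, L (fderiv ℝ (d ∘ (ι ∘ c.symm)) q v) = (mfderiv I J ι x
      (mfderiv 𝓘(ℝ, E) I c.symm q v : E) : E') := fun v =>
    (mfderiv_symm_comp_fderiv hιd hq3 v).trans
      (mfderiv_comp_extChartAt_symm hq1 (hι.mdifferentiableAt (by simp)) v)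
  have hWa : ∀ a b, W q a b = twoFormBilin E' (Ω (ι x)) (L a) (L b) := fun a b =>
    twoFormBilin_formInChart Ω hq3 a b
  -- A vector of `Γ` orthogonal to `T_xN` lies in `T_xN`, which is its own orthogonal, so
  -- transversality makes it zero; independence of the frame then kills its coefficients.
  have hTinj : Function.Injective (T q) := by
    refine (injective_iff_map_eq_zero _).2 fun a ha => ?_
    have h1 : (L (S q a) : E') ∈ ((mfderiv I J ι x).range : Submodule ℝ E') := by
      refine (hN x _).2 ?_
      rintro _ ⟨u, rfl⟩
      obtain ⟨u', hu'⟩ : ∃ u' : E, (mfderiv 𝓘(ℝ, E) I c.symm q u' : E) = u :=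
        ⟨_, mfderiv_extChartAt_symm_comp hq1 u⟩
      have h2 : T q a u' = 0 := by rw [ha]; rfl
      rw [hTa, hWa, hLd, hu'] at h2
      exact (twoFormBilin_apply (Z := E') (Ω (ι x)) _ _).symm.trans
        (neg_eq_zero.1 ((twoFormBilin_swap (Z := E') (Ω (ι x)) _ _).symm.trans h2))
    have h2 : (L (S q a) : E') ∈ (Γ x ⊓ (mfderiv I J ι x).range : Submodule ℝ E') := ⟨hLSΓ a, h1⟩
    have h3 : L (S q a) = 0 := by
      have h4 : (Γ x ⊓ (mfderiv I J ι x).range : Submodule ℝ E') = ⊥ := hΓN x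
      rwa [h4, Submodule.mem_bot] at h2
    rw [hLS] at h3
    exact funext (Fintype.linearIndependent_iff.1 hxV.1 a h3)
  have hTinv : (T q).IsInvertible := by
    have hdim : Module.finrank ℝ (Fin m → ℝ) = Module.finrank ℝ (E →L[ℝ] ℝ) := by
      rw [Module.finrank_fin_fun, ← hm]
      exact Subspace.dual_finrank_eq.symm.trans (LinearMap.toContinuousLinearMap.finrank_eq)
    exact ⟨(LinearMap.linearEquivOfInjective (T q).toLinearMap hTinj hdim).toContinuousLinearEquiv, rfl⟩
  have hTT : ∀ p, T q ((T q).inverse p) = p := fun p => hTinv.self_apply_inverse p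
  refine ⟨hq1, hq3, ?_, fun p => hLSΓ _, fun p v => ?_, fun p w hw hwp => ?_⟩
  · have hSc : ContDiffAt ℝ ∞ S q := by
      refine ContDiffAt.sum fun i _ => ?_
      refine contDiffAt_const.smulRight ?_
      exact contDiffAt_coord_of_contMDiffAt hq1 hq3 ((hs i).contMDiffAt hq2)
    have hid : ContDiffAt ℝ ∞ (d ∘ (ι ∘ c.symm)) q :=
      contDiffAt_extChartAt_comp ((hι _).comp q (contMDiffAt_extChartAt_symm hq1)) hq3
    have hWc : ContDiffAt ℝ ∞ W q := by
      refine (twoFormBilin E').contDiff.contDiffAt.comp q (ContDiffAt.comp q ?_ hid)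
      exact (hΩ (ι x₀)).contDiffAt (extChartAt_target_mem_nhds_of_mem (d.map_source hq3))
    have hTc : ContDiffAt ℝ ∞ T q :=
      ((ContinuousLinearMap.flipₗᵢ ℝ E E' ℝ).contDiff.contDiffAt.comp q
        (hWc.clm_comp (hid.fderiv_right (by simp)))).clm_comp hSc
    obtain ⟨e, he⟩ := hTinv
    have h1 : ContDiffAt ℝ ∞ (ContinuousLinearMap.inverse (R := ℝ) :
        ((Fin m → ℝ) →L[ℝ] E →L[ℝ] ℝ) → (E →L[ℝ] ℝ) →L[ℝ] Fin m → ℝ) (T q) := by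
      rw [← he]
      exact contDiffAt_map_inverse e
    exact hSc.clm_comp (h1.comp q hTc)
  · have h1 := congrArg (fun f : E →L[ℝ] ℝ => f v) (hTT p)
    exact h1
  · have hw' : L w ∈ Submodule.span ℝ (Set.range σ) := by
      rw [hspan]
      exact hw
    obtain ⟨a, ha⟩ := (Submodule.mem_span_range_iff_exists_fun ℝ).1 hw'
    have h1 : S q a = w := hLinj ((hLS a).trans ha)
    have h2 : T q a = p := ContinuousLinearMap.ext fun v => by
      rw [hTa, h1]
      exact hwp v
    change w = S q ((T q).inverse p)
    rw [← h2, hTinv.inverse_apply_self, h1]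

end

/-! ## First-order modification over a chart of the base -/

section

variable {E : Type} [NormedAddCommGroup E] [NormedSpace ℝ E] [FiniteDimensional ℝ E]
  {H : Type*} [TopologicalSpace H] {I : ModelWithCorners ℝ E H} [I.Boundaryless]
  {N : Type*} [TopologicalSpace N] [ChartedSpace H N] [IsManifold I ∞ N]
  {E' : Type} [NormedAddCommGroup E'] [NormedSpace ℝ E'] [FiniteDimensional ℝ E']
  {H' : Type*} [TopologicalSpace H'] {J : ModelWithCorners ℝ E' H'} [J.Boundaryless]
  {M : Type*} [TopologicalSpace M] [ChartedSpace H' M] [IsManifold J ∞ M]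

/-- Being adapted to first order determines the vertical derivative. -/
theorem isFirstOrderAdapted_iff_fderiv {Ω : ∀ y : M, TangentSpace J y [⋀^Fin 2]→L[ℝ] ℝ} {ι : N → M}
    (hι : ContMDiff I J ∞ ι)
    (hN : ∀ x, IsLagrangianSubspace (Ω (ι x)) (mfderiv I J ι x).range)
    {Γ : ∀ x : N, Submodule ℝ (TangentSpace J (ι x))}
    (hΓL : ∀ x, IsLagrangianSubspace (Ω (ι x)) (Γ x))
    {x₀ : N} {y₀ : M} {q : E} (hq : q ∈ (extChartAt I x₀).target)
    (hy : ι ((extChartAt I x₀).symm q) ∈ (extChartAt J y₀).source) {A : (E →L[ℝ] ℝ) →L[ℝ] E'}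
    (hA1 : ∀ p, (mfderiv 𝓘(ℝ, E') J (extChartAt J y₀).symm
        (extChartAt J y₀ (ι ((extChartAt I x₀).symm q))) (A p) : E') ∈
          Γ ((extChartAt I x₀).symm q))
    (hA2 : ∀ p v, twoFormBilin E' (formInChart J Ω y₀
        (extChartAt J y₀ (ι ((extChartAt I x₀).symm q))))
        (fderiv ℝ (extChartAt J y₀ ∘ (ι ∘ (extChartAt I x₀).symm)) q v) (A p) = p v)
    (hA3 : ∀ (p : E →L[ℝ] ℝ) (w : E'), (mfderiv 𝓘(ℝ, E') J (extChartAt J y₀).symm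
        (extChartAt J y₀ (ι ((extChartAt I x₀).symm q))) w : E') ∈ Γ ((extChartAt I x₀).symm q) →
        (∀ v, twoFormBilin E' (formInChart J Ω y₀
          (extChartAt J y₀ (ι ((extChartAt I x₀).symm q))))
          (fderiv ℝ (extChartAt J y₀ ∘ (ι ∘ (extChartAt I x₀).symm)) q v) w = p v) → w = A p)
    {Φ : CotangentBundle I N → M} (hΦ : IsSmoothExtensionAt I J ι Φ ((extChartAt I x₀).symm q))
    {G : E × (E →L[ℝ] ℝ) → M} (hG : Φ ∘ (cotangentChart I x₀).symm =ᶠ[𝓝 (q, 0)] G)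
    (hG0 : ∀ᶠ q' in 𝓝 q, G (q', 0) = ι ((extChartAt I x₀).symm q')) :
    IsFirstOrderAdapted I J Ω Γ Φ ((extChartAt I x₀).symm q) ↔
      ∀ p : E →L[ℝ] ℝ, fderiv ℝ (extChartAt J y₀ ∘ G) (q, 0) (0, p) = A p := by
  set c := extChartAt I x₀ with hc
  set d := extChartAt J y₀ with hd
  set x := c.symm q with hx
  have hxs : x ∈ c.source := c.map_target hq
  have hcx : c x = q := c.right_inv hq
  have hG' : Φ ∘ (cotangentChart I x₀).symm =ᶠ[𝓝 (c x, 0)] G := by rwa [hcx]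
  have hS := (isSmoothExtensionAt_iff hxs hG').1 hΦ
  rw [isFirstOrderAdapted_iff hxs hΦ hG']
  rw [← hc, hcx] at hS ⊢
  have hGd : MDifferentiableAt 𝓘(ℝ, E × (E →L[ℝ] ℝ)) J G (q, 0) :=
    hS.2.self_of_nhds.mdifferentiableAt (by simp)
  have hGy : G (q, 0) ∈ d.source := by rw [hS.1]; exact hy
  set g := d ∘ G with hg
  have hgd : DifferentiableAt ℝ g (q, 0) :=
    (contDiffAt_extChartAt_comp hS.2.self_of_nhds hGy).differentiableAt (by simp)
  set W := twoFormBilin E' (formInChart J Ω y₀ (d (ι x))) with hW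
  set L : E' →L[ℝ] E' := mfderiv 𝓘(ℝ, E') J d.symm (d (ι x)) with hL
  have hWa : ∀ a b, W a b = twoFormBilin E' (Ω (ι x)) (L a) (L b) := fun a b =>
    twoFormBilin_formInChart Ω hy a b
  have hform : ∀ a b, twoFormBilin _ (formPullback 𝓘(ℝ, E × (E →L[ℝ] ℝ)) J G Ω (q, 0)) a b =
      W (fderiv ℝ g (q, 0) a) (fderiv ℝ g (q, 0) b) := fun a b => by
    rw [formPullback_eq_formInChart Ω hGd hGy, twoFormBilin_comp, hW, ← hS.1]
    rfl
  have hbase : ∀ v, fderiv ℝ g (q, 0) (v, 0) = fderiv ℝ (d ∘ (ι ∘ c.symm)) q v := by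
    intro v
    have h1 : HasFDerivAt (fun q' => g (q', 0)) ((fderiv ℝ g (q, 0)).comp
        (ContinuousLinearMap.inl ℝ E (E →L[ℝ] ℝ))) q :=
      HasFDerivAt.comp (f := fun q' => (q', (0 : E →L[ℝ] ℝ))) q hgd.hasFDerivAt
        (hasFDerivAt_prodMk_left q 0)
    have h2 : (fun q' => g (q', 0)) =ᶠ[𝓝 q] d ∘ (ι ∘ c.symm) := by
      filter_upwards [hG0] with q' hq'
      simp only [hg, Function.comp_apply, hq']
    rw [← h2.fderiv_eq, h1.fderiv]
    rfl
  have hLd : ∀ v, L (fderiv ℝ (d ∘ (ι ∘ c.symm)) q v) = (mfderiv I J ι x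
      (mfderiv 𝓘(ℝ, E) I c.symm q v : E) : E') := fun v =>
    (mfderiv_symm_comp_fderiv ((hι.mdifferentiableAt (by simp)).comp q
      (mdifferentiableAt_extChartAt_symm hq)) hy v).trans
      (mfderiv_comp_extChartAt_symm hq (hι.mdifferentiableAt (by simp)) v)
  have hLg : ∀ a, L (fderiv ℝ g (q, 0) a) = mfderiv 𝓘(ℝ, E × (E →L[ℝ] ℝ)) J G (q, 0) a := by
    intro a
    have h1 := mfderiv_symm_comp_fderiv hGd hGy a
    rw [hS.1] at h1
    exact h1
  constructor
  · rintro ⟨h1, h2⟩ p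
    refine hA3 p _ (by have := h2 p; rw [← hLg] at this; exact this) fun v => ?_
    rw [← hbase, ← hform, h1, stdSymplectic_apply]
    simp
  · intro h
    refine ⟨ContinuousLinearMap.ext fun a => ContinuousLinearMap.ext fun b => ?_, fun p => ?_⟩
    -- The form is compared block by block: base with base vanishes because `N` is Lagrangian, fibre
    -- with fibre because `Γ` is, and the mixed blocks are `hA2`.
    · have hsplit : ∀ a : E × (E →L[ℝ] ℝ), fderiv ℝ g (q, 0) a =
          fderiv ℝ (d ∘ (ι ∘ c.symm)) q a.1 + A a.2 := fun a => by
        rw [← hbase, ← h, ← map_add]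
        simp
      have h1 : ∀ v v', W (fderiv ℝ (d ∘ (ι ∘ c.symm)) q v) (fderiv ℝ (d ∘ (ι ∘ c.symm)) q v') = 0 := by
        intro v v'
        rw [hWa, hLd, hLd]
        exact (twoFormBilin_apply (Z := E') (Ω (ι x)) _ _).trans ((hN x _).1 ⟨_, rfl⟩ _ ⟨_, rfl⟩)
      have h2 : ∀ p p', W (A p) (A p') = 0 := by
        intro p p'
        rw [hWa]
        exact (twoFormBilin_apply (Z := E') (Ω (ι x)) _ _).trans
          ((hΓL x _).1 (hA1 p) _ (hA1 p'))
      have h3 : ∀ p v, W (A p) (fderiv ℝ (d ∘ (ι ∘ c.symm)) q v) = -p v := fun p v => by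
        rw [hW, twoFormBilin_swap, hA2]
      rw [hform, hsplit, hsplit, stdSymplectic_apply]
      simp only [map_add, add_apply]
      rw [h1, h2, h3, hA2]
      ring
    · have h1 := hA1 p
      have h2 := hLg (0, p)
      rw [h] at h2
      exact Eq.mp (congrArg (fun w : E' => w ∈ (Γ x : Submodule ℝ E')) h2) h1

/-- A map with prescribed vertical derivative over the region where `χ = 1`. -/
theorem hasFDerivAt_add_vertical {F V : Type*} [NormedAddCommGroup F] [NormedSpace ℝ F]
    [NormedAddCommGroup V] [NormedSpace ℝ V] {g : E × F → V} {k : E → F →L[ℝ] V} {q : E}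
    (hg : DifferentiableAt ℝ g (q, 0)) (hk : DifferentiableAt ℝ k q) (p : F) :
    fderiv ℝ (fun z => g z + k z.1 z.2) (q, 0) (0, p) = fderiv ℝ g (q, 0) (0, p) + k q p := by
  have h1 : HasFDerivAt (fun z : E × F => k z.1) _ (q, 0) :=
    HasFDerivAt.comp (f := Prod.fst) (q, (0 : F)) hk.hasFDerivAt hasFDerivAt_fst
  have h2 := hg.hasFDerivAt.add (h1.clm_apply (u := Prod.snd) hasFDerivAt_snd)
  have h3 := congrArg (fun f : E × F →L[ℝ] V => f (0, p)) h2.fderiv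
  refine Eq.trans h3 ?_
  simp

/-- In coordinates one adds `k q p`, where `k` is `χ` times the difference between `A` and the
present vertical derivative. Values on the zero section are unchanged, and the vertical derivative
becomes `A` where `χ = 1`. At a point already adapted the present derivative is `A`, so `k` vanishes
there and adaptedness survives. -/
theorem exists_firstOrder_modification [T2Space N] {m : ℕ} (hm : Module.finrank ℝ E = m)
    {Ω : ∀ y : M, TangentSpace J y [⋀^Fin 2]→L[ℝ] ℝ}
    (hΩ : IsSmoothForm J Ω) {ι : N → M} (hι : ContMDiff I J ∞ ι)
    (hN : ∀ x, IsLagrangianSubspace (Ω (ι x)) (mfderiv I J ι x).range)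
    {Γ : ∀ x : N, Submodule ℝ (TangentSpace J (ι x))} (hΓ : IsSmoothDistributionAlong I J m ι Γ)
    (hΓL : ∀ x, IsLagrangianSubspace (Ω (ι x)) (Γ x))
    (hΓN : ∀ x, Γ x ⊓ (mfderiv I J ι x).range = ⊥) (x₀ : N) :
    ∃ V ∈ 𝓝 x₀, ∀ Φ : CotangentBundle I N → M, (∀ x, IsSmoothExtensionAt I J ι Φ x) →
      ∃ Ψ : CotangentBundle I N → M, (∀ x, IsSmoothExtensionAt I J ι Ψ x) ∧
        (∀ x, IsFirstOrderAdapted I J Ω Γ Φ x → IsFirstOrderAdapted I J Ω Γ Ψ x) ∧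
        ∀ x ∈ V, IsFirstOrderAdapted I J Ω Γ Ψ x := by
  obtain ⟨D₀, hD₀, A, hA⟩ := exists_dual_frame hm hΩ hι hN hΓ hΓN x₀
  set c := extChartAt I x₀ with hc
  set d := extChartAt J (ι x₀) with hd
  have hx₀ : x₀ ∈ c.source := mem_extChartAt_source x₀
  obtain ⟨D, hDD, hDo, hxD⟩ := mem_nhds_iff.1 hD₀
  obtain ⟨r, hr, hrD⟩ := Metric.nhds_basis_closedBall.mem_iff.1 (hDo.mem_nhds hxD)
  let χ : ContDiffBump (c x₀) := ⟨r / 2, r, by linarith, by linarith⟩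
  set K := Metric.closedBall (c x₀) r with hK
  have hKt : K ⊆ c.target := fun q hq => (hA q (hDD (hrD hq))).1
  have hχK : ∀ q, q ∉ K → χ q = 0 := fun q hq => by
    have : q ∉ Function.support χ := by
      rw [χ.support_eq]
      exact fun h => hq (Metric.ball_subset_closedBall h)
    simpa using this
  refine ⟨c.source ∩ c ⁻¹' Metric.ball (c x₀) (r / 2), Filter.inter_mem (extChartAt_source_mem_nhds x₀)
    ((continuousAt_extChartAt x₀).preimage_mem_nhds (Metric.ball_mem_nhds _ (half_pos hr))),
    fun Φ hΦ => ?_⟩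
  set G := Φ ∘ (cotangentChart I x₀).symm with hG
  set g := d ∘ G with hg
  have hGx : ∀ q ∈ c.target, G (q, 0) = ι (c.symm q) ∧
      ∀ᶠ z in 𝓝 (q, (0 : E →L[ℝ] ℝ)), ContMDiffAt 𝓘(ℝ, E × (E →L[ℝ] ℝ)) J ∞ G z := fun q hq => by
    have := (isSmoothExtensionAt_iff (J := J) (ι := ι) (Φ := Φ) (c.map_target hq)
      (Filter.EventuallyEq.refl _ G)).1 (hΦ _)
    rwa [← hc, c.right_inv hq] at this
  have hGd : ∀ q ∈ D, ∀ᶠ z in 𝓝 (q, (0 : E →L[ℝ] ℝ)),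
      ContMDiffAt 𝓘(ℝ, E × (E →L[ℝ] ℝ)) J ∞ G z ∧ G z ∈ d.source := fun q hq => by
    obtain ⟨h1, h2, -⟩ := hA q (hDD hq)
    refine (hGx q h1).2.and ((hGx q h1).2.self_of_nhds.continuousAt.eventually_mem
      ((isOpen_extChartAt_source (ι x₀)).mem_nhds ?_))
    rw [(hGx q h1).1]
    exact h2
  have hgc : ∀ q ∈ D, ∀ᶠ z in 𝓝 (q, (0 : E →L[ℝ] ℝ)), ContDiffAt ℝ ∞ g z := fun q hq => by
    filter_upwards [hGd q hq] with z hz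
    exact contDiffAt_extChartAt_comp hz.1 hz.2
  set k : E → (E →L[ℝ] ℝ) →L[ℝ] E' := fun q => χ q • (A q - (fderiv ℝ g (q, 0)).comp
    (ContinuousLinearMap.inr ℝ E (E →L[ℝ] ℝ))) with hk
  have hkc : ∀ q ∈ D, ContDiffAt ℝ ∞ k q := fun q hq => by
    refine χ.contDiff.contDiffAt.smul ((hA q (hDD hq)).2.2.1.sub (ContDiffAt.clm_comp ?_ contDiffAt_const))
    exact ContDiffAt.comp (f := fun q' => (q', (0 : E →L[ℝ] ℝ))) q
      ((hgc q hq).self_of_nhds.fderiv_right (by simp)) (contDiffAt_id.prodMk contDiffAt_const)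
  set g' : E × (E →L[ℝ] ℝ) → E' := fun z => g z + k z.1 z.2 with hg'
  have hg'c : ∀ q ∈ D, ∀ᶠ z in 𝓝 (q, (0 : E →L[ℝ] ℝ)), ContDiffAt ℝ ∞ g' z := fun q hq => by
    filter_upwards [hgc q hq, continuous_fst.continuousAt.eventually_mem
      (x := (q, (0 : E →L[ℝ] ℝ))) (hDo.mem_nhds hq)] with z hz hz'
    exact hz.add (((hkc _ hz').comp z contDiffAt_fst).clm_apply contDiffAt_snd)
  have hg'0 : ∀ q ∈ c.target, g' (q, 0) = d (ι (c.symm q)) := fun q hq => by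
    simp only [hg', map_zero, add_zero, hg, Function.comp_apply, (hGx q hq).1]
  have hg't : ∀ q ∈ D, ∀ᶠ z in 𝓝 (q, (0 : E →L[ℝ] ℝ)), g' z ∈ d.target := fun q hq => by
    obtain ⟨h1, h2, -⟩ := hA q (hDD hq)
    refine (hg'c q hq).self_of_nhds.continuousAt.eventually_mem (extChartAt_target_mem_nhds_of_mem ?_)
    rw [hg'0 q h1]
    exact d.map_source h2
  obtain ⟨Ψ, hΨ1, hΨ2⟩ := exists_glue_chart (Φ := Φ) (G' := d.symm ∘ g') (isCompact_closedBall _ r)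
    hKt (fun q hq => by
      filter_upwards [hGd q (hrD hq)] with z hz hzK
      have h1 : g' z = d (G z) := by
        simp [hg', hk, hχK _ hzK, hg]
      rw [Function.comp_apply, h1, d.left_inv hz.2]
      rfl)
  have hΨG : ∀ q ∈ K, Ψ ∘ (cotangentChart I x₀).symm =ᶠ[𝓝 (q, 0)] d.symm ∘ g' := fun q hq => by
    have := hΨ1 _ (c.map_target (hKt hq))
    rw [← hc, c.right_inv (hKt hq)] at this
    exact this hq
  have hS : ∀ x, IsSmoothExtensionAt I J ι Ψ x := by
    intro x
    by_cases hx : x ∈ c.source ∧ c x ∈ K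
    · have hxD := hrD hx.2
      refine (isSmoothExtensionAt_iff hx.1 (hΨ1 x hx.1 hx.2)).2 ⟨?_, ?_⟩
      · have h2 := (hA _ (hDD hxD)).2.1
        rw [c.left_inv hx.1] at h2
        rw [Function.comp_apply, hg'0 _ (c.map_source hx.1), c.left_inv hx.1, d.left_inv h2]
      · filter_upwards [hg'c _ hxD, hg't _ hxD] with z hz hz'
        exact (contMDiffAt_extChartAt_symm hz').comp z hz.contMDiffAt
    · exact (hΦ x).congr (hΨ2 x hx).symm
  have hFO : ∀ q ∈ K, (χ q = 1 ∨ IsFirstOrderAdapted I J Ω Γ Φ (c.symm q)) →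
      IsFirstOrderAdapted I J Ω Γ Ψ (c.symm q) := by
    intro q hq h
    have hqD := hrD hq
    obtain ⟨h1, h2, -, h3, h4, h5⟩ := hA q (hDD hqD)
    have hev : ∀ᶠ q' in 𝓝 q, q' ∈ D := hDo.mem_nhds hqD
    refine (isFirstOrderAdapted_iff_fderiv hι hN hΓL h1 h2 h3 h4 h5 (hS _) (hΨG q hq) ?_).2
      fun p => ?_
    · filter_upwards [hev] with q' hq'
      obtain ⟨h1', h2', -⟩ := hA q' (hDD hq')
      rw [Function.comp_apply, hg'0 _ h1', d.left_inv h2']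
    · have h6 : d ∘ (d.symm ∘ g') =ᶠ[𝓝 (q, 0)] g' := by
        filter_upwards [hg't q hqD] with z hz
        exact d.right_inv hz
      rw [← hd, h6.fderiv_eq, hasFDerivAt_add_vertical
        ((hgc q hqD).self_of_nhds.differentiableAt (by simp))
        ((hkc q hqD).differentiableAt (by simp))]
      rcases h with h | h
      · simp [hk, h]
      · have h7 := (isFirstOrderAdapted_iff_fderiv hι hN hΓL h1 h2 h3 h4 h5 (hΦ _)
          (Filter.EventuallyEq.refl _ G) (by
            filter_upwards [hev] with q' hq'
            exact (hGx q' (hA q' (hDD hq')).1).1)).1 h p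
        have h8 : fderiv ℝ g (q, 0) (0, p) = A q p := h7
        simp [hk, h8]
  refine ⟨Ψ, hS, fun x hΦx => ?_, fun x hx => ?_⟩
  · by_cases hx : x ∈ c.source ∧ c x ∈ K
    · have := hFO (c x) hx.2
      rw [c.left_inv hx.1] at this
      exact this (Or.inr hΦx)
    · exact hΦx.congr (hΨ2 x hx).symm
  · have hxK : c x ∈ K := Metric.ball_subset_closedBall (Metric.ball_subset_ball (by linarith) hx.2)
    have := hFO (c x) hxK
    rw [c.left_inv hx.1] at this
    exact this (Or.inl (χ.one_of_mem_closedBall (Metric.ball_subset_closedBall hx.2)))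

/-- The starting point of all corrections, constant along the fibres. -/
theorem isSmoothExtensionAt_comp_proj {ι : N → M} (hι : ContMDiff I J ∞ ι) (x : N) :
    IsSmoothExtensionAt I J ι (fun p : CotangentBundle I N => ι p.proj) x :=
  ⟨rfl, Filter.Eventually.of_forall fun _ => (hι.comp
    (Bundle.contMDiff_proj (n := ∞) (IB := I) (fun x : N => TangentSpace I x →L[ℝ] ℝ))).contMDiffAt⟩

/-- A symplectic germ along the zero section extending `ι` and tangent to `Γ`. -/
theorem exists_symplectic_germ [CompactSpace N] [T2Space N] {m : ℕ} (hm : Module.finrank ℝ E = m)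
    {Ω : ∀ y : M, TangentSpace J y [⋀^Fin 2]→L[ℝ] ℝ}
    (hΩ : IsSmoothForm J Ω) (hcl : ∀ y, formExtDeriv J Ω y = 0) {ι : N → M} (hι : ContMDiff I J ∞ ι)
    (hN : ∀ x, IsLagrangianSubspace (Ω (ι x)) (mfderiv I J ι x).range)
    {Γ : ∀ x : N, Submodule ℝ (TangentSpace J (ι x))} (hΓ : IsSmoothDistributionAlong I J m ι Γ)
    (hΓL : ∀ x, IsLagrangianSubspace (Ω (ι x)) (Γ x))
    (hΓN : ∀ x, Γ x ⊓ (mfderiv I J ι x).range = ⊥) :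
    ∃ Φ : CotangentBundle I N → M, ∀ x, (IsSmoothExtensionAt I J ι Φ x ∧
      IsFirstOrderAdapted I J Ω Γ Φ x) ∧ IsSymplecticNear I J Ω Φ x := by
  -- Two rounds of patching: what the first gains becomes part of what the second must preserve.
  obtain ⟨Φ, hΦ⟩ := exists_forall_of_local_modification
    (exists_firstOrder_modification hm hΩ hι hN hΓ hΓL hΓN) (isSmoothExtensionAt_comp_proj hι)
  exact exists_forall_of_local_modification (exists_symplectic_modification hΩ hcl) hΦ

end

/-! ## The inverse function theorem on manifolds and immersions -/

section

variable {E : Type*} [NormedAddCommGroup E] [NormedSpace ℝ E] [CompleteSpace E]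
  {H : Type*} [TopologicalSpace H] {I : ModelWithCorners ℝ E H} [I.Boundaryless]
  {X : Type*} [TopologicalSpace X] [ChartedSpace H X] [IsManifold I ∞ X]
  {E' : Type*} [NormedAddCommGroup E'] [NormedSpace ℝ E']
  {M : Type*} [TopologicalSpace M] [ChartedSpace E' M] [IsManifold 𝓘(ℝ, E') ∞ M]

/-- The inverse function theorem for maps between manifolds. -/
theorem exists_openPartialHomeomorph_of_contMDiffAt {f : X → M} {p : X}
    (hf : ∀ᶠ x in 𝓝 p, ContMDiffAt I 𝓘(ℝ, E') ∞ f x) {A : E ≃L[ℝ] E'}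
    (hA : (mfderiv I 𝓘(ℝ, E') f p : E →L[ℝ] E') = (A : E →L[ℝ] E')) :
    ∃ ψ : OpenPartialHomeomorph X M, p ∈ ψ.source ∧ EqOn f ψ ψ.source ∧
      ContMDiffOn I 𝓘(ℝ, E') ∞ ψ ψ.source ∧ ContMDiffOn 𝓘(ℝ, E') I ∞ ψ.symm ψ.target := by
  set e := extChartAt I p with he
  set d := extChartAt 𝓘(ℝ, E') (f p) with hd
  have hp : p ∈ e.source := mem_extChartAt_source p
  have hfp : f p ∈ d.source := mem_extChartAt_source (f p)
  set F : E → E' := d ∘ f ∘ e.symm with hF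
  have hsymm : Filter.Tendsto e.symm (𝓝 (e p)) (𝓝 p) := by
    have := (contMDiffAt_extChartAt_symm (I := I) (e.map_source hp)).continuousAt
    rwa [ContinuousAt, ← he, e.left_inv hp] at this
  have hev : ∀ᶠ z in 𝓝 (e p), z ∈ e.target ∧ ContMDiffAt I 𝓘(ℝ, E') ∞ f (e.symm z) ∧
      f (e.symm z) ∈ d.source :=
    Filter.Eventually.and (extChartAt_target_mem_nhds_of_mem (e.map_source hp)) ((hsymm.eventually hf).and
      (hsymm.eventually (hf.self_of_nhds.continuousAt.eventually_mem
        ((isOpen_extChartAt_source (f p)).mem_nhds hfp))))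
  have hFc : ∀ z, z ∈ e.target ∧ ContMDiffAt I 𝓘(ℝ, E') ∞ f (e.symm z) ∧ f (e.symm z) ∈ d.source →
      ContDiffAt ℝ ∞ F z := fun z ⟨h1, h2, h3⟩ =>
    ((contMDiffAt_extChartAt_of_mem h3).comp z
      (h2.comp z (contMDiffAt_extChartAt_symm h1))).contDiffAt
  have hFp : ContDiffAt ℝ ∞ F (e p) := hFc _ hev.self_of_nhds
  have hFA : HasFDerivAt F (A : E →L[ℝ] E') (e p) := by
    have h1 := (hFp.differentiableAt (by simp)).hasFDerivAt
    have h2 : (mfderiv I 𝓘(ℝ, E') f p : E →L[ℝ] E') = fderivWithin ℝ F (range I) (e p) :=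
      (hf.self_of_nhds.mdifferentiableAt (by simp)).mfderiv
    rw [I.range_eq_univ, fderivWithin_univ] at h2
    rwa [← h2, hA] at h1
  -- Invertibility is needed on a whole neighbourhood, since the inverse must be smooth on all of
  -- `ψ.target`.
  have hinv : ∀ᶠ z in 𝓝 (e p), ∃ B : E ≃L[ℝ] E', (B : E →L[ℝ] E') = fderiv ℝ F z := by
    have h1 : ContinuousAt (fderiv ℝ F) (e p) := (hFp.fderiv_right (m := 0) (by simp)).continuousAt
    have h2 : range ((↑) : (E ≃L[ℝ] E') → E →L[ℝ] E') ∈ 𝓝 (fderiv ℝ F (e p)) := by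
      rw [hFA.fderiv]
      exact A.nhds
    exact h1.eventually_mem h2
  obtain ⟨G, hG, hGo, hpG⟩ := mem_nhds_iff.1 (hev.and hinv)
  set F₀ := hFp.toOpenPartialHomeomorph F hFA (by simp) with hF₀
  set ψ : OpenPartialHomeomorph X M := ((chartAt H p).trans
    (I.toHomeomorph.toOpenPartialHomeomorph.trans ((F₀.restr G)))).trans
      (chartAt E' (f p)).symm with hψ
  have hψs : ∀ x ∈ ψ.source, x ∈ e.source ∧ e x ∈ F₀.source ∧ e x ∈ G := by
    intro x hx
    simp only [hψ, OpenPartialHomeomorph.trans_source, OpenPartialHomeomorph.restr_source,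
      hGo.interior_eq, mem_inter_iff, mem_preimage] at hx
    rw [he, extChartAt_source]
    exact ⟨hx.1.1, hx.1.2.2⟩
  have hψe : ∀ x, ψ x = d.symm (F (e x)) := fun x => rfl
  have hψf : EqOn f ψ ψ.source := fun x hx => by
    obtain ⟨h1, h2, h3⟩ := hψs x hx
    have h4 := (hG h3).1.2.2
    rw [e.left_inv h1] at h4
    rw [hψe, hF, Function.comp_apply, Function.comp_apply, e.left_inv h1, d.left_inv h4]
  have hψsymm : ∀ y, ψ.symm y = e.symm (F₀.symm (d y)) := fun y => rfl
  refine ⟨ψ, ?_, hψf, ?_, ?_⟩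
  · simp only [hψ, OpenPartialHomeomorph.trans_source, OpenPartialHomeomorph.restr_source,
      hGo.interior_eq, mem_inter_iff, mem_preimage]
    refine ⟨⟨mem_chart_source H p, trivial, ?_, hpG⟩, ?_⟩
    · exact hFp.mem_toOpenPartialHomeomorph_source hFA (by simp)
    · change F (e p) ∈ (chartAt E' (f p)).target
      rw [hF, Function.comp_apply, Function.comp_apply, e.left_inv hp]
      exact mem_chart_target E' (f p)
  · intro x hx
    obtain ⟨h1, h2, h3⟩ := hψs x hx
    have h4 := (hG h3).1.2.1
    rw [e.left_inv h1] at h4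
    refine (h4.congr_of_eventuallyEq ?_).contMDiffWithinAt
    filter_upwards [ψ.open_source.mem_nhds hx] with x' hx'
    exact (hψf hx').symm
  · intro y hy
    have hx := ψ.map_target hy
    obtain ⟨h1, h2, h3⟩ := hψs _ hx
    have hyd : y ∈ d.source := by
      have h4 := (hG h3).1.2.2
      rwa [e.left_inv h1, hψf hx, ψ.right_inv hy] at h4
    have hyF : d y ∈ F₀.target := by
      have h4 : F (e (ψ.symm y)) = d y := by
        have h5 := hψf hx
        rw [ψ.right_inv hy] at h5
        rw [hF, Function.comp_apply, Function.comp_apply, e.left_inv h1, h5]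
      rw [← h4]
      exact F₀.map_source h2
    have hz : e (ψ.symm y) = F₀.symm (d y) := by
      have h4 : d y = F₀ (e (ψ.symm y)) := by
        change _ = F (e (ψ.symm y))
        have h5 := hψf hx
        rw [ψ.right_inv hy] at h5
        rw [hF, Function.comp_apply, Function.comp_apply, e.left_inv h1, h5]
      rw [h4, F₀.left_inv h2]
    rw [hz] at h3
    obtain ⟨B, hB⟩ := (hG h3).2
    have h6 : ContDiffAt ℝ ∞ F₀.symm (d y) := by
      refine F₀.contDiffAt_symm (f₀' := B) hyF ?_ (hFc _ (hG h3).1)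
      rw [hB]
      exact ((hFc _ (hG h3).1).differentiableAt (by simp)).hasFDerivAt
    refine ContMDiffAt.contMDiffWithinAt ?_
    have h7 : ContMDiffAt 𝓘(ℝ, E') I ∞ (e.symm ∘ (F₀.symm ∘ d)) y :=
      (contMDiffAt_extChartAt_symm (hG h3).1.1).comp y
        (h6.contMDiffAt.comp y (contMDiffAt_extChartAt_of_mem hyd))
    exact h7

/-- A local diffeomorphism, restricted to an open subset, is an immersion. -/
theorem isImmersionAtOfComplement_of_openPartialHomeomorph (A : E ≃L[ℝ] E') {f : X → M}
    {U : TopologicalSpace.Opens X} (y : U) {ψ : OpenPartialHomeomorph X M} (hy : (y : X) ∈ ψ.source)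
    (hψ : EqOn f ψ ψ.source) (hψs : ContMDiffOn I 𝓘(ℝ, E') ∞ ψ ψ.source)
    (hψi : ContMDiffOn 𝓘(ℝ, E') I ∞ ψ.symm ψ.target) :
    Manifold.IsImmersionAtOfComplement PUnit.{1} I 𝓘(ℝ, E') ∞ (fun x : U => f x) y := by
  set e := extChartAt I (y : X) with he
  -- A chart of `M` in which `f` is the linear map `A`: undo `f` by `ψ.symm`, then apply the chart
  -- of `X` and `A`. The complement of the immersion is therefore trivial.
  set κ : OpenPartialHomeomorph M E' := ψ.symm.trans ((chartAt H (y : X)).trans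
    (I.toHomeomorph.trans A.toHomeomorph).toOpenPartialHomeomorph) with hκ
  have hκs : κ.source = ψ.target ∩ ψ.symm ⁻¹' e.source := by
    rw [he, extChartAt_source]
    simp [hκ]
  have hκa : ∀ m, κ m = A (e (ψ.symm m)) := fun m => rfl
  have hκsymm : ∀ z, κ.symm z = ψ (e.symm (A.symm z)) := fun z => rfl
  have hκ1 : ContMDiffOn 𝓘(ℝ, E') 𝓘(ℝ, E') ∞ κ κ.source := by
    intro m hm
    rw [hκs] at hm
    have h1 := hψi.contMDiffAt (ψ.open_target.mem_nhds hm.1)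
    have h2 : ContMDiffAt 𝓘(ℝ, E') 𝓘(ℝ, E') ∞ (A ∘ (e ∘ ψ.symm)) m :=
      A.contDiff.contMDiff.contMDiffAt.comp m ((contMDiffAt_extChartAt_of_mem hm.2).comp m h1)
    exact h2.contMDiffWithinAt
  have hκ2 : ContMDiffOn 𝓘(ℝ, E') 𝓘(ℝ, E') ∞ κ.symm κ.target := by
    intro z hz
    have h1 := κ.map_target hz
    have h5 := κ.right_inv hz
    rw [hκs] at h1
    have h3 : A.symm z = e (ψ.symm (κ.symm z)) := by
      rw [← A.symm_apply_apply (e (ψ.symm (κ.symm z))), ← hκa, h5]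
    have h2 : A.symm z ∈ e.target := by
      rw [h3]
      exact e.map_source h1.2
    have h4 : e.symm (A.symm z) ∈ ψ.source := by
      rw [h3, e.left_inv h1.2]
      exact ψ.map_target h1.1
    have h6 : ContMDiffAt 𝓘(ℝ, E') 𝓘(ℝ, E') ∞ (ψ ∘ (e.symm ∘ A.symm)) z :=
      (hψs.contMDiffAt (ψ.open_source.mem_nhds h4)).comp z
        ((contMDiffAt_extChartAt_symm h2).comp z A.symm.contDiff.contMDiff.contMDiffAt)
    exact h6.contMDiffWithinAt
  have hO : IsOpen ((Subtype.val : U → X) ⁻¹' ψ.source) := ψ.open_source.preimage continuous_subtype_val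
  have hmem : ∀ x : X, x ∈ ψ.source → x ∈ e.source → f x ∈ κ.source := by
    intro x hx hxe
    rw [hκs, hψ hx]
    refine ⟨ψ.map_source hx, ?_⟩
    rwa [mem_preimage, ψ.left_inv hx]
  have hfc : ContinuousAt (fun x : U => f x) y := by
    refine ContinuousAt.comp (g := f) (f := Subtype.val) ?_ continuous_subtype_val.continuousAt
    exact (ψ.continuousAt hy).congr (Filter.eventuallyEq_of_mem (ψ.open_source.mem_nhds hy) hψ.symm)
  refine Manifold.IsImmersionAtOfComplement.mk_of_continuousAt hfc
    ((ContinuousLinearEquiv.prodUnique ℝ E PUnit.{1}).trans A)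
    ((chartAt H y).restr (Subtype.val ⁻¹' ψ.source)) κ ?_ ?_ ?_ ?_ ?_
  · rw [OpenPartialHomeomorph.restr_source, hO.interior_eq]
    exact ⟨mem_chart_source H y, hy⟩
  · exact hmem _ hy (mem_extChartAt_source _)
  · exact restr_mem_maximalAtlas (contDiffGroupoid ∞ I) (IsManifold.chart_mem_maximalAtlas y) hO
  · exact κ.mem_maximalAtlas_of_contMDiffOn hκ1 hκ2
  · intro z hz
    have hz0 : I.symm z ∈ ((chartAt H y).restr (Subtype.val ⁻¹' ψ.source)).target := by
      rw [OpenPartialHomeomorph.extend_target] at hz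
      exact hz.1
    have hz1 : ((chartAt H y).restr (Subtype.val ⁻¹' ψ.source)).symm (I.symm z) ∈
        ((chartAt H y).restr (Subtype.val ⁻¹' ψ.source)).source :=
      ((chartAt H y).restr (Subtype.val ⁻¹' ψ.source)).map_target hz0
    have hz2 := ((chartAt H y).restr (Subtype.val ⁻¹' ψ.source)).right_inv hz0
    rw [OpenPartialHomeomorph.restr_source, hO.interior_eq] at hz1
    set x : U := ((chartAt H y).restr (Subtype.val ⁻¹' ψ.source)).symm (I.symm z) with hx
    have h1 : chartAt H (y : X) (x : X) = I.symm z := hz2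
    have h2 : e x = z := by
      change I (chartAt H (y : X) x) = z
      rw [h1, I.right_inv (by simp [I.range_eq_univ])]
    change κ (f x) = A z
    rw [hψ hz1.2, hκa, ψ.left_inv hz1.2, h2]

end

/-! ## From the germ to an embedding -/

section

variable {E : Type} [NormedAddCommGroup E] [NormedSpace ℝ E] [FiniteDimensional ℝ E]
  {H : Type*} [TopologicalSpace H] {I : ModelWithCorners ℝ E H} [I.Boundaryless]
  {N : Type*} [TopologicalSpace N] [ChartedSpace H N] [IsManifold I ∞ N]
  {E' : Type} [NormedAddCommGroup E'] [NormedSpace ℝ E'] [FiniteDimensional ℝ E']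
  {H' : Type*} [TopologicalSpace H'] {J : ModelWithCorners ℝ E' H'} [J.Boundaryless]
  {M : Type*} [TopologicalSpace M] [ChartedSpace H' M] [IsManifold J ∞ M]

theorem canonicalForm_mfderiv_symm (P : CotangentBundle I N) {z : E × (E →L[ℝ] ℝ)}
    (hz : z ∈ (extChartAt (cotangentModel I) P).target) (a b : E × (E →L[ℝ] ℝ)) :
    twoFormBilin (E × (E →L[ℝ] ℝ)) (canonicalForm I ((extChartAt (cotangentModel I) P).symm z))
      (mfderiv 𝓘(ℝ, E × (E →L[ℝ] ℝ)) (cotangentModel I) (extChartAt (cotangentModel I) P).symm z a :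
        E × (E →L[ℝ] ℝ))
      (mfderiv 𝓘(ℝ, E × (E →L[ℝ] ℝ)) (cotangentModel I) (extChartAt (cotangentModel I) P).symm z b :
        E × (E →L[ℝ] ℝ)) = b.2 a.1 - a.2 b.1 := by
  rw [← stdSymplectic_apply, ← formPullback_symm_canonicalForm P hz]
  exact (twoFormBilin_comp (Z := E × (E →L[ℝ] ℝ)) (Y := E × (E →L[ℝ] ℝ)) (canonicalForm I _)
    (mfderiv 𝓘(ℝ, E × (E →L[ℝ] ℝ)) (cotangentModel I) (extChartAt (cotangentModel I) P).symm z) a b).symm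

/-- Read in a chart, the form is the invertible `stdSymplectic`. -/
theorem canonicalForm_nondegenerate (p : CotangentBundle I N) (v : E × (E →L[ℝ] ℝ))
    (h : ∀ w, twoFormBilin (E × (E →L[ℝ] ℝ)) (canonicalForm I p) v w = 0) : v = 0 := by
  have hz := mem_extChartAt_target (I := cotangentModel I) p
  have hp := extChartAt_to_inv (I := cotangentModel I) p
  have hv := mfderiv_extChartAt_symm_comp (J := cotangentModel I) (y₀ := p) hz v
  set a : E × (E →L[ℝ] ℝ) := mfderiv (cotangentModel I) 𝓘(ℝ, E × (E →L[ℝ] ℝ))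
    (extChartAt (cotangentModel I) p)
    ((extChartAt (cotangentModel I) p).symm (extChartAt (cotangentModel I) p p)) v with ha
  have h1 : twoFormBilin _ (stdSymplectic E) a = 0 := ContinuousLinearMap.ext fun b => by
    rw [stdSymplectic_apply, ← canonicalForm_mfderiv_symm p hz, hv, hp]
    exact h _
  have h2 : a = 0 := by
    obtain ⟨e, he⟩ := isInvertible_stdSymplectic E
    rw [← he] at h1
    exact e.injective (h1.trans (map_zero e).symm)
  rw [← hv, h2]
  exact map_zero _

theorem twoFormBilin_formPullback (Ω : ∀ y : M, TangentSpace J y [⋀^Fin 2]→L[ℝ] ℝ)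
    (Φ : CotangentBundle I N → M) (p : CotangentBundle I N) (v w : E × (E →L[ℝ] ℝ)) :
    twoFormBilin (E × (E →L[ℝ] ℝ)) (formPullback (cotangentModel I) J Φ Ω p) v w =
      twoFormBilin E' (Ω (Φ p)) (mfderiv (cotangentModel I) J Φ p v : E')
        (mfderiv (cotangentModel I) J Φ p w : E') :=
  twoFormBilin_comp (Z := E × (E →L[ℝ] ℝ)) (Y := E') (Ω (Φ p)) (mfderiv (cotangentModel I) J Φ p) v w

/-- A vector killed by the differential pairs to zero with everything under the pulled back form,
which is nondegenerate; equality of dimensions upgrades injectivity to an isomorphism. -/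
theorem exists_equiv_mfderiv (hdim : Module.finrank ℝ E' = 2 * Module.finrank ℝ E)
    {Ω : ∀ y : M, TangentSpace J y [⋀^Fin 2]→L[ℝ] ℝ}
    {Φ : CotangentBundle I N → M} {p : CotangentBundle I N}
    (hp : formPullback (cotangentModel I) J Φ Ω p = canonicalForm I p) :
    ∃ A : (E × (E →L[ℝ] ℝ)) ≃L[ℝ] E', (mfderiv (cotangentModel I) J Φ p :
      E × (E →L[ℝ] ℝ) →L[ℝ] E') = (A : E × (E →L[ℝ] ℝ) →L[ℝ] E') := by
  set L : E × (E →L[ℝ] ℝ) →L[ℝ] E' := mfderiv (cotangentModel I) J Φ p with hL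
  have hinj : Function.Injective L := by
    refine (injective_iff_map_eq_zero _).2 fun v hv => canonicalForm_nondegenerate p v fun w => ?_
    have h1 := twoFormBilin_formPullback Ω Φ p v w
    rw [hp] at h1
    refine h1.trans ?_
    change twoFormBilin E' (Ω (Φ p)) (L v) (L w) = 0
    rw [hv, map_zero, zero_apply]
  have hd : Module.finrank ℝ (E × (E →L[ℝ] ℝ)) = Module.finrank ℝ E' := by
    have h1 : Module.finrank ℝ (E →L[ℝ] ℝ) = Module.finrank ℝ E :=
      ((Subspace.dual_finrank_eq (K := ℝ) (V := E)).symm.trans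
        (LinearMap.toContinuousLinearMap.finrank_eq)).symm
    rw [Module.finrank_prod, h1, hdim]
    ring
  exact ⟨(LinearMap.linearEquivOfInjective L.toLinearMap hinj hd).toContinuousLinearEquiv, rfl⟩

/-- If the image of `w` lies in `Γ x`, it is orthogonal to the images of vertical vectors, which
also lie in `Γ x`. Hence `w` is orthogonal to the vertical space for the canonical form, every
covector annihilates its base component, and `w` is vertical. -/
theorem map_fibreTangent_eq (hdim : Module.finrank ℝ E' = 2 * Module.finrank ℝ E)
    {Ω : ∀ y : M, TangentSpace J y [⋀^Fin 2]→L[ℝ] ℝ} {ι : N → M}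
    {Γ : ∀ x : N, Submodule ℝ (TangentSpace J (ι x))}
    (hΓL : ∀ x, IsLagrangianSubspace (Ω (ι x)) (Γ x)) {Φ : CotangentBundle I N → M} {x : N}
    (h0 : Φ (zeroCovector I x) = ι x) (hΦ : IsFirstOrderAdapted I J Ω Γ Φ x) :
    ((fibreTangent I (zeroCovector I x)).map
      (mfderiv (cotangentModel I) J Φ (zeroCovector I x)).toLinearMap : Submodule ℝ E') =
      (Γ x : Submodule ℝ E') := by
  obtain ⟨A, hA⟩ := exists_equiv_mfderiv hdim hΦ.1
  refine le_antisymm ?_ fun v hv => ?_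
  · rintro _ ⟨u, hu, rfl⟩
    exact hΦ.2 u hu
  · obtain ⟨w, rfl⟩ := A.surjective v
    refine ⟨w, ?_, congrArg (fun f : E × (E →L[ℝ] ℝ) →L[ℝ] E' => f w) hA⟩
    have hx := mem_extChartAt_source (I := I) x
    have ht := (extChartAt I x).map_source hx
    have htc : (extChartAt I x x, (0 : E →L[ℝ] ℝ)) ∈ (cotangentChart I x).target :=
      mem_cotangentChart_target.2 ht
    have hs0 : (cotangentChart I x).symm (extChartAt I x x, 0) = zeroCovector I x := by
      rw [cotangentChart_symm_zero ht, (extChartAt I x).left_inv hx]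
    have hw := mfderiv_extChartAt_symm_comp (J := cotangentModel I) (y₀ := zeroCovector I x) htc w
    set a : E × (E →L[ℝ] ℝ) := mfderiv (cotangentModel I) 𝓘(ℝ, E × (E →L[ℝ] ℝ)) (cotangentChart I x)
      ((cotangentChart I x).symm (extChartAt I x x, 0)) w with ha
    have key : ∀ p : E →L[ℝ] ℝ, p a.1 = 0 := by
      intro p
      have hu := (mem_fibreTangent_iff hx _).2 ⟨p, rfl⟩
      set u : E × (E →L[ℝ] ℝ) := mfderiv 𝓘(ℝ, E × (E →L[ℝ] ℝ)) (cotangentModel I)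
        (cotangentChart I x).symm (extChartAt I x x, 0) ((0, p) : E × (E →L[ℝ] ℝ)) with hudef
      have h1 := canonicalForm_mfderiv_symm (zeroCovector I x) htc a (0, p)
      rw [hs0] at h1
      have h1' := (congrArg (fun w' : E × (E →L[ℝ] ℝ) => twoFormBilin (E × (E →L[ℝ] ℝ))
        (canonicalForm I (zeroCovector I x)) w' u) hw).symm.trans h1
      have h2 := twoFormBilin_formPullback Ω Φ (zeroCovector I x) w u
      have h2' := (congrArg (fun β : (E × (E →L[ℝ] ℝ)) [⋀^Fin 2]→L[ℝ] ℝ =>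
        twoFormBilin (E × (E →L[ℝ] ℝ)) β w u) hΦ.1).symm.trans h2
      have h3 := hΦ.2 _ hu
      have h4 : (mfderiv (cotangentModel I) J Φ (zeroCovector I x) w : E') = A w :=
        congrArg (fun f : E × (E →L[ℝ] ℝ) →L[ℝ] E' => f w) hA
      have h5 : (Ω (Φ (zeroCovector I x)) : E' [⋀^Fin 2]→L[ℝ] ℝ) = Ω (ι x) := by rw [h0]
      have h6 := (twoFormBilin_apply (Z := E') (Ω (ι x)) _ _).trans ((hΓL x _).1 hv _ h3)
      rw [h4, h5] at h2'
      have h7 : p a.1 - a.2 0 = 0 := h1'.symm.trans (h2'.trans h6)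
      simpa using h7
    have ha1 : a.1 = 0 := by
      by_contra hne
      obtain ⟨g, hg⟩ := SeparatingDual.exists_ne_zero (R := ℝ) hne
      exact hg (key g)
    refine (mem_fibreTangent_iff hx w).2 ⟨a.2, ?_⟩
    rw [← hw]
    congr 1
    exact Prod.ext ha1 rfl

end

/-! ### Injectivity near the compact zero section -/

section

variable {E : Type} [NormedAddCommGroup E] [NormedSpace ℝ E] [FiniteDimensional ℝ E]
  {H : Type*} [TopologicalSpace H] {I : ModelWithCorners ℝ E H} [I.Boundaryless]
  {N : Type*} [TopologicalSpace N] [CompactSpace N] [ChartedSpace H N] [IsManifold I ∞ N]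
  {E' : Type} [NormedAddCommGroup E'] [NormedSpace ℝ E'] [FiniteDimensional ℝ E']
  {M : Type*} [TopologicalSpace M] [T2Space M] [ChartedSpace E' M] [IsManifold 𝓘(ℝ, E') ∞ M]

/-- A symplectic germ along the compact zero section is an embedding of a neighbourhood. -/
theorem exists_isSmoothEmbedding (hdim : Module.finrank ℝ E' = 2 * Module.finrank ℝ E)
    {Ω : ∀ y : M, TangentSpace 𝓘(ℝ, E') y [⋀^Fin 2]→L[ℝ] ℝ} {ι : N → M}
    (hι : Function.Injective ι) {Φ : CotangentBundle I N → M}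
    (hS : ∀ x, IsSmoothExtensionAt I 𝓘(ℝ, E') ι Φ x)
    (hΦ : ∀ x, IsSymplecticNear I 𝓘(ℝ, E') Ω Φ x) :
    ∃ U : TopologicalSpace.Opens (CotangentBundle I N), (∀ x : N, zeroCovector I x ∈ U) ∧
      Manifold.IsSmoothEmbedding (cotangentModel I) 𝓘(ℝ, E') ∞ (fun p : U => Φ p) ∧
      ∀ p ∈ U, formPullback (cotangentModel I) 𝓘(ℝ, E') Φ Ω p = canonicalForm I p := by
  set O : Set (CotangentBundle I N) := interior {p | ContMDiffAt (cotangentModel I) 𝓘(ℝ, E') ∞ Φ p ∧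
    formPullback (cotangentModel I) 𝓘(ℝ, E') Φ Ω p = canonicalForm I p} with hO
  have hzO : ∀ x, zeroCovector I x ∈ O := fun x =>
    mem_interior_iff_mem_nhds.2 ((hS x).2.and (hΦ x))
  have hloc : ∀ p ∈ O, ∃ (A : (E × (E →L[ℝ] ℝ)) ≃L[ℝ] E')
      (ψ : OpenPartialHomeomorph (CotangentBundle I N) M), p ∈ ψ.source ∧
      EqOn Φ ψ ψ.source ∧ ContMDiffOn (cotangentModel I) 𝓘(ℝ, E') ∞ ψ ψ.source ∧
      ContMDiffOn 𝓘(ℝ, E') (cotangentModel I) ∞ ψ.symm ψ.target := by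
    intro p hp
    obtain ⟨A, hA⟩ := exists_equiv_mfderiv hdim (interior_subset hp).2
    refine ⟨A, exists_openPartialHomeomorph_of_contMDiffAt ?_ hA⟩
    filter_upwards [isOpen_interior.mem_nhds hp] with p' hp'
    exact (interior_subset hp').1
  -- Injectivity on a compact set together with local injectivity at its points gives injectivity on
  -- a neighbourhood; the local part is the inverse function theorem.
  obtain ⟨t, hto, hst, htinj⟩ := Set.InjOn.exists_isOpen_superset (f := Φ)
    (s := range (zeroCovector I : N → CotangentBundle I N))
    (by
      rintro _ ⟨x, rfl⟩ _ ⟨y, rfl⟩ hxy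
      rw [(hS x).1, (hS y).1] at hxy
      rw [hι hxy])
    (isCompact_range continuous_zeroCovector)
    (by
      rintro _ ⟨x, rfl⟩
      exact (hS x).2.self_of_nhds.continuousAt)
    (by
      rintro _ ⟨x, rfl⟩
      obtain ⟨A, ψ, h1, h2, -⟩ := hloc _ (hzO x)
      exact ⟨ψ.source, ψ.open_source.mem_nhds h1, ψ.injOn.congr h2.symm⟩)
  have hUo : IsOpen (O ∩ t) := isOpen_interior.inter hto
  refine ⟨⟨O ∩ t, hUo⟩, fun x => ⟨hzO x, hst ⟨x, rfl⟩⟩, ⟨?_, ?_⟩, fun p hp =>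
    (interior_subset hp.1).2⟩
  · refine Manifold.IsImmersionOfComplement.isImmersion (F := PUnit.{1}) fun y => ?_
    obtain ⟨A, ψ, h1, h2, h3, h4⟩ := hloc _ y.2.1
    exact isImmersionAtOfComplement_of_openPartialHomeomorph A y h1 h2 h3 h4
  -- Being a local homeomorphism makes the map open, so a continuous inverse on the image needs no
  -- separate argument.
  · refine (IsOpenEmbedding.of_continuous_injective_isOpenMap ?_ ?_ ?_).isEmbedding
    · refine continuous_iff_continuousAt.2 fun y => ?_
      exact ContinuousAt.comp (g := Φ) (f := Subtype.val) (interior_subset y.2.1).1.continuousAt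
        continuous_subtype_val.continuousAt
    · intro y y' h
      exact Subtype.ext (htinj y.2.2 y'.2.2 h)
    · refine IsOpenMap.of_nhds_le fun y => ?_
      obtain ⟨A, ψ, h1, h2, -⟩ := hloc _ y.2.1
      have h5 : Filter.map (Subtype.val : (O ∩ t : Set (CotangentBundle I N)) → CotangentBundle I N) (𝓝 y) =
        𝓝 (y : CotangentBundle I N) := hUo.isOpenEmbedding_subtypeVal.map_nhds_eq y
      have h6 : Φ =ᶠ[𝓝 (y : CotangentBundle I N)] ψ :=
        Filter.eventuallyEq_of_mem (ψ.open_source.mem_nhds h1) h2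
      have h7 : Filter.map Φ (𝓝 (y : CotangentBundle I N)) = 𝓝 (Φ y) := by
        rw [Filter.map_congr h6, ψ.map_nhds_eq h1, h2 h1]
      exact le_of_eq (by rw [← h7, ← h5, Filter.map_map]; rfl)

end

end

/-! ### The main theorem -/

theorem theorem2p3p3 (m : ℕ)
    {M : Type*} [TopologicalSpace M] [T2Space M] [SecondCountableTopology M]
    [ChartedSpace (EuclideanSpace ℝ (Fin (2 * m))) M] [IsManifold (𝓡 (2 * m)) ∞ M]
    (Ω : ∀ y : M, TangentSpace (𝓡 (2 * m)) y [⋀^Fin 2]→L[ℝ] ℝ)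
    (hΩ : IsSymplecticForm (𝓡 (2 * m)) Ω)
    {N : Type*} [TopologicalSpace N] [CompactSpace N]
    [ChartedSpace (EuclideanSpace ℝ (Fin m)) N] [IsManifold (𝓡 m) ∞ N]
    (ι : N → M) (hι : Manifold.IsSmoothEmbedding (𝓡 m) (𝓡 (2 * m)) ∞ ι)
    (hN : ∀ x, IsLagrangianSubspace (Ω (ι x)) (mfderiv (𝓡 m) (𝓡 (2 * m)) ι x).range)
    (Γ : ∀ x : N, Submodule ℝ (TangentSpace (𝓡 (2 * m)) (ι x)))
    (hΓ : IsSmoothDistributionAlong (𝓡 m) (𝓡 (2 * m)) m ι Γ)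
    (hΓL : ∀ x, IsLagrangianSubspace (Ω (ι x)) (Γ x))
    (hΓN : ∀ x, Γ x ⊓ (mfderiv (𝓡 m) (𝓡 (2 * m)) ι x).range = ⊥) :
    ∃ (U : TopologicalSpace.Opens (CotangentBundle (𝓡 m) N)) (Φ : CotangentBundle (𝓡 m) N → M),
      (∀ x : N, zeroCovector (𝓡 m) x ∈ U) ∧
      Manifold.IsSmoothEmbedding (cotangentModel (𝓡 m)) (𝓡 (2 * m)) ∞ (fun p : U => Φ p) ∧
      (∀ x : N, Φ (zeroCovector (𝓡 m) x) = ι x) ∧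
      (∀ p ∈ U, formPullback (cotangentModel (𝓡 m)) (𝓡 (2 * m)) Φ Ω p
        = canonicalForm (𝓡 m) p) ∧
      ∀ x : N, (fibreTangent (𝓡 m) (zeroCovector (𝓡 m) x)).map
          (mfderiv (cotangentModel (𝓡 m)) (𝓡 (2 * m)) Φ (zeroCovector (𝓡 m) x)).toLinearMap
        = Γ x := by
  -- `N` inherits the Hausdorff property from `M`; gluing over charts needs compact subsets of `N`
  -- to be closed.
  have hT : T2Space N := hι.isEmbedding.t2Space
  have hm : Module.finrank ℝ (EuclideanSpace ℝ (Fin m)) = m := by simp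
  have hdim : Module.finrank ℝ (EuclideanSpace ℝ (Fin (2 * m))) =
      2 * Module.finrank ℝ (EuclideanSpace ℝ (Fin m)) := by simp
  obtain ⟨Φ, hΦ⟩ := exists_symplectic_germ hm hΩ.smooth hΩ.closed hι.contMDiff hN hΓ hΓL hΓN
  obtain ⟨U, hU0, hUe, hUs⟩ := exists_isSmoothEmbedding hdim hι.isEmbedding.injective
    (fun x => (hΦ x).1.1) (fun x => (hΦ x).2)
  exact ⟨U, Φ, hU0, hUe, fun x => (hΦ x).1.1.1, hUs, fun x =>
    map_fibreTangent_eq hdim hΓL (hΦ x).1.1.1 (hΦ x).1.2⟩
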